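/- Let $V=V_0\oplus V_1$ be a real super vector space of dimension $n|m$ (for example $V=T_pM$, where $p$ is a point of an $n|m$-dimensional supermanifold $M$). In a homogeneous basis write $x^a$, $a\in\{1,\dots,n,\hat 1,\dots,\hat m\}$, for the components of a vector, with $\tilde a=0$ for $a=1,\dots,n$ and $\tilde a=1$ for $a=\hat1,\dots,\hat m$. Consider smooth superfunctions $L=L(x_1,x_{\hat 1})$ on $V\times(\Pi V\setminus\{0\})$, that is, functions of one even vector $x_1$ and one odd vector $x_{\hat 1}$ with $(x_{\hat1}^{\hat1},\dots,x_{\hat1}^{\hat m})$ nonzero modulo nilpotents. Such an $L$ is a *(Voronov–Zorich) $1|1$-form on $V$* if it satisfies (BER) $L(g\cdot x)=L(x)\,\mathrm{Ber}\,g$ for all $g\in GL(1|1)$, where $(g\cdot x)_F=\sum_G g_F{}^G x_G$; (PDE) $\dfrac{\partial^2 L}{\partial x^A_F\partial x^B_G}+(-1)^{\tilde F\tilde G+\tilde B(\tilde F+\tilde G)}\dfrac{\partial^2L}{\partial x^A_G\partial x^B_F}=0$ for all $F,G\in\{1,\hat1\}$ and all $A,B$ (left derivatives). Let $\mathbb P^{m-1|n}=P(\Pi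 V)$ be the projective superspace with homogeneous coordinates $x_{\hat1}^a$ (of parity $\tilde a+1$); its charts are the loci where some $x_{\hat 1}^{\alpha}$, $\alpha\in\{\hat1,\dots,\hat m\}$, is invertible, with coordinates $u^a=x_{\hat1}^a/x_{\hat1}^\alpha$, $a\ne\alpha$. 1. Every $1|1$-form can be written as $L=x_1^aL_a$ with unique functions $L_a=L_a(x_{\hat1})$, the components of a well-defined differential 1-form $\omega_L:=dx_{\hat1}^a\,L_a$ on $\Pi V\setminus\{0\}$. 2. For any superfunction of the form $L=x_1^aL_a(x_{\hat1})$ on $V\times(\Pi V\setminus\{0\})$, the form $\omega_L=dx_{\hat1}^aL_a$ is closed if and only if $L$ satisfies (PDE). 3. If $L=x_1^aL_a(x_{\hat 1})$ satisfies (BER), then $\omega_L$ descends to $P(\Pi V)$: it is the pull-back of a unique differential 1-form $\overline{\omega_L}$ on $P(\Pi V)$; and $\overline{\omega_L}$ is closed if and only if $L$ satisfies (PDE). 4. The map $L\mapsto\overline{\omega_L}$ is a parity-preserving linear isomorphism from the vector space of $1|1$-forms on $V$ onto the vector space of closed differential 1-forms on $P(\Pi V)$. -/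

import Mathlib

open scoped ContDiff
open TopologicalSpace

noncomputable section

namespace SuperGeom

/-! ### Grassmann algebras and signs -/

/-- The real Grassmann algebra on `N` odd generators. -/
abbrev Grassmann (N : ℕ) : Type := ExteriorAlgebra ℝ (Fin N → ℝ)

/-- The subspace of elements of parity `p` of the Grassmann algebra. -/
def part (N : ℕ) (p : ZMod 2) : Submodule ℝ (Grassmann N) :=
  CliffordAlgebra.evenOdd (0 : QuadraticForm ℝ (Fin N → ℝ)) p

/-- The body (degree zero component) of an element of the Grassmann algebra. -/
def body {N : ℕ} : Grassmann N →ₐ[ℝ] ℝ := ExteriorAlgebra.algebraMapInv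

/-- The soul (nilpotent component) of an element of the Grassmann algebra. -/
def soul {N : ℕ} (a : Grassmann N) : Grassmann N := a - algebraMap ℝ (Grassmann N) (body a)

/-- The sign `(-1)^p`. -/
def sgn (p : ZMod 2) : ℝ := if p = 0 then 1 else -1

/-- Parity of a coordinate: the coordinates indexed by the left summand are even, those indexed
by the right summand are odd. -/
def par {ι κ : Type} : ι ⊕ κ → ZMod 2
  | Sum.inl _ => 0
  | Sum.inr _ => 1

/-! ### Superfunctions on superdomains -/

/-- `C^∞(U) ⊗ Λ(ξ_k : k ∈ κ)`, the algebra of smooth functions on the superdomain with underlying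
open set `U ⊆ ℝ^ι` and odd coordinates `ξ_k`. The element `∑_I f_I ξ^I` (where `ξ^I` is the product
of the `ξ_k`, `k ∈ I`, in increasing order) is given by its coefficients `f_I`, which are smooth
on `U`; they are extended by zero outside `U`, so that only their values on `U` matter. -/
def SuperFun {ι : Type} [Fintype ι] (U : Opens (ι → ℝ)) (κ : Type) :
    Submodule ℝ (Finset κ → (ι → ℝ) → ℝ) where
  carrier := {f | ∀ I, ContDiffOn ℝ ∞ (f I) U ∧ ∀ x ∉ U, f I x = 0}
  add_mem' := by
    intro f g hf hg I
    refine ⟨(hf I).1.add (hg I).1, fun x hx => ?_⟩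
    simp [(hf I).2 x hx, (hg I).2 x hx]
  zero_mem' := fun I => ⟨contDiffOn_const, fun _ _ => rfl⟩
  smul_mem' := by
    intro c f hf I
    refine ⟨(hf I).1.const_smul c, fun x hx => ?_⟩
    simp [(hf I).2 x hx]

lemma contDiffAt_coeff {ι κ : Type} [Fintype ι] {U : Opens (ι → ℝ)} (f : SuperFun U κ) (I : Finset κ) {x : ι → ℝ} (hx : x ∈ U) :
    ContDiffAt ℝ ∞ (f.1 I) x :=
  (f.2 I).1.contDiffAt (U.2.mem_nhds hx)

section Superdomain

variable {ι : Type} [Fintype ι] [DecidableEq ι] {U : Opens (ι → ℝ)} {κ : Type} [Fintype κ]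
  [LinearOrder κ]

/-- The underlying real point of a tuple of values of the coordinates. -/
def bodyPt {N : ℕ} (X : ι ⊕ κ → Grassmann N) : ι → ℝ := fun i => body (X (Sum.inl i))

/-- The tuple `X` of elements of the Grassmann algebra is a Grassmann-valued point of the
superdomain: each coordinate has the right parity, and the underlying real point lies in `U`. -/
def IsPoint (U : Opens (ι → ℝ)) {N : ℕ} (X : ι ⊕ κ → Grassmann N) : Prop :=
  (∀ c, X c ∈ part N (par c)) ∧ bodyPt X ∈ U

/-- The Taylor expansion `∑_k D^k f(b)(s, …, s) / k!` of a function of the even variables, where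
`b` is the body and `s` the soul of the argument. Products of more than `N` souls vanish. -/
def taylor {N : ℕ} (f : (ι → ℝ) → ℝ) (x : ι → Grassmann N) : Grassmann N :=
  ∑ k ∈ Finset.range (N + 1), ∑ i : Fin k → ι,
    (((k.factorial : ℝ)⁻¹ * iteratedFDeriv ℝ k f (fun j => body (x j))
      (fun l => Pi.single (i l) (1 : ℝ))) : ℝ) • (List.ofFn fun l => soul (x (i l))).prod

lemma taylor_add {N : ℕ} {ι κ : Type} [Fintype ι] [DecidableEq ι]
    {U : Opens (ι → ℝ)} (f g : SuperFun U κ) (I : Finset κ) (x : ι → Grassmann N)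
    (hx : (fun j => body (x j)) ∈ U) :
    taylor ((f + g).1 I) x = taylor (f.1 I) x + taylor (g.1 I) x := by
  unfold taylor
  rw [← Finset.sum_add_distrib]
  refine Finset.sum_congr rfl fun k _ => ?_
  rw [← Finset.sum_add_distrib]
  refine Finset.sum_congr rfl fun i _ => ?_
  have hk : ((k : ℕ∞) : WithTop ℕ∞) ≤ ∞ := by exact_mod_cast le_top
  have h := iteratedFDeriv_add_apply (i := k) ((contDiffAt_coeff f I hx).of_le hk)
    ((contDiffAt_coeff g I hx).of_le hk)
  have h' : (f + g).1 I = f.1 I + g.1 I := rfl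
  rw [h', h, add_apply, mul_add, add_smul]

lemma taylor_smul {N : ℕ} {ι κ : Type} [Fintype ι] [DecidableEq ι]
    {U : Opens (ι → ℝ)} (c : ℝ) (f : SuperFun U κ) (I : Finset κ) (x : ι → Grassmann N)
    (hx : (fun j => body (x j)) ∈ U) :
    taylor ((c • f).1 I) x = c • taylor (f.1 I) x := by
  unfold taylor
  rw [Finset.smul_sum]
  refine Finset.sum_congr rfl fun k _ => ?_
  rw [Finset.smul_sum]
  refine Finset.sum_congr rfl fun i _ => ?_
  have hk : ((k : ℕ∞) : WithTop ℕ∞) ≤ ∞ := by exact_mod_cast le_top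
  have h := iteratedFDeriv_const_smul_apply (i := k) (a := c) ((contDiffAt_coeff f I hx).of_le hk)
  have h' : (c • f).1 I = c • f.1 I := rfl
  rw [h', h, smul_apply, smul_smul, smul_eq_mul]
  congr 1
  ring

open scoped Classical in
/-- The value `∑_I f_I(x) ξ^I` of a superfunction at a Grassmann-valued point `X = (x, ξ)`.
(It is set to zero if the underlying real point is not in `U`.) -/
def eval {N : ℕ} (X : ι ⊕ κ → Grassmann N) : SuperFun U κ →ₗ[ℝ] Grassmann N where
  toFun f := if bodyPt X ∈ U then
    ∑ I : Finset κ, taylor (f.1 I) (fun i => X (Sum.inl i)) *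
      ((I.sort (· ≤ ·)).map fun k => X (Sum.inr k)).prod else 0
  map_add' f g := by
    by_cases h : bodyPt X ∈ U
    · simp only [if_pos h]
      rw [← Finset.sum_add_distrib]
      refine Finset.sum_congr rfl fun I _ => ?_
      rw [taylor_add f g I _ h, add_mul]
    · simp [h]
  map_smul' c f := by
    by_cases h : bodyPt X ∈ U
    · simp only [if_pos h, RingHom.id_apply]
      rw [Finset.smul_sum]
      refine Finset.sum_congr rfl fun I _ => ?_
      rw [taylor_smul c f I _ h, smul_mul_assoc]
    · simp [h]

open scoped Classical in
/-- Partial derivative along the even coordinate with index `i`. -/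
def pdEven (i : ι) : SuperFun U κ →ₗ[ℝ] SuperFun U κ where
  toFun f := ⟨fun I x => if x ∈ U then fderiv ℝ (f.1 I) x (Pi.single i 1) else 0, fun I => by
    refine ⟨?_, fun x hx => if_neg hx⟩
    have h : ContDiffOn ℝ ∞ (fderiv ℝ (f.1 I)) U :=
      (f.2 I).1.fderiv_of_isOpen U.2 (by simp)
    exact (h.clm_apply contDiffOn_const).congr fun x hx => if_pos hx⟩
  map_add' f g := by
    ext I x
    by_cases h : x ∈ U
    · have h1 := (contDiffAt_coeff f I h).differentiableAt (by simp)
      have h2 := (contDiffAt_coeff g I h).differentiableAt (by simp)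
      have h' : (f + g).1 I = f.1 I + g.1 I := rfl
      simp only [if_pos h, h', fderiv_add h1 h2, Submodule.coe_add, Pi.add_apply, add_apply]
    · simp [h]
  map_smul' c f := by
    ext I x
    by_cases h : x ∈ U
    · have h1 := (contDiffAt_coeff f I h).differentiableAt (by simp)
      have h' : (c • f).1 I = c • f.1 I := rfl
      simp only [if_pos h, h', fderiv_const_smul h1, Submodule.coe_smul, Pi.smul_apply,
        RingHom.id_apply, smul_apply]
    · simp [h]

/-- Left partial derivative along the odd coordinate with index `k`:
`∂/∂ξ_k (ξ^J) = (-1)^{#{j ∈ J | j < k}} ξ^{J \ {k}}` if `k ∈ J`, and `0` otherwise. -/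
def pdOdd (k : κ) : SuperFun U κ →ₗ[ℝ] SuperFun U κ where
  toFun f := ⟨fun I => if k ∈ I then 0 else
      ((-1 : ℝ) ^ (I.filter (· < k)).card) • f.1 (insert k I), fun I => by
    by_cases h : k ∈ I
    · simp only [if_pos h]
      exact ⟨contDiffOn_const, fun _ _ => rfl⟩
    · simp only [if_neg h]
      refine ⟨(f.2 (insert k I)).1.const_smul ((-1 : ℝ) ^ (I.filter (· < k)).card),
        fun x hx => ?_⟩
      simp [(f.2 (insert k I)).2 x hx]⟩
  map_add' f g := by
    ext I x
    by_cases h : k ∈ I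
    · simp [h]
    · simp [h, mul_add]
  map_smul' c f := by
    ext I x
    by_cases h : k ∈ I
    · simp [h]
    · simp [h, mul_left_comm]

/-- (Left) partial derivative of superfunctions along a coordinate. -/
def pd : ι ⊕ κ → SuperFun U κ →ₗ[ℝ] SuperFun U κ
  | Sum.inl i => pdEven i
  | Sum.inr k => pdOdd k

/-- The superfunction `f` is homogeneous of parity `p`. -/
def HasParity (p : ZMod 2) (f : SuperFun U κ) : Prop :=
  ∀ I : Finset κ, (I.card : ZMod 2) ≠ p → f.1 I = 0

/-! ### Differential 1-forms on superdomains

A 1-form `τ = ∑_c dx^c τ_c` is given by its coefficients. Differential forms are functions of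
the coordinates `x^c` and of their differentials `dx^c`, which have the opposite parity. -/

/-- `dX` is a Grassmann-valued tuple of differentials: `dx^c` has parity opposite to `x^c`. -/
def IsDiff {N : ℕ} (dX : ι ⊕ κ → Grassmann N) : Prop :=
  ∀ c, dX c ∈ part N (par c + 1)

/-- The value of the 1-form `∑_c dx^c τ_c`. -/
def evalForm {N : ℕ} (τ : ι ⊕ κ → SuperFun U κ) (X dX : ι ⊕ κ → Grassmann N) : Grassmann N :=
  ∑ c, dX c * eval X (τ c)

/-- The value of the 2-form `dτ = ∑_c (-1)^{|dx^c|} dx^c dτ_c`, where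
`dτ_c = ∑_{c'} dx^{c'} ∂τ_c/∂x^{c'}`. -/
def evalD {N : ℕ} (τ : ι ⊕ κ → SuperFun U κ) (X dX : ι ⊕ κ → Grassmann N) : Grassmann N :=
  ∑ c, ∑ c', sgn (par c + 1) • (dX c * (dX c' * eval X (pd c' (τ c))))

/-- `dτ = 0`. -/
def IsClosedForm (τ : ι ⊕ κ → SuperFun U κ) : Prop :=
  ∀ (N : ℕ) (X dX : ι ⊕ κ → Grassmann N), IsPoint U X → IsDiff dX → evalD τ X dX = 0

/-- The 1-form is homogeneous of (total) parity `p`. -/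
def FormHasParity (p : ZMod 2) (τ : ι ⊕ κ → SuperFun U κ) : Prop :=
  ∀ c, HasParity (p + par c + 1) (τ c)

end Superdomain

/-! ### Even and odd vectors of a superspace of dimension `n|m`, in components

The components of a vector are indexed by `A : Fin n ⊕ Fin m`, of parity `par A`. -/

section Vectors

variable {n m N : ℕ}

/-- Components `x^A` of a Grassmann-valued vector of parity `F`: `x^A` has parity `A + F`. -/
def IsVector (F : ZMod 2) (x : Fin n ⊕ Fin m → Grassmann N) : Prop :=
  ∀ A, x A ∈ part N (par A + F)

/-- The underlying real point, in `ℝ^m`, of an odd vector. -/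
def oddBody (y : Fin n ⊕ Fin m → Grassmann N) : Fin m → ℝ := fun j => body (y (Sum.inr j))

/-- The underlying open set `ℝ^m \ {0}` of `ΠV \ {0}`. -/
def puncture (m : ℕ) : Opens (Fin m → ℝ) := ⟨{0}ᶜ, isOpen_compl_singleton⟩

/-- The underlying open set `ℝ^n × (ℝ^m \ {0})` of `V × (ΠV \ {0})`. -/
def pairDomain (n m : ℕ) : Opens (Fin n ⊕ Fin m → ℝ) :=
  ⟨{z | (fun j => z (Sum.inr j)) ≠ (0 : Fin m → ℝ)},
    isOpen_ne_fun (by fun_prop) continuous_const⟩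

/-- The odd coordinates on `V × ΠV`: the components `x_1^{ĵ}` of the even vector, and the
components `x_{1̂}^i` of the odd vector. The even coordinates are `x_1^i` and `x_{1̂}^{ĵ}`. -/
abbrev OddPair (n m : ℕ) : Type := Lex (Fin m ⊕ Fin n)

/-- Functions of one even vector and one non-zero odd vector, in components. -/
abbrev PairFun (n m : ℕ) : Type := SuperFun (pairDomain n m) (OddPair n m)

/-- Functions of one non-zero odd vector, in components. -/
abbrev OddFun (n m : ℕ) : Type := SuperFun (puncture m) (Fin n)

/-- The coordinate on `V × ΠV` that is the component `x_F^A` of the even (`F = 0`) or of the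
odd (`F = 1`) vector. -/
def argCoord (F : ZMod 2) (A : Fin n ⊕ Fin m) : (Fin n ⊕ Fin m) ⊕ OddPair n m :=
  if F = 0 then
    match A with
    | Sum.inl i => Sum.inl (Sum.inl i)
    | Sum.inr j => Sum.inr (toLex (Sum.inl j))
  else
    match A with
    | Sum.inl i => Sum.inr (toLex (Sum.inr i))
    | Sum.inr j => Sum.inl (Sum.inr j)

/-- The Grassmann-valued point of `V × ΠV` given by an even vector `x` and an odd vector `y`. -/
def pair (x y : Fin n ⊕ Fin m → Grassmann N) : (Fin n ⊕ Fin m) ⊕ OddPair n m → Grassmann N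
  | Sum.inl (Sum.inl i) => x (Sum.inl i)
  | Sum.inl (Sum.inr j) => y (Sum.inr j)
  | Sum.inr s => Sum.elim (fun j => x (Sum.inr j)) (fun i => y (Sum.inl i)) (ofLex s)

/-- The tuple `y`, with its even coordinates `y^{ĵ}` and its odd coordinates `y^i`, as
coordinates on `ΠV`. -/
def onPi (y : Fin n ⊕ Fin m → Grassmann N) : Fin m ⊕ Fin n → Grassmann N := fun c => y c.swap

/-- The condition `L(g · x) = L(x) Ber g` for all Grassmann-valued
`g = (a, β; γ, d)` in `GL(1|1)`, where `(g · x)_F = ∑_G g_F^G x_G` and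
`Ber g = (a - β d⁻¹ γ) d⁻¹`. -/
def BER (L : PairFun n m) : Prop :=
  ∀ (N : ℕ) (a β γ d : Grassmann N),
    a ∈ part N 0 → β ∈ part N 1 → γ ∈ part N 1 → d ∈ part N 0 → IsUnit a → IsUnit d →
    ∀ x y : Fin n ⊕ Fin m → Grassmann N, IsVector 0 x → IsVector 1 y → oddBody y ≠ 0 →
      eval (pair (fun A => a * x A + β * y A) (fun A => γ * x A + d * y A)) L =
        eval (pair x y) L * ((a - β * Ring.inverse d * γ) * Ring.inverse d)

/-- The system
`∂²L/∂x_F^A ∂x_G^B + (-1)^{F G + B (F + G)} ∂²L/∂x_G^A ∂x_F^B = 0` (for all `F, G, A, B`). -/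
def PDE (L : PairFun n m) : Prop :=
  ∀ (F G : ZMod 2) (A B : Fin n ⊕ Fin m),
    pd (argCoord F A) (pd (argCoord G B) L) +
      sgn (F * G + par B * (F + G)) • pd (argCoord G A) (pd (argCoord F B) L) = 0

/-! ### Affine charts of the projective superspace

The chart with index `α : Fin m` is the locus where the homogeneous coordinate `x^{α̂}` is
invertible; its coordinates are `u^A = x^A / x^{α̂}` for `A ≠ α̂`. -/

/-- The homogeneous index of a coordinate of the chart `α`. -/
def homIndex {α : Fin m} : {j : Fin m // j ≠ α} ⊕ Fin n → Fin n ⊕ Fin m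
  | Sum.inl j => Sum.inr j.1
  | Sum.inr i => Sum.inl i

/-- The tuple of homogeneous coordinates (or of their differentials) that extends a tuple of
coordinates (differentials) of the chart `α` by the value `v` at the index `α̂`. -/
def homogenize (α : Fin m) (u : {j : Fin m // j ≠ α} ⊕ Fin n → Grassmann N) (v : Grassmann N) :
    Fin n ⊕ Fin m → Grassmann N
  | Sum.inl i => u (Sum.inr i)
  | Sum.inr j => if h : j = α then v else u (Sum.inl ⟨j, h⟩)

/-- The affine coordinates `u^A = x^A (x^{α̂})⁻¹`. -/
def affine (α : Fin m) (x : Fin n ⊕ Fin m → Grassmann N) :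
    {j : Fin m // j ≠ α} ⊕ Fin n → Grassmann N :=
  fun c => x (homIndex c) * Ring.inverse (x (Sum.inr α))

/-- The differentials of the affine coordinates,
`du^A = d(x^A (x^{α̂})⁻¹) = dx^A (x^{α̂})⁻¹ - dx^{α̂} x^A (x^{α̂})⁻²`. -/
def dAffine (α : Fin m) (x dx : Fin n ⊕ Fin m → Grassmann N) :
    {j : Fin m // j ≠ α} ⊕ Fin n → Grassmann N :=
  fun c => dx (homIndex c) * Ring.inverse (x (Sum.inr α)) -
    dx (Sum.inr α) * x (homIndex c) * Ring.inverse (x (Sum.inr α)) ^ 2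

/-- Superfunctions on an affine chart `ℝ^{m-1|n}` of the projective superspace. -/
abbrev ChartFun (n : ℕ) {m : ℕ} (α : Fin m) : Type :=
  SuperFun (⊤ : Opens ({j : Fin m // j ≠ α} → ℝ)) (Fin n)

end Vectors

/-! ### Super vector spaces, and functions and forms on the superspaces attached to them

A super vector space `V = V₀ ⊕ V₁` is given by its even part `V₀` and its odd part `V₁`. A function
or form is given by its expressions in all homogeneous bases, subject to the transformation law
under a change of basis. -/

section Global

variable (n m : ℕ) (V₀ V₁ : Type*) [AddCommGroup V₀] [Module ℝ V₀] [AddCommGroup V₁] [Module ℝ V₁]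

/-- A homogeneous basis of a super vector space of dimension `n|m`. -/
structure Frame where
  even : Module.Basis (Fin n) ℝ V₀
  odd : Module.Basis (Fin m) ℝ V₁

variable {n m V₀ V₁}

/-- The components with respect to `b'` of the vector with components `x` with respect to `b`. -/
def changeFrame {N : ℕ} (b b' : Frame n m V₀ V₁) (x : Fin n ⊕ Fin m → Grassmann N) :
    Fin n ⊕ Fin m → Grassmann N
  | Sum.inl i => ∑ k, (b'.even.repr (b.even k) i) • x (Sum.inl k)
  | Sum.inr j => ∑ k, (b'.odd.repr (b.odd k) j) • x (Sum.inr k)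

variable (n m V₀ V₁)

/-- `C^∞(V × (ΠV \ {0}))`: functions of one even vector and one non-zero odd vector of `V`. -/
def VectorFun : Submodule ℝ (Frame n m V₀ V₁ → PairFun n m) where
  carrier := {L | ∀ (b b' : Frame n m V₀ V₁) (N : ℕ) (x y : Fin n ⊕ Fin m → Grassmann N),
    IsVector 0 x → IsVector 1 y → oddBody y ≠ 0 →
      eval (pair (changeFrame b b' x) (changeFrame b b' y)) (L b') = eval (pair x y) (L b)}
  add_mem' := by
    intro L M hL hM b b' N x y hx hy h
    simp only [Pi.add_apply, map_add, hL b b' N x y hx hy h, hM b b' N x y hx hy h]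
  zero_mem' := by
    intro b b' N x y _ _ _
    simp only [Pi.zero_apply, map_zero]
  smul_mem' := by
    intro c L hL b b' N x y hx hy h
    simp only [Pi.smul_apply, map_smul, hL b b' N x y hx hy h]

/-- The space of (Voronov–Zorich) `1|1`-forms on `V`. -/
def VZForm : Submodule ℝ (VectorFun n m V₀ V₁) where
  carrier := {L | ∀ b, BER (L.1 b) ∧ PDE (L.1 b)}
  add_mem' := by
    intro L M hL hM b
    have h' : (L + M).1 b = L.1 b + M.1 b := rfl
    refine ⟨?_, ?_⟩
    · intro N a β γ d ha hβ hγ hd ha' hd' x y hx hy h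
      rw [h', map_add, map_add, add_mul, (hL b).1 N a β γ d ha hβ hγ hd ha' hd' x y hx hy h,
        (hM b).1 N a β γ d ha hβ hγ hd ha' hd' x y hx hy h]
    · intro F G A B
      have h1 := (hL b).2 F G A B
      have h2 := (hM b).2 F G A B
      rw [h', map_add, map_add, map_add, map_add, smul_add, add_add_add_comm, h1, h2, add_zero]
  zero_mem' := by
    intro b
    have h' : (0 : VectorFun n m V₀ V₁).1 b = 0 := rfl
    refine ⟨?_, ?_⟩
    · intro N a β γ d _ _ _ _ _ _ x y _ _ _
      rw [h', map_zero, map_zero, zero_mul]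
    · intro F G A B
      rw [h', map_zero, map_zero, map_zero, map_zero, smul_zero, add_zero]
  smul_mem' := by
    intro c L hL b
    have h' : (c • L).1 b = c • L.1 b := rfl
    refine ⟨?_, ?_⟩
    · intro N a β γ d ha hβ hγ hd ha' hd' x y hx hy h
      rw [h', map_smul, map_smul, smul_mul_assoc,
        (hL b).1 N a β γ d ha hβ hγ hd ha' hd' x y hx hy h]
    · intro F G A B
      have h1 := (hL b).2 F G A B
      rw [h', map_smul, map_smul, map_smul, map_smul, smul_comm, ← smul_add, h1, smul_zero]

variable {n m V₀ V₁} in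
lemma evalForm_add {ι κ : Type} [Fintype ι] [DecidableEq ι] {U : Opens (ι → ℝ)} [Fintype κ]
    [LinearOrder κ] {N : ℕ} (τ η : ι ⊕ κ → SuperFun U κ) (X dX : ι ⊕ κ → Grassmann N) :
    evalForm (τ + η) X dX = evalForm τ X dX + evalForm η X dX := by
  simp only [evalForm, Pi.add_apply, map_add, mul_add, Finset.sum_add_distrib]

variable {n m V₀ V₁} in
lemma evalForm_smul {ι κ : Type} [Fintype ι] [DecidableEq ι] {U : Opens (ι → ℝ)} [Fintype κ]
    [LinearOrder κ] {N : ℕ} (r : ℝ) (τ : ι ⊕ κ → SuperFun U κ) (X dX : ι ⊕ κ → Grassmann N) :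
    evalForm (r • τ) X dX = r • evalForm τ X dX := by
  simp only [evalForm, Pi.smul_apply, map_smul, mul_smul_comm, Finset.smul_sum]

/-- Differential 1-forms on `ΠV \ {0}`. -/
def PiForm : Submodule ℝ (Frame n m V₀ V₁ → Fin m ⊕ Fin n → OddFun n m) where
  carrier := {η | ∀ (b b' : Frame n m V₀ V₁) (N : ℕ) (x dx : Fin n ⊕ Fin m → Grassmann N),
    IsVector 1 x → IsVector 0 dx → oddBody x ≠ 0 →
      evalForm (η b') (onPi (changeFrame b b' x)) (onPi (changeFrame b b' dx)) =
        evalForm (η b) (onPi x) (onPi dx)}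
  add_mem' := by
    intro η θ hη hθ b b' N x dx hx hdx h
    simp only [Pi.add_apply, evalForm_add, hη b b' N x dx hx hdx h, hθ b b' N x dx hx hdx h]
  zero_mem' := by
    intro b b' N x dx _ _ _
    simp only [evalForm, Pi.zero_apply, map_zero, mul_zero]
  smul_mem' := by
    intro c η hη b b' N x dx hx hdx h
    simp only [Pi.smul_apply, evalForm_smul, hη b b' N x dx hx hdx h]

/-- Differential 1-forms on the projective superspace `P(ΠV)`: families of 1-forms on all affine
charts (indexed by a homogeneous basis `b` of `V` and an index `α`) that agree on overlaps. -/
def ProjForm : Submodule ℝ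
    (Frame n m V₀ V₁ → (α : Fin m) → {j : Fin m // j ≠ α} ⊕ Fin n → ChartFun n α) where
  carrier := {w | ∀ (b b' : Frame n m V₀ V₁) (α β : Fin m) (N : ℕ)
    (u du : {j : Fin m // j ≠ α} ⊕ Fin n → Grassmann N) (x dx : Fin n ⊕ Fin m → Grassmann N),
    IsPoint ⊤ u → IsDiff du →
    x = changeFrame b b' (homogenize α u 1) → dx = changeFrame b b' (homogenize α du 0) →
    body (x (Sum.inr β)) ≠ 0 →
      evalForm (w b' β) (affine β x) (dAffine β x dx) = evalForm (w b α) u du}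
  add_mem' := by
    intro v w hv hw b b' α β N u du x dx hu hdu hx hdx h
    simp only [Pi.add_apply, evalForm_add, hv b b' α β N u du x dx hu hdu hx hdx h,
      hw b b' α β N u du x dx hu hdu hx hdx h]
  zero_mem' := by
    intro b b' α β N u du x dx _ _ _ _ _
    simp only [evalForm, Pi.zero_apply, map_zero, mul_zero, Finset.sum_const_zero]
  smul_mem' := by
    intro c w hw b b' α β N u du x dx hu hdu hx hdx h
    simp only [Pi.smul_apply, evalForm_smul, hw b b' α β N u du x dx hu hdu hx hdx h]

/-- The space of closed differential 1-forms on `P(ΠV)`. -/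
def ClosedProjForm : Submodule ℝ (ProjForm n m V₀ V₁) where
  carrier := {w | ∀ b α, IsClosedForm (w.1 b α)}
  add_mem' := by
    intro v w hv hw b α N X dX hX hdX
    have h' : (v + w).1 b α = v.1 b α + w.1 b α := rfl
    have h1 := hv b α N X dX hX hdX
    have h2 := hw b α N X dX hX hdX
    unfold evalD at h1 h2 ⊢
    simp only [h', Pi.add_apply, map_add, mul_add, smul_add, Finset.sum_add_distrib, h1, h2,
      add_zero]
  zero_mem' := by
    intro b α N X dX _ _
    have h' : (0 : ProjForm n m V₀ V₁).1 b α = 0 := rfl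
    simp only [evalD, h', Pi.zero_apply, map_zero, mul_zero, smul_zero, Finset.sum_const_zero]
  smul_mem' := by
    intro c w hw b α N X dX hX hdX
    have h' : (c • w).1 b α = c • w.1 b α := rfl
    have h2 : evalD (c • w.1 b α) X dX = c • evalD (w.1 b α) X dX := by
      simp only [evalD, Pi.smul_apply, map_smul, mul_smul_comm, Finset.smul_sum,
        smul_comm _ c]
    rw [h', h2, hw b α N X dX hX hdX, smul_zero]

variable {n m V₀ V₁}

/-- In every homogeneous basis, `L = x_1^a L_a`, where the `L_a` are functions of the odd vector
`x_{1̂}` and `η = ω_L = dx_{1̂}^a L_a`. -/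
def IsOmega (L : VectorFun n m V₀ V₁) (η : PiForm n m V₀ V₁) : Prop :=
  ∀ (b : Frame n m V₀ V₁) (N : ℕ) (x y : Fin n ⊕ Fin m → Grassmann N),
    IsVector 0 x → IsVector 1 y → oddBody y ≠ 0 →
      eval (pair x y) (L.1 b) = ∑ a, x a * eval (onPi y) (η.1 b a.swap)

/-- The 1-form `η` on `ΠV \ {0}` descends to the 1-form `w` on `P(ΠV)`, i.e. it is the pull-back
of `w` under the projection. -/
def DescendsTo (η : PiForm n m V₀ V₁) (w : ProjForm n m V₀ V₁) : Prop :=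
  ∀ (b : Frame n m V₀ V₁) (α : Fin m) (N : ℕ) (x dx : Fin n ⊕ Fin m → Grassmann N),
    IsVector 1 x → IsVector 0 dx → body (x (Sum.inr α)) ≠ 0 →
      evalForm (η.1 b) (onPi x) (onPi dx) = evalForm (w.1 b α) (affine α x) (dAffine α x dx)

end Global

end SuperGeom

end

noncomputable section

namespace SuperGeom

set_option linter.unusedSectionVars false

/-! ### Grassmann algebras -/

section GrassmannAlgebra

variable {N : ℕ}

/-! Everything is tested on Grassmann-valued points. A superfunction is determined by its values
there, and points whose odd coordinates are free generators suffice (`superFun_ext`). A few spare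
generators make it enough to know an identity after multiplication by odd parameters
(`superFun_eq_zero`). Conversely, expressions built from smooth functions, products and
substitutions are superfunctions (`Representable.mul`, `Representable.comp`), because a value at a
nilpotent displacement depends only on a finite jet (`taylor_eq_of_approximates`). Derivatives enter
through f(X + θ dX) = f(X) + θ df(X, dX) with θ odd (`eval_add_mul`).

The components of the even vector x_1 have the parities of dx_1̂. Hence L = x_1^a L_a is just the
value of ω_L with x_1 put in place of dx_1̂. To obtain this shape for a 1|1-form, take F = G = 0 in
(PDE): the second derivatives along x_1 vanish, so the ∂L/∂x_1^a depend on x_1̂ only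
(`exists_eq_pullFun`). (BER) for diag(a, 1) gives homogeneity of degree one in x_1, and a = 1 + θθ'
turns this into Euler's identity L = x_1^a ∂L/∂x_1^a (`exists_eq_omegaFun`). For L = x_1^a L_a the
equations with F = G hold identically, and the mixed ones are, up to sign, the components of dω_L =
0 (`isClosedForm_iff_PDE`).

Descent uses one upper triangular matrix. With i the inverse of x_1̂^α̂, the element (i, -x_1^α̂ i²;
0, i) of GL(1|1) has Berezinian 1 and carries (x_1, x_1̂) to (du, u) in the chart α, completed by 0
and 1 at the index α̂. So (BER) exhibits L as the pull-back of a form on each chart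
(`exists_matches`). Closedness upstairs and downstairs agree because θ dω_L and θ dw both measure
the change of L under x_1̂ ↦ x_1̂ + θ x_1 (`Matches.isClosedForm_iff`).

For the converse, the pull-backs of a form w from the charts glue to ω_L for a unique L = x_1^a L_a
(`exists_matches_of_compatible`). Any such L transforms correctly under the upper triangular
matrices, since du kills the direction x_1̂ and scales properly. Invariance under the lower
unipotent ones is exactly where dw = 0 is used (`Matches.ber`). -/

lemma mul_mem_part {p q : ZMod 2} {a b : Grassmann N} (ha : a ∈ part N p) (hb : b ∈ part N q) :
    a * b ∈ part N (p + q) :=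
  CliffordAlgebra.evenOdd_mul_le (0 : QuadraticForm ℝ (Fin N → ℝ)) p q
    (Submodule.mul_mem_mul ha hb)

lemma algebraMap_mem_part (r : ℝ) : algebraMap ℝ (Grassmann N) r ∈ part N 0 :=
  SetLike.algebraMap_mem_graded (CliffordAlgebra.evenOdd (0 : QuadraticForm ℝ (Fin N → ℝ))) r

lemma one_mem_part : (1 : Grassmann N) ∈ part N 0 := by
  simpa using algebraMap_mem_part (N := N) 1

/-- The even part is generated by products of two generators, and moving such a product past a
generator costs two signs. -/
lemma even_commute {a : Grassmann N} (ha : a ∈ part N 0) (b : Grassmann N) : a * b = b * a := by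
  have key : ∀ x y : Fin N → ℝ, ExteriorAlgebra.ι ℝ x * ExteriorAlgebra.ι ℝ y =
      -(ExteriorAlgebra.ι ℝ y * ExteriorAlgebra.ι ℝ x) := fun x y =>
    eq_neg_of_add_eq_zero_left (ExteriorAlgebra.ι_add_mul_swap x y)
  induction a, ha using CliffordAlgebra.even_induction with
  | algebraMap r => exact Algebra.commutes r b
  | add x y hx hy ihx ihy => rw [add_mul, mul_add, ihx, ihy]
  | ι_mul_ι_mul m₁ m₂ x hx ih =>
    have h : ∀ b : Grassmann N, (ExteriorAlgebra.ι ℝ m₁ * ExteriorAlgebra.ι ℝ m₂) * b =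
        b * (ExteriorAlgebra.ι ℝ m₁ * ExteriorAlgebra.ι ℝ m₂) := by
      intro b
      induction b using ExteriorAlgebra.induction with
      | algebraMap r => exact (Algebra.commutes r _).symm
      | ι z =>
        rw [mul_assoc, key m₂ z, mul_neg, ← mul_assoc, key m₁ z, neg_mul, neg_neg, mul_assoc]
      | mul a b iha ihb => rw [← mul_assoc, iha, mul_assoc, ihb, mul_assoc]
      | add a b iha ihb => rw [mul_add, add_mul, iha, ihb]
    change (ExteriorAlgebra.ι ℝ m₁ * ExteriorAlgebra.ι ℝ m₂) * x * b =
      b * ((ExteriorAlgebra.ι ℝ m₁ * ExteriorAlgebra.ι ℝ m₂) * x)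
    rw [mul_assoc, ih, ← mul_assoc, h b, mul_assoc]

/-- An odd element is built from a generator by multiplying with pairs of generators. Pairs are
central, so both inductions reduce to the anticommutation of two generators. -/
lemma odd_anticommute {a b : Grassmann N} (ha : a ∈ part N 1) (hb : b ∈ part N 1) :
    a * b = -(b * a) := by
  have key : ∀ x y : Fin N → ℝ, ExteriorAlgebra.ι ℝ x * ExteriorAlgebra.ι ℝ y =
      -(ExteriorAlgebra.ι ℝ y * ExteriorAlgebra.ι ℝ x) := fun x y =>
    eq_neg_of_add_eq_zero_left (ExteriorAlgebra.ι_add_mul_swap x y)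
  have hev : ∀ m₁ m₂ : Fin N → ℝ,
      (ExteriorAlgebra.ι ℝ m₁ * ExteriorAlgebra.ι ℝ m₂ : Grassmann N) ∈ part N 0 := fun m₁ m₂ =>
    CliffordAlgebra.ι_mul_ι_mem_evenOdd_zero _ m₁ m₂
  have h1 : ∀ z : Fin N → ℝ, a * ExteriorAlgebra.ι ℝ z = -(ExteriorAlgebra.ι ℝ z * a) := by
    intro z
    induction a, ha using CliffordAlgebra.odd_induction with
    | ι v => exact key v z
    | add x y hx hy ihx ihy => rw [add_mul, mul_add, ihx, ihy, neg_add]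
    | ι_mul_ι_mul m₁ m₂ x hx ih =>
      change (ExteriorAlgebra.ι ℝ m₁ * ExteriorAlgebra.ι ℝ m₂) * x * _ =
        -(_ * ((ExteriorAlgebra.ι ℝ m₁ * ExteriorAlgebra.ι ℝ m₂) * x))
      rw [mul_assoc, ih, mul_neg, ← mul_assoc, even_commute (hev m₁ m₂), mul_assoc]
  induction b, hb using CliffordAlgebra.odd_induction with
  | ι v => exact h1 v
  | add x y hx hy ihx ihy => rw [add_mul, mul_add, ihx, ihy, neg_add]
  | ι_mul_ι_mul m₁ m₂ x hx ih =>
    change a * ((ExteriorAlgebra.ι ℝ m₁ * ExteriorAlgebra.ι ℝ m₂) * x) =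
      -((ExteriorAlgebra.ι ℝ m₁ * ExteriorAlgebra.ι ℝ m₂) * x * a)
    rw [← mul_assoc, ← even_commute (hev m₁ m₂), mul_assoc _ a, ih, mul_neg, mul_assoc _ x]

lemma sgn_zero : sgn 0 = 1 := if_pos rfl

lemma sgn_one : sgn 1 = -1 := if_neg one_ne_zero

lemma parity_cases (p : ZMod 2) : p = 0 ∨ p = 1 := by
  fin_cases p
  · exact Or.inl rfl
  · exact Or.inr rfl

lemma sgn_add (p q : ZMod 2) : sgn (p + q) = sgn p * sgn q := by
  have h : (1 : ZMod 2) + 1 = 0 := rfl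
  rcases parity_cases p with rfl | rfl <;> rcases parity_cases q with rfl | rfl <;>
    simp [sgn, h]

lemma sgn_mul_self (p : ZMod 2) : sgn p * sgn p = 1 := by
  rcases parity_cases p with rfl | rfl <;> simp [sgn]

lemma sgn_ne_zero (p : ZMod 2) : sgn p ≠ 0 := by
  rcases parity_cases p with rfl | rfl <;> simp [sgn]

lemma part_commute {p q : ZMod 2} {a b : Grassmann N} (ha : a ∈ part N p) (hb : b ∈ part N q) :
    a * b = sgn (p * q) • (b * a) := by
  rcases parity_cases p with rfl | rfl
  · simpa [sgn] using even_commute ha b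
  · rcases parity_cases q with rfl | rfl
    · simpa [sgn] using (even_commute hb a).symm
    · simpa [sgn] using odd_anticommute ha hb

lemma odd_mul_self {a : Grassmann N} (ha : a ∈ part N 1) : a * a = 0 := by
  have h := odd_anticommute ha ha
  have h2 : (2 : ℝ) • (a * a) = 0 := by
    rw [two_smul]; nth_rewrite 1 [h]; exact neg_add_cancel _
  exact (smul_eq_zero.mp h2).resolve_left two_ne_zero

lemma odd_mul_mul_self {a : Grassmann N} (ha : a ∈ part N 1) (b : Grassmann N) :
    a * (a * b) = 0 := by
  rw [← mul_assoc, odd_mul_self ha, zero_mul]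

lemma body_ι (v : Fin N → ℝ) : body (ExteriorAlgebra.ι ℝ v) = 0 := by
  simp [body, ExteriorAlgebra.algebraMapInv]

lemma body_odd {a : Grassmann N} (ha : a ∈ part N 1) : body a = 0 := by
  induction a, ha using CliffordAlgebra.odd_induction with
  | ι v => exact body_ι v
  | add x y hx hy ihx ihy => rw [map_add, ihx, ihy, add_zero]
  | ι_mul_ι_mul m₁ m₂ x hx ih => rw [map_mul, ih, mul_zero]

lemma body_algebraMap (r : ℝ) : body (algebraMap ℝ (Grassmann N) r) = r :=
  ExteriorAlgebra.algebraMap_leftInverse _ r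

/-- The nilpotent ideal of the Grassmann algebra. -/
def souls (N : ℕ) : Submodule ℝ (Grassmann N) :=
  LinearMap.range (ExteriorAlgebra.ι ℝ (M := Fin N → ℝ)) * ⊤

lemma ι_mem_souls (v : Fin N → ℝ) : ExteriorAlgebra.ι ℝ v ∈ souls N := by
  have := Submodule.mul_mem_mul (LinearMap.mem_range_self (ExteriorAlgebra.ι ℝ (M := Fin N → ℝ)) v)
    (Submodule.mem_top (x := (1 : Grassmann N)))
  rwa [mul_one] at this

lemma souls_mul_mem {a : Grassmann N} (ha : a ∈ souls N) (b : Grassmann N) : a * b ∈ souls N := by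
  have : a * b ∈ souls N * ⊤ := Submodule.mul_mem_mul ha Submodule.mem_top
  rw [souls, mul_assoc] at this
  exact (mul_le_mul' le_rfl le_top : _ ≤ souls N) this

lemma mul_ι_mem_souls (a : Grassmann N) (v : Fin N → ℝ) :
    a * ExteriorAlgebra.ι ℝ v ∈ souls N := by
  induction a using ExteriorAlgebra.induction generalizing v with
  | algebraMap r =>
    rw [Algebra.commutes]; exact souls_mul_mem (ι_mem_souls v) _
  | ι z => exact souls_mul_mem (ι_mem_souls z) _
  | mul a b iha ihb =>
    rw [mul_assoc]
    have h : ∀ c ∈ souls N, a * c ∈ souls N := by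
      intro c hc
      induction hc using Submodule.mul_induction_on' with
      | mem_mul_mem m hm n hn =>
        obtain ⟨w, rfl⟩ := hm
        rw [← mul_assoc]
        exact souls_mul_mem (iha w) n
      | add x _ y _ hx hy => rw [mul_add]; exact add_mem hx hy
    exact h _ (ihb v)
  | add a b iha ihb => rw [add_mul]; exact add_mem (iha v) (ihb v)

lemma mul_mem_souls (a : Grassmann N) {c : Grassmann N} (hc : c ∈ souls N) : a * c ∈ souls N := by
  induction hc using Submodule.mul_induction_on' with
  | mem_mul_mem m hm n hn =>
    obtain ⟨w, rfl⟩ := hm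
    rw [← mul_assoc]
    exact souls_mul_mem (mul_ι_mem_souls a w) n
  | add x _ y _ hx hy => rw [mul_add]; exact add_mem hx hy

lemma soul_mem_souls (a : Grassmann N) : soul a ∈ souls N := by
  unfold soul
  induction a using ExteriorAlgebra.induction with
  | algebraMap r => rw [body_algebraMap, sub_self]; exact zero_mem _
  | ι v => rw [body_ι, map_zero, sub_zero]; exact ι_mem_souls v
  | mul a b iha ihb =>
    have : a * b - algebraMap ℝ (Grassmann N) (body (a * b)) =
        (a - algebraMap ℝ _ (body a)) * b +
          algebraMap ℝ _ (body a) * (b - algebraMap ℝ _ (body b)) := by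
      rw [map_mul, map_mul]; noncomm_ring
    rw [this]
    exact add_mem (souls_mul_mem iha b) (mul_mem_souls _ ihb)
  | add a b iha ihb =>
    rw [map_add, map_add, add_sub_add_comm]
    exact add_mem iha ihb

lemma mem_souls_iff {a : Grassmann N} : a ∈ souls N ↔ body a = 0 := by
  constructor
  · intro h
    induction h using Submodule.mul_induction_on' with
    | mem_mul_mem m hm n hn =>
      obtain ⟨w, rfl⟩ := hm
      rw [map_mul, body_ι, zero_mul]
    | add x _ y _ hx hy => rw [map_add, hx, hy, add_zero]
  · intro h
    simpa [soul, h] using soul_mem_souls a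

/-- The ideal is W · Λ with W the span of the generators. It is two-sided, so all factors from W can
be collected on the left. -/
lemma souls_pow_le (k : ℕ) :
    souls N ^ k ≤ LinearMap.range (ExteriorAlgebra.ι ℝ (M := Fin N → ℝ)) ^ k * ⊤ := by
  induction k with
  | zero => simp
  | succ k ih =>
    rw [pow_succ, pow_succ, mul_assoc]
    refine (mul_le_mul' ih le_rfl).trans ?_
    rw [mul_assoc]
    refine mul_le_mul' le_rfl ?_
    rw [Submodule.mul_le]
    exact fun m _ n hn => mul_mem_souls m hn

/-- The exterior power of degree `N + 1` of an `N`-dimensional space vanishes. This is why Taylor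
expansions may be cut off after order `N`. -/
lemma souls_pow_eq_bot : souls N ^ (N + 1) = ⊥ := by
  refine eq_bot_iff.2 ((souls_pow_le _).trans ?_)
  have : (LinearMap.range (ExteriorAlgebra.ι ℝ (M := Fin N → ℝ))) ^ (N + 1) = ⊥ := by
    change (⋀[ℝ]^(N + 1) (Fin N → ℝ)) = ⊥
    rw [← ExteriorAlgebra.ιMulti_span_fixedDegree, Submodule.span_eq_bot]
    rintro _ ⟨v, rfl⟩
    refine AlternatingMap.map_linearDependent _ _ fun h => ?_
    have := h.fintype_card_le_finrank
    simp at this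
  rw [this, Submodule.bot_mul]

end GrassmannAlgebra

/-! ### Units, parity components and odd monomials of Grassmann algebras -/

section GrassmannUnits

variable {N : ℕ}

lemma isNilpotent_of_body_eq_zero {a : Grassmann N} (h : body a = 0) : IsNilpotent a :=
  ⟨N + 1, by
    have := Submodule.pow_mem_pow _ (mem_souls_iff.2 h) (N + 1)
    rwa [souls_pow_eq_bot, Submodule.mem_bot] at this⟩

lemma isUnit_iff_body_ne_zero {a : Grassmann N} : IsUnit a ↔ body a ≠ 0 := by
  constructor
  · intro h
    exact (h.map body).ne_zero
  · intro h
    have h1 : IsNilpotent (soul a) := isNilpotent_of_body_eq_zero (mem_souls_iff.1 (soul_mem_souls a))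
    have h2 : IsUnit (algebraMap ℝ (Grassmann N) (body a)) := (IsUnit.mk0 _ h).map _
    have h3 := h1.isUnit_add_left_of_commute h2 (Algebra.commutes _ _).symm
    simpa [soul] using h3

lemma exists_parts (a : Grassmann N) (p : ZMod 2) :
    ∃ b ∈ part N p, ∃ c ∈ part N (p + 1), a = b + c := by
  have h := (CliffordAlgebra.evenOdd_isCompl (0 : QuadraticForm ℝ (Fin N → ℝ))).sup_eq_top
  obtain ⟨b, hb, c, hc, hbc⟩ := Submodule.mem_sup.1 (h ▸ Submodule.mem_top (x := a))
  rcases parity_cases p with rfl | rfl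
  · exact ⟨b, hb, c, hc, hbc.symm⟩
  · exact ⟨c, hc, b, hb, by rw [add_comm]; exact hbc.symm⟩

lemma eq_zero_of_mem_parts {a : Grassmann N} {p : ZMod 2} (h : a ∈ part N p)
    (h' : a ∈ part N (p + 1)) : a = 0 := by
  have hd := (CliffordAlgebra.evenOdd_isCompl (0 : QuadraticForm ℝ (Fin N → ℝ))).disjoint
  rcases parity_cases p with rfl | rfl
  · exact Submodule.disjoint_def.1 hd a h h'
  · exact Submodule.disjoint_def.1 hd a h' h

/-- If c is the odd component of the inverse, then a c is odd, and it is also even as the difference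
of 1 and an even element. Hence a c = 0, and c = 0 because a is invertible. -/
lemma inverse_mem_part {a : Grassmann N} (ha : a ∈ part N 0) : Ring.inverse a ∈ part N 0 := by
  by_cases hu : IsUnit a
  · obtain ⟨b, hb, c, hc, h⟩ := exists_parts (Ring.inverse a) 0
    have h1 : a * b + a * c = 1 := by rw [← mul_add, ← h, Ring.mul_inverse_cancel a hu]
    have h2 : a * c = 0 := by
      refine eq_zero_of_mem_parts (p := 0) ?_ (mul_mem_part ha hc)
      rw [eq_sub_of_add_eq' h1]
      exact sub_mem one_mem_part (by simpa using mul_mem_part ha hb)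
    have h3 : c = 0 := by
      rw [← Ring.inverse_mul_cancel_left a c hu, h2, mul_zero]
    rw [h, h3, add_zero]
    exact hb
  · rw [Ring.inverse_non_unit a hu]
    exact zero_mem _

lemma list_prod_mem_part (l : List (Grassmann N)) (h : ∀ a ∈ l, a ∈ part N 1) :
    l.prod ∈ part N (l.length : ZMod 2) := by
  induction l with
  | nil => simpa using one_mem_part
  | cons a l ih =>
    rw [List.prod_cons, List.length_cons, Nat.cast_succ, add_comm]
    exact mul_mem_part (h a (by simp)) (ih fun b hb => h b (by simp [hb]))

/-- The scalar is chosen before `N` and `ξ`: it is the sign of a permutation of the labels. This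
uniformity is what lets products of superfunctions be superfunctions. -/
lemma list_prod_perm {κ : Type} {l l' : List κ} (h : l.Perm l') :
    ∃ e : ℝ, e ≠ 0 ∧ ∀ (N : ℕ) (ξ : κ → Grassmann N), (∀ k, ξ k ∈ part N 1) →
      (l.map ξ).prod = e • (l'.map ξ).prod := by
  induction h with
  | nil => exact ⟨1, one_ne_zero, fun N ξ _ => (one_smul _ _).symm⟩
  | cons a _ ih =>
    obtain ⟨e, he, h⟩ := ih
    refine ⟨e, he, fun N ξ hξ => ?_⟩
    simp only [List.map_cons, List.prod_cons, h N ξ hξ, mul_smul_comm]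
  | swap a b l =>
    refine ⟨-1, by norm_num, fun N ξ hξ => ?_⟩
    simp only [List.map_cons, List.prod_cons, ← mul_assoc]
    rw [odd_anticommute (hξ b) (hξ a), neg_mul, neg_one_smul]
  | trans _ _ ih1 ih2 =>
    obtain ⟨e, he, h⟩ := ih1
    obtain ⟨e', he', h'⟩ := ih2
    refine ⟨e * e', mul_ne_zero he he', fun N ξ hξ => ?_⟩
    rw [h N ξ hξ, h' N ξ hξ, smul_smul]

/-- The product of the `ξ k`, `k ∈ I`, in increasing order. -/
def oddMonomial {κ : Type} [LinearOrder κ] (ξ : κ → Grassmann N) (I : Finset κ) : Grassmann N :=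
  ((I.sort (· ≤ ·)).map ξ).prod

lemma oddMonomial_empty {κ : Type} [LinearOrder κ] (ξ : κ → Grassmann N) :
    oddMonomial ξ ∅ = 1 := by
  simp [oddMonomial]

lemma oddMonomial_insert_min {κ : Type} [LinearOrder κ] (ξ : κ → Grassmann N) (a : κ)
    (I : Finset κ) (h : ∀ b ∈ I, a < b) :
    oddMonomial ξ (insert a I) = ξ a * oddMonomial ξ I := by
  rw [oddMonomial, Finset.sort_insert _ (fun b hb => (h b hb).le) fun ha => (h a ha).false,
    List.map_cons, List.prod_cons]
  rfl

lemma oddMonomial_mem_part {κ : Type} [LinearOrder κ] {ξ : κ → Grassmann N}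
    (hξ : ∀ k, ξ k ∈ part N 1) (I : Finset κ) : oddMonomial ξ I ∈ part N (I.card : ZMod 2) := by
  have := list_prod_mem_part ((I.sort (· ≤ ·)).map ξ) (by simp [hξ])
  simpa [oddMonomial] using this

lemma list_prod_of_nodup {κ : Type} [LinearOrder κ] {l : List κ} (h : l.Nodup) :
    ∃ e : ℝ, e ≠ 0 ∧ ∀ (N : ℕ) (ξ : κ → Grassmann N), (∀ k, ξ k ∈ part N 1) →
      (l.map ξ).prod = e • oddMonomial ξ l.toFinset :=
  list_prod_perm <| (List.perm_ext_iff_of_nodup h (Finset.sort_nodup _ _)).2 (by simp)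

lemma list_prod_of_not_nodup {κ : Type} {l : List κ} (h : ¬ l.Nodup)
    {N : ℕ} {ξ : κ → Grassmann N} (hξ : ∀ k, ξ k ∈ part N 1) : (l.map ξ).prod = 0 := by
  induction l with
  | nil => simp at h
  | cons a l ih =>
    by_cases hl : l.Nodup
    · have ha : a ∈ l := by
        by_contra ha
        exact h (List.nodup_cons.2 ⟨ha, hl⟩)
      classical
      obtain ⟨e, -, h'⟩ := list_prod_perm (List.perm_cons_erase ha)
      rw [List.map_cons, List.prod_cons, h' N ξ hξ, List.map_cons, List.prod_cons, mul_smul_comm,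
        odd_mul_mul_self (hξ a), smul_zero]
    · rw [List.map_cons, List.prod_cons, ih hl, mul_zero]

/-- Every product of odd variables is a multiple of one in increasing order. -/
lemma exists_list_prod_eq {κ : Type} [LinearOrder κ] (l : List κ) :
    ∃ (e : ℝ) (I : Finset κ), ∀ (N : ℕ) (ξ : κ → Grassmann N), (∀ k, ξ k ∈ part N 1) →
      (l.map ξ).prod = e • oddMonomial ξ I := by
  by_cases h : l.Nodup
  · obtain ⟨e, -, he⟩ := list_prod_of_nodup h
    exact ⟨e, _, he⟩
  · refine ⟨0, ∅, fun N ξ hξ => ?_⟩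
    rw [list_prod_of_not_nodup h hξ, zero_smul]

/-- The standard odd generators. -/
def gen (i : Fin N) : Grassmann N := ExteriorAlgebra.ι ℝ (Pi.single i 1)

lemma gen_mem_part (i : Fin N) : gen i ∈ part N 1 := CliffordAlgebra.ι_mem_evenOdd_one _ _

/-- Increasing products of the generators are the standard basis of the exterior algebra. All
uniqueness statements below rest on this. -/
lemma linearIndependent_oddMonomial_gen :
    LinearIndependent ℝ (oddMonomial (gen : Fin N → Grassmann N)) := by
  suffices h : oddMonomial (gen : Fin N → Grassmann N) = (Pi.basisFun ℝ (Fin N)).ExteriorAlgebra by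
    rw [h]
    exact (Pi.basisFun ℝ (Fin N)).ExteriorAlgebra.linearIndependent
  ext1 s
  rw [ExteriorAlgebra.basis_apply_ofCard _ (rfl : s.card = s.card)]
  change _ = ExteriorAlgebra.ιMulti ℝ s.card
    (⇑(Pi.basisFun ℝ (Fin N)) ∘ ⇑(s.orderEmbOfFin rfl))
  rw [ExteriorAlgebra.ιMulti_apply, oddMonomial,
    ← Finset.listMap_orderEmbOfFin_finRange s rfl, List.map_map, List.ofFn_eq_map]
  congr 1
  refine List.map_congr_left fun i _ => ?_
  simp [gen]

end GrassmannUnits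

/-! ### Taylor polynomials -/

section TaylorPolynomial

open Filter Topology Asymptotics MvPolynomial

variable {ι : Type} [Fintype ι] [DecidableEq ι]

/-- The directional derivative along a coordinate. -/
def coordDeriv (j : ι) (f : (ι → ℝ) → ℝ) : (ι → ℝ) → ℝ := fun x => fderiv ℝ f x (Pi.single j 1)

lemma contDiffAt_coordDeriv {f : (ι → ℝ) → ℝ} {b : ι → ℝ} (hf : ContDiffAt ℝ ∞ f b) (j : ι) :
    ContDiffAt ℝ ∞ (coordDeriv j f) b :=
  (hf.fderiv_right (m := ∞) (by simp)).clm_apply contDiffAt_const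

lemma eventually_contDiffAt {f : (ι → ℝ) → ℝ} {b : ι → ℝ} (hf : ContDiffAt ℝ ∞ f b) (n : ℕ) :
    ∀ᶠ x in 𝓝 b, ContDiffAt ℝ n f x :=
  (hf.of_le (by exact_mod_cast le_top) : ContDiffAt ℝ n f b).eventually (by simp)

lemma coordDeriv_comm {f : (ι → ℝ) → ℝ} {b : ι → ℝ} (hf : ContDiffAt ℝ ∞ f b) (i j : ι) :
    coordDeriv i (coordDeriv j f) =ᶠ[𝓝 b] coordDeriv j (coordDeriv i f) := by
  filter_upwards [eventually_contDiffAt hf 2] with x hx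
  have hd : DifferentiableAt ℝ (fderiv ℝ f) x :=
    (hx.fderiv_right (m := 1) (by norm_num)).differentiableAt (by simp)
  have h : ∀ i j : ι, coordDeriv i (coordDeriv j f) x =
      fderiv ℝ (fderiv ℝ f) x (Pi.single i 1) (Pi.single j 1) := by
    intro i j
    unfold coordDeriv
    rw [fderiv_clm_apply hd (differentiableAt_const _)]
    simp
  rw [h, h]
  exact (hx.isSymmSndFDerivAt (by simp)).eq _ _

/-- `k!` times the degree `k` part of the Taylor polynomial of `f` at `b`. -/
def taylorTerm (k : ℕ) (f : (ι → ℝ) → ℝ) (b : ι → ℝ) : MvPolynomial ι ℝ :=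
  ∑ i : Fin k → ι, C (iteratedFDeriv ℝ k f b fun l => Pi.single (i l) (1 : ℝ)) * ∏ l, X (i l)

lemma taylorTerm_zero (f : (ι → ℝ) → ℝ) (b : ι → ℝ) : taylorTerm 0 f b = C (f b) := by
  simp [taylorTerm]

lemma taylorTerm_congr {f g : (ι → ℝ) → ℝ} {b : ι → ℝ} (h : f =ᶠ[𝓝 b] g) (k : ℕ) :
    taylorTerm k f b = taylorTerm k g b := by
  simp only [taylorTerm, (h.iteratedFDeriv ℝ k).eq_of_nhds]

/-- The last argument of the iterated derivative is split off: the derivative of order k + 1 of `f`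
is the one of order k of `fderiv ℝ f`, and evaluation at a basis vector commutes with
differentiation. -/
lemma taylorTerm_succ {f : (ι → ℝ) → ℝ} {b : ι → ℝ} (hf : ContDiffAt ℝ ∞ f b) (k : ℕ) :
    taylorTerm (k + 1) f b = ∑ j, X j * taylorTerm k (coordDeriv j f) b := by
  unfold taylorTerm
  rw [← (Fin.snocEquiv fun _ : Fin (k + 1) => ι).sum_comp, Fintype.sum_prod_type]
  refine Finset.sum_congr rfl fun j _ => ?_
  rw [Finset.mul_sum]
  refine Finset.sum_congr rfl fun i _ => ?_
  have h0 : coordDeriv j f =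
      ContinuousLinearMap.apply ℝ ℝ (Pi.single j (1 : ℝ) : ι → ℝ) ∘ fderiv ℝ f := rfl
  have h := (ContinuousLinearMap.apply ℝ ℝ (Pi.single j (1 : ℝ) : ι → ℝ)).iteratedFDeriv_comp_left
    (i := k) (hf.fderiv_right (m := ∞) (by simp)) (by exact_mod_cast le_top)
  rw [← h0] at h
  rw [iteratedFDeriv_succ_apply_right, Fin.prod_univ_castSucc, h]
  have h1 : (Fin.init (α := fun _ => ι → ℝ) fun l =>
      Pi.single (Fin.snocEquiv (fun _ => ι) (j, i) l) (1 : ℝ)) =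
      fun l => (Pi.single (i l) (1 : ℝ) : ι → ℝ) := by
    ext1 l
    simp [Fin.init_def]
  rw [h1]
  simp only [Fin.snocEquiv_apply, Fin.snoc_last, Fin.snoc_castSucc,
    ContinuousLinearMap.compContinuousMultilinearMap_coe, Function.comp_apply,
    ContinuousLinearMap.apply_apply]
  ring

/-- Induction through `taylorTerm_succ`. The product rule gives one copy of the wanted term from the
explicit variable, and the symmetry of second derivatives collects the other k + 1. -/
lemma pderiv_taylorTerm {f : (ι → ℝ) → ℝ} {b : ι → ℝ} (hf : ContDiffAt ℝ ∞ f b) (k : ℕ) (j : ι) :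
    pderiv j (taylorTerm (k + 1) f b) = (k + 1) • taylorTerm k (coordDeriv j f) b := by
  induction k generalizing f with
  | zero =>
    rw [taylorTerm_succ hf, map_sum, Finset.sum_eq_single j]
    · simp [taylorTerm_zero]
    · intro i _ hi
      simp [taylorTerm_zero, pderiv_X_of_ne hi]
    · simp
  | succ k ih =>
    rw [taylorTerm_succ hf, map_sum]
    simp only [pderiv_mul, ih (contDiffAt_coordDeriv hf _), Finset.sum_add_distrib]
    have h1 : ∑ i, pderiv j (X i) * taylorTerm (k + 1) (coordDeriv i f) b =
        taylorTerm (k + 1) (coordDeriv j f) b := by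
      rw [Finset.sum_eq_single j]
      · simp
      · intro i _ hi
        simp [pderiv_X_of_ne hi]
      · simp
    have h2 : ∀ i, taylorTerm k (coordDeriv j (coordDeriv i f)) b =
        taylorTerm k (coordDeriv i (coordDeriv j f)) b := fun i =>
      taylorTerm_congr (coordDeriv_comm hf j i) k
    simp only [h1, h2, mul_smul_comm, ← Finset.smul_sum]
    rw [← taylorTerm_succ (contDiffAt_coordDeriv hf j), ← succ_nsmul', add_assoc]

/-- The Taylor polynomial of degree `N` of `f` at `b`, in the displacement from `b`. -/
def taylorPoly (N : ℕ) (f : (ι → ℝ) → ℝ) (b : ι → ℝ) : MvPolynomial ι ℝ :=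
  ∑ k ∈ Finset.range (N + 1), (k.factorial : ℝ)⁻¹ • taylorTerm k f b

lemma pderiv_taylorPoly {f : (ι → ℝ) → ℝ} {b : ι → ℝ} (hf : ContDiffAt ℝ ∞ f b) (N : ℕ) (j : ι) :
    pderiv j (taylorPoly (N + 1) f b) = taylorPoly N (coordDeriv j f) b := by
  unfold taylorPoly
  rw [Finset.sum_range_succ', map_add, map_sum, taylorTerm_zero]
  simp only [Nat.factorial_zero, Nat.cast_one, inv_one, one_smul, pderiv_C, add_zero]
  refine Finset.sum_congr rfl fun k _ => ?_
  rw [Derivation.map_smul, pderiv_taylorTerm hf, ← Nat.cast_smul_eq_nsmul ℝ, smul_smul, Nat.factorial_succ]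
  congr 1
  have : (k.factorial : ℝ) ≠ 0 := by exact_mod_cast k.factorial_ne_zero
  push_cast
  field_simp

lemma hasFDerivAt_eval (P : MvPolynomial ι ℝ) (v : ι → ℝ) :
    HasFDerivAt (fun v => MvPolynomial.eval v P)
      (∑ j, MvPolynomial.eval v (pderiv j P) • ContinuousLinearMap.proj (R := ℝ)
        (φ := fun _ : ι => ℝ) j) v := by
  induction P using MvPolynomial.induction_on with
  | C a => simpa using hasFDerivAt_const a v
  | add p q hp hq =>
    have h := hp.add hq
    simp only [map_add, add_smul, Finset.sum_add_distrib]
    exact h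
  | mul_X p i hp =>
    have h := hp.mul (ContinuousLinearMap.proj (R := ℝ) (φ := fun _ : ι => ℝ) i).hasFDerivAt (x := v)
    simp only [map_mul, eval_X]
    refine h.congr_fderiv ?_
    ext w
    simp [pderiv_X, Pi.single_apply, Finset.sum_add_distrib, Finset.mul_sum,
      mul_add, mul_comm, mul_left_comm, apply_ite (MvPolynomial.eval v)]

lemma eval_zero_taylorPoly {f : (ι → ℝ) → ℝ} {b : ι → ℝ} (hf : ContDiffAt ℝ ∞ f b) (N : ℕ) :
    MvPolynomial.eval 0 (taylorPoly N f b) = f b := by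
  unfold taylorPoly
  rw [Finset.sum_range_succ', map_add, map_sum]
  simp [taylorTerm_zero, taylorTerm_succ hf]

/-- Taylor's theorem. -/
theorem sub_taylorPoly_isLittleO {f : (ι → ℝ) → ℝ} {b : ι → ℝ} (hf : ContDiffAt ℝ ∞ f b) (N : ℕ) :
    (fun v => f (b + v) - MvPolynomial.eval v (taylorPoly N f b)) =o[𝓝 0] fun v => ‖v‖ ^ N := by
  have hadd : Tendsto (fun v => b + v) (𝓝 0) (𝓝 b) := by
    have : Continuous fun v => b + v := by fun_prop
    simpa using this.tendsto 0
  induction N generalizing f with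
  | zero =>
    have h0 : taylorPoly 0 f b = C (f b) := by simp [taylorPoly, taylorTerm_zero]
    simp only [pow_zero, h0, eval_C]
    refine (isLittleO_one_iff ℝ).2 ?_
    have := (hf.continuousAt.tendsto.comp hadd).sub_const (f b)
    simpa using this
  | succ N ih =>
    -- The gradient of the remainder of order N + 1 consists of the order N remainders of the
    -- partial derivatives. The mean value inequality on the closed ball of radius ‖v‖ then gains
    -- one power of ‖v‖.
    set R : (ι → ℝ) → ℝ := fun v => f (b + v) - MvPolynomial.eval v (taylorPoly (N + 1) f b) with hR
    set G : ι → (ι → ℝ) → ℝ := fun j v =>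
      coordDeriv j f (b + v) - MvPolynomial.eval v (taylorPoly N (coordDeriv j f) b) with hG
    have hGo : (fun v => ∑ j, ‖G j v‖) =o[𝓝 0] fun v => ‖v‖ ^ N :=
      IsLittleO.fun_sum fun j _ => (ih (contDiffAt_coordDeriv hf j)).norm_left
    have hderiv : ∀ᶠ v in 𝓝 0, HasFDerivAt R (∑ j, G j v • ContinuousLinearMap.proj (R := ℝ)
        (φ := fun _ : ι => ℝ) j) v := by
      filter_upwards [hadd.eventually (eventually_contDiffAt hf 1)] with v hv
      have h1 : HasFDerivAt (fun v => f (b + v)) (fderiv ℝ f (b + v)) v := by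
        have := (hv.differentiableAt (by simp)).hasFDerivAt
        exact (this.comp v ((hasFDerivAt_id v).const_add b)).congr_fderiv
          (ContinuousLinearMap.comp_id _)
      refine (h1.sub (hasFDerivAt_eval (taylorPoly (N + 1) f b) v)).congr_fderiv ?_
      ext w
      have hw : fderiv ℝ f (b + v) w = ∑ j, coordDeriv j f (b + v) * w j := by
        have hs : w = ∑ j, w j • (Pi.single j (1 : ℝ) : ι → ℝ) := by
          ext i
          simp [Finset.sum_apply, Pi.single_apply]
        conv_lhs => rw [hs, map_sum]
        refine Finset.sum_congr rfl fun j _ => ?_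
        rw [map_smul, smul_eq_mul, mul_comm]
        rfl
      simp [hw, hG, pderiv_taylorPoly hf, sub_mul, Finset.sum_sub_distrib]
    have hR0 : R 0 = 0 := by
      rw [hR]
      beta_reduce
      rw [eval_zero_taylorPoly hf, add_zero, sub_self]
    rw [isLittleO_iff]
    intro c hc
    have hev := hderiv.and ((isLittleO_iff.1 hGo) hc)
    obtain ⟨r, hr, hball⟩ := Metric.eventually_nhds_iff_ball.1 hev
    filter_upwards [Metric.ball_mem_nhds 0 hr] with v hv
    have hvr : ‖v‖ < r := by simpa using hv
    have hsub : ∀ w ∈ Metric.closedBall (0 : ι → ℝ) ‖v‖, w ∈ Metric.ball (0 : ι → ℝ) r :=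
      fun w hw => Metric.closedBall_subset_ball hvr hw
    have hmv := Convex.norm_image_sub_le_of_norm_hasFDerivWithin_le (f := R) (C := c * ‖v‖ ^ N)
      (s := Metric.closedBall (0 : ι → ℝ) ‖v‖) (x := 0) (y := v)
      (fun w hw => (hball w (hsub w hw)).1.hasFDerivWithinAt) (fun w hw => ?_)
      (convex_closedBall _ _) (by simp) (by simp)
    · rw [hR0, sub_zero, sub_zero] at hmv
      calc ‖R v‖ ≤ c * ‖v‖ ^ N * ‖v‖ := hmv
        _ = c * ‖‖v‖ ^ (N + 1)‖ := by rw [norm_pow, norm_norm, pow_succ, mul_assoc]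
    · have h2 := (hball w (hsub w hw)).2
      have hwv : ‖w‖ ≤ ‖v‖ := by simpa using hw
      rw [Real.norm_of_nonneg (Finset.sum_nonneg fun _ _ => norm_nonneg _), norm_pow,
        norm_norm] at h2
      refine le_trans ?_ (h2.trans (by gcongr))
      refine ContinuousLinearMap.opNorm_le_bound _
        (Finset.sum_nonneg fun _ _ => norm_nonneg _) fun u => ?_
      rw [sum_apply, Finset.sum_mul]
      refine (norm_sum_le _ _).trans (Finset.sum_le_sum fun j _ => ?_)
      simp only [smul_apply, ContinuousLinearMap.proj_apply, smul_eq_mul, norm_mul]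
      gcongr
      exact norm_le_pi_norm u j

/-- One factor X is split off at a time: the quotient tends to 0 at 0, so its constant term
vanishes. -/
lemma X_pow_dvd_of_isLittleO {p : Polynomial ℝ} {N : ℕ}
    (h : (fun t => p.eval t) =o[𝓝 0] fun t : ℝ => t ^ N) : Polynomial.X ^ (N + 1) ∣ p := by
  have key : ∀ k ≤ N + 1, Polynomial.X ^ k ∣ p := by
    intro k
    induction k with
    | zero => intro _; simp
    | succ k ih =>
      intro hk
      obtain ⟨q, rfl⟩ := ih (by omega)
      have h1 : (fun t => (Polynomial.X ^ k * q).eval t) =o[𝓝 0] fun t : ℝ => t ^ k := by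
        refine h.trans_isBigO ?_
        refine IsBigO.of_bound 1 ?_
        filter_upwards [Metric.ball_mem_nhds (0 : ℝ) one_pos] with t ht
        rw [one_mul, norm_pow, norm_pow]
        refine pow_le_pow_of_le_one (norm_nonneg _) ?_ (by omega)
        simpa using (le_of_lt (by simpa using ht : |t| < 1))
      have h2 : Tendsto (fun t => q.eval t) (𝓝[≠] 0) (𝓝 0) := by
        have h3 := (h1.mono (nhdsWithin_le_nhds (s := {0}ᶜ))).tendsto_div_nhds_zero
        refine h3.congr' ?_
        filter_upwards [self_mem_nhdsWithin] with t ht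
        have : t ^ k ≠ 0 := pow_ne_zero _ ht
        simp only [Polynomial.eval_mul, Polynomial.eval_pow, Polynomial.eval_X]
        field_simp
      have h4 : q.eval 0 = 0 := tendsto_nhds_unique
        ((q.continuous.tendsto 0).mono_left nhdsWithin_le_nhds) h2
      rw [pow_succ]
      refine mul_dvd_mul_left _ ?_
      rwa [Polynomial.X_dvd_iff, Polynomial.coeff_zero_eq_eval_zero]
  exact key _ le_rfl

/-- A polynomial that vanishes to order `N` has no terms of degree at most `N`. -/
lemma coeff_eq_zero_of_isLittleO {Q : MvPolynomial ι ℝ} {N : ℕ}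
    (h : (fun v => MvPolynomial.eval v Q) =o[𝓝 0] fun v : ι → ℝ => ‖v‖ ^ N) (d : ι →₀ ℕ)
    (hd : d.degree ≤ N) : Q.coeff d = 0 := by
  -- Restriction to the line t ↦ t v: the coefficient of t^k is the value at v of the homogeneous
  -- component of degree k. This reduces the claim to polynomials in one variable.
  have hcomp : ∀ (v : ι → ℝ) (k : ℕ) (Q : MvPolynomial ι ℝ),
      (MvPolynomial.aeval (fun i => Polynomial.C (v i) * Polynomial.X) Q).coeff k =
        MvPolynomial.eval v (homogeneousComponent k Q) := by
    intro v k Q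
    induction Q using MvPolynomial.induction_on' with
    | monomial u a =>
      rw [aeval_monomial, Finsupp.prod_fintype _ _ (by simp)]
      simp only [mul_pow, Finset.prod_mul_distrib, ← Polynomial.C_pow]
      rw [Finset.prod_pow_eq_pow_sum, ← map_prod]
      have hu : ∑ i, u i = u.degree := (Finsupp.degree_eq_sum u).symm
      rw [hu, ← mul_assoc, Polynomial.algebraMap_eq, ← Polynomial.C_mul,
        Polynomial.coeff_C_mul, Polynomial.coeff_X_pow,
        homogeneousComponent_of_mem ((mem_homogeneousSubmodule _ _).2
          (isHomogeneous_monomial a (rfl : u.degree = u.degree)))]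
      split_ifs <;> simp [eval_monomial, Finsupp.prod_fintype]
    | add p q hp hq => simp [hp, hq]
  have hzero : homogeneousComponent d.degree Q = 0 := by
    refine MvPolynomial.funext fun v => ?_
    rw [map_zero, ← hcomp]
    set p := MvPolynomial.aeval (fun i => Polynomial.C (v i) * Polynomial.X) Q with hp
    have hev : ∀ t : ℝ, p.eval t = MvPolynomial.eval (t • v) Q := by
      intro t
      rw [hp]
      clear hp p h
      induction Q using MvPolynomial.induction_on with
      | C a => simp
      | add p q hp hq => simp only [map_add, Polynomial.eval_add, hp, hq]
      | mul_X p i hp => simp [hp, mul_comm t]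
    have ht : Tendsto (fun t : ℝ => t • v) (𝓝 0) (𝓝 0) := by
      have : Continuous fun t : ℝ => t • v := by fun_prop
      simpa using this.tendsto 0
    have ho : (fun t => p.eval t) =o[𝓝 0] fun t : ℝ => t ^ N := by
      simp only [hev]
      refine (h.comp_tendsto ht).trans_isBigO (IsBigO.of_bound (‖v‖ ^ N) (Eventually.of_forall ?_))
      intro t
      simp [norm_smul, mul_pow, mul_comm]
    exact Polynomial.X_pow_dvd_iff.1 (X_pow_dvd_of_isLittleO ho) _ (by omega)
  have := congrArg (coeff d) hzero
  rwa [coeff_homogeneousComponent, if_pos rfl, coeff_zero] at this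

end TaylorPolynomial

/-! ### Taylor expansions at Grassmann-valued points -/

section TaylorValue

open Filter Topology Asymptotics

variable {ι : Type} [Fintype ι] [DecidableEq ι] {N : ℕ}

lemma soul_mem_part {a : Grassmann N} (ha : a ∈ part N 0) : soul a ∈ part N 0 :=
  sub_mem ha (algebraMap_mem_part _)

lemma body_soul (a : Grassmann N) : body (soul a) = 0 := by
  rw [soul, map_sub, body_algebraMap, sub_self]

lemma algebraMap_body_add_soul (a : Grassmann N) :
    algebraMap ℝ (Grassmann N) (body a) + soul a = a := by
  rw [soul, add_sub_cancel]

lemma soul_add (a b : Grassmann N) : soul (a + b) = soul a + soul b := by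
  simp only [soul, map_add]; abel

lemma soul_of_body_eq_zero {a : Grassmann N} (h : body a = 0) : soul a = a := by
  rw [soul, h, map_zero, sub_zero]

/-- Evaluation of polynomials at a tuple of even elements of the Grassmann algebra. -/
def polyHom {s : ι → Grassmann N} (hs : ∀ j, s j ∈ part N 0) :
    MvPolynomial ι ℝ →ₐ[ℝ] Grassmann N :=
  (Subalgebra.center ℝ (Grassmann N)).val.comp
    (MvPolynomial.aeval fun j => (⟨s j, Subalgebra.mem_center_iff.2 fun b =>
      (even_commute (hs j) b).symm⟩ : Subalgebra.center ℝ (Grassmann N)))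

@[simp] lemma polyHom_X {s : ι → Grassmann N} (hs : ∀ j, s j ∈ part N 0) (j : ι) :
    polyHom hs (MvPolynomial.X j) = s j := by
  simp [polyHom]

@[simp] lemma polyHom_C {s : ι → Grassmann N} (hs : ∀ j, s j ∈ part N 0) (r : ℝ) :
    polyHom hs (MvPolynomial.C r) = algebraMap ℝ _ r :=
  (polyHom hs).commutes r

lemma polyHom_mem_part {s : ι → Grassmann N} (hs : ∀ j, s j ∈ part N 0) (P : MvPolynomial ι ℝ) :
    polyHom hs P ∈ part N 0 := by
  induction P using MvPolynomial.induction_on with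
  | C a => rw [polyHom_C]; exact algebraMap_mem_part a
  | add p q hp hq => rw [map_add]; exact add_mem hp hq
  | mul_X p i hp => rw [map_mul, polyHom_X]; simpa using mul_mem_part hp (hs i)

/-- A monomial of degree above N in nilpotent elements lies in `souls N ^ (N + 1)`, which is zero.
-/
lemma polyHom_eq_zero {s : ι → Grassmann N} (hs : ∀ j, s j ∈ part N 0) (hb : ∀ j, body (s j) = 0)
    {Q : MvPolynomial ι ℝ} (hQ : ∀ d : ι →₀ ℕ, d.degree ≤ N → Q.coeff d = 0) :
    polyHom hs Q = 0 := by
  have hmem : ∀ d : ι →₀ ℕ, polyHom hs (MvPolynomial.monomial d 1) ∈ souls N ^ d.degree := by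
    intro d
    induction d using Finsupp.induction_linear with
    | zero => simp
    | add f g hf hg =>
      rw [← one_mul (1 : ℝ), ← MvPolynomial.monomial_mul, map_mul, map_add, pow_add]
      exact Submodule.mul_mem_mul hf hg
    | single i n =>
      rw [← MvPolynomial.X_pow_eq_monomial, map_pow, polyHom_X, Finsupp.degree_single]
      exact Submodule.pow_mem_pow _ (mem_souls_iff.2 (hb i)) n
  rw [Q.as_sum, map_sum]
  refine Finset.sum_eq_zero fun d _ => ?_
  by_cases hd : d.degree ≤ N
  · rw [hQ d hd, map_zero, map_zero]
  · obtain ⟨r, hr⟩ := Nat.exists_eq_add_of_le (show N + 1 ≤ d.degree by omega)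
    have h := hmem d
    rw [hr, pow_add, souls_pow_eq_bot, Submodule.bot_mul, Submodule.mem_bot] at h
    rw [← mul_one (Q.coeff d), ← MvPolynomial.C_mul_monomial, map_mul, h, mul_zero]

lemma taylor_eq_polyHom {x : ι → Grassmann N} (hx : ∀ j, x j ∈ part N 0) (f : (ι → ℝ) → ℝ) :
    taylor f x = polyHom (fun j => soul_mem_part (hx j))
      (taylorPoly N f fun j => body (x j)) := by
  unfold taylor taylorPoly taylorTerm
  rw [map_sum]
  refine Finset.sum_congr rfl fun k _ => ?_
  rw [map_smul, map_sum, Finset.smul_sum]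
  refine Finset.sum_congr rfl fun i _ => ?_
  rw [map_mul, polyHom_C, ← Algebra.smul_def, smul_smul, ← List.prod_ofFn, map_list_prod,
    List.map_ofFn]
  congr 3
  ext l
  simp

/-- `P` agrees with `f` near `b` up to order `N`. -/
def Approximates (N : ℕ) (f : (ι → ℝ) → ℝ) (b : ι → ℝ) (P : MvPolynomial ι ℝ) : Prop :=
  (fun v => f (b + v) - MvPolynomial.eval v P) =o[𝓝 0] fun v => ‖v‖ ^ N

lemma approximates_taylorPoly {f : (ι → ℝ) → ℝ} {b : ι → ℝ} (hf : ContDiffAt ℝ ∞ f b) (N : ℕ) :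
    Approximates N f b (taylorPoly N f b) :=
  sub_taylorPoly_isLittleO hf N

lemma Approximates.of_succ {f : (ι → ℝ) → ℝ} {b : ι → ℝ} {P : MvPolynomial ι ℝ}
    (h : Approximates (N + 1) f b P) : Approximates N f b P := by
  refine h.trans_isBigO (IsBigO.of_bound 1 ?_)
  filter_upwards [Metric.ball_mem_nhds (0 : ι → ℝ) one_pos] with v hv
  rw [one_mul, norm_pow, norm_pow, norm_norm]
  exact pow_le_pow_of_le_one (norm_nonneg _) (by simpa using (mem_ball_zero_iff.1 hv).le) (by omega)

/-- Only the N-jet of `f` matters, so any polynomial with that jet computes the value. The product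
and chain rules below thus become estimates of remainders instead of identities between Taylor
coefficients. -/
lemma taylor_eq_of_approximates {x : ι → Grassmann N} (hx : ∀ j, x j ∈ part N 0)
    {f : (ι → ℝ) → ℝ} (hf : ContDiffAt ℝ ∞ f fun j => body (x j)) {P : MvPolynomial ι ℝ}
    (hP : Approximates N f (fun j => body (x j)) P) :
    taylor f x = polyHom (fun j => soul_mem_part (hx j)) P := by
  rw [taylor_eq_polyHom hx, ← sub_eq_zero, ← map_sub]
  refine polyHom_eq_zero _ (fun j => body_soul _) fun d hd => coeff_eq_zero_of_isLittleO ?_ d hd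
  have h := hP.sub (approximates_taylorPoly hf N)
  refine h.congr_left fun v => ?_
  rw [map_sub]
  ring

lemma taylor_mem_part {x : ι → Grassmann N} (hx : ∀ j, x j ∈ part N 0) (f : (ι → ℝ) → ℝ) :
    taylor f x ∈ part N 0 := by
  rw [taylor_eq_polyHom hx]
  exact polyHom_mem_part _ _

lemma body_polyHom {s : ι → Grassmann N} (hs : ∀ j, s j ∈ part N 0) (P : MvPolynomial ι ℝ) :
    body (polyHom hs P) = MvPolynomial.eval (fun j => body (s j)) P := by
  induction P using MvPolynomial.induction_on with
  | C a => simp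
  | add p q hp hq => simp [hp, hq]
  | mul_X p i hp => simp [hp]

lemma body_taylor {x : ι → Grassmann N} (hx : ∀ j, x j ∈ part N 0) {f : (ι → ℝ) → ℝ}
    (hf : ContDiffAt ℝ ∞ f fun j => body (x j)) :
    body (taylor f x) = f fun j => body (x j) := by
  rw [taylor_eq_polyHom hx, body_polyHom]
  simp only [body_soul]
  exact eval_zero_taylorPoly hf N

lemma taylor_congr {x : ι → Grassmann N} {f g : (ι → ℝ) → ℝ}
    (h : f =ᶠ[𝓝 fun j => body (x j)] g) : taylor f x = taylor g x := by
  unfold taylor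
  simp only [(h.iteratedFDeriv ℝ _).eq_of_nhds]

lemma taylor_const (r : ℝ) (x : ι → Grassmann N) (hx : ∀ j, x j ∈ part N 0) :
    taylor (fun _ => r) x = algebraMap ℝ _ r := by
  rw [taylor_eq_of_approximates hx contDiffAt_const (P := MvPolynomial.C r), polyHom_C]
  simp [Approximates]

lemma taylor_coord (j : ι) (x : ι → Grassmann N) (hx : ∀ j, x j ∈ part N 0) :
    taylor (fun v => v j) x = x j := by
  rw [taylor_eq_of_approximates hx (contDiff_apply ℝ ℝ j).contDiffAt
    (P := MvPolynomial.C (body (x j)) + MvPolynomial.X j), map_add, polyHom_C, polyHom_X,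
    algebraMap_body_add_soul]
  simp [Approximates]

lemma eval_isBigO_one (P : MvPolynomial ι ℝ) :
    (fun v => MvPolynomial.eval v P) =O[𝓝 0] fun _ => (1 : ℝ) :=
  ((hasFDerivAt_eval P 0).continuousAt.tendsto).isBigO_one ℝ

lemma tendsto_const_add (b : ι → ℝ) : Tendsto (fun v => b + v) (𝓝 0) (𝓝 b) := by
  have : Continuous fun v => b + v := by fun_prop
  simpa using this.tendsto 0

lemma taylor_mul {x : ι → Grassmann N} (hx : ∀ j, x j ∈ part N 0) {f g : (ι → ℝ) → ℝ}
    (hf : ContDiffAt ℝ ∞ f fun j => body (x j)) (hg : ContDiffAt ℝ ∞ g fun j => body (x j)) :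
    taylor (fun v => f v * g v) x = taylor f x * taylor g x := by
  rw [taylor_eq_polyHom hx f, taylor_eq_polyHom hx g, ← map_mul]
  refine taylor_eq_of_approximates hx (hf.mul hg) ?_
  have hfO : (fun v => f ((fun j => body (x j)) + v)) =O[𝓝 0] fun _ => (1 : ℝ) :=
    (hf.continuousAt.tendsto.comp (tendsto_const_add _)).isBigO_one ℝ
  have h1 := hfO.mul_isLittleO (approximates_taylorPoly hg N)
  have h2 := (approximates_taylorPoly hf N).mul_isBigO
    (eval_isBigO_one (taylorPoly N g fun j => body (x j)))
  simp only [one_mul] at h1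
  simp only [mul_one] at h2
  refine (h1.add h2).congr_left fun v => ?_
  rw [map_mul]
  ring

lemma taylor_comp {ι' : Type} [Fintype ι'] [DecidableEq ι'] {x : ι → Grassmann N}
    (hx : ∀ j, x j ∈ part N 0) {g : (ι' → ℝ) → ℝ} {φ : (ι → ℝ) → ι' → ℝ}
    (hφ : ContDiffAt ℝ ∞ φ fun j => body (x j))
    (hg : ContDiffAt ℝ ∞ g (φ fun j => body (x j))) :
    taylor g (fun j => taylor (fun v => φ v j) x) = taylor (fun v => g (φ v)) x := by
  set b : ι → ℝ := fun j => body (x j) with hb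
  have hφj : ∀ j, ContDiffAt ℝ ∞ (fun v => φ v j) b := contDiffAt_pi.1 hφ
  have hs := fun j => soul_mem_part (hx j)
  have hx' : ∀ j, taylor (fun v => φ v j) x ∈ part N 0 := fun j => taylor_mem_part hx _
  have hbody : (fun j => body (taylor (fun v => φ v j) x)) = φ b :=
    funext fun j => body_taylor hx (hφj j)
  -- Taylor polynomials of the components without their constant terms. Their values are the souls
  -- of the components of φ(x), so substituting them into the Taylor polynomial of g matches
  -- composition.
  set R : ι' → MvPolynomial ι ℝ := fun j =>
    taylorPoly N (fun v => φ v j) b - MvPolynomial.C (φ b j) with hR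
  have hsoul : ∀ j, soul (taylor (fun v => φ v j) x) = polyHom hs (R j) := by
    intro j
    rw [hR, map_sub, polyHom_C, ← taylor_eq_polyHom hx, soul, body_taylor hx (hφj j)]
  have hcomp : ∀ P : MvPolynomial ι' ℝ, polyHom (fun j => soul_mem_part (hx' j)) P =
      polyHom hs (MvPolynomial.bind₁ R P) := by
    intro P
    have : polyHom (fun j => soul_mem_part (hx' j)) =
        (polyHom hs).comp (MvPolynomial.bind₁ R) := by
      refine MvPolynomial.algHom_ext fun j => ?_
      simp [hsoul]
    rw [this, AlgHom.comp_apply]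
  rw [taylor_eq_polyHom hx' g, hcomp, hbody]
  refine (taylor_eq_of_approximates hx (hg.comp b hφ) ?_).symm
  set P := taylorPoly N g (φ b) with hP
  have hw : Tendsto (fun v => φ (b + v) - φ b) (𝓝 0) (𝓝 0) := by
    simpa using (hφ.continuousAt.tendsto.comp (tendsto_const_add b)).sub_const (φ b)
  have hwO : (fun v => φ (b + v) - φ b) =O[𝓝 0] fun v => v := by
    have := (hφ.differentiableAt (by simp)).isBigO_sub.comp_tendsto (tendsto_const_add b)
    simpa [Function.comp_def] using this
  have h1 : (fun v => g (φ (b + v)) - MvPolynomial.eval (φ (b + v) - φ b) P) =o[𝓝 0]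
      fun v => ‖v‖ ^ N := by
    have := (approximates_taylorPoly hg N).comp_tendsto hw
    refine (this.trans_isBigO (hwO.norm_norm.pow N)).congr_left fun v => ?_
    simp [hP]
  have hRv : ∀ j, (fun v => φ (b + v) j - φ b j - MvPolynomial.eval v (R j)) =o[𝓝 0]
      fun v => ‖v‖ ^ N := fun j =>
    (approximates_taylorPoly (hφj j) N).congr_left fun v => by simp [hR]
  have hRtend : Tendsto (fun v j => MvPolynomial.eval v (R j)) (𝓝 0) (𝓝 0) := by
    refine tendsto_pi_nhds.2 fun j => ?_
    have := (hasFDerivAt_eval (R j) 0).continuousAt.tendsto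
    rwa [show MvPolynomial.eval 0 (R j) = 0 by
      rw [hR, map_sub, eval_zero_taylorPoly (hφj j), MvPolynomial.eval_C, sub_self]] at this
  -- A polynomial is Lipschitz near 0, so replacing the displacement of φ by its Taylor polynomials
  -- changes the value of P only by o(‖v‖^N).
  obtain ⟨K, t, ht, hlip⟩ := (show ContDiffAt ℝ 1 (fun w => MvPolynomial.eval w P) 0 from
    ((AnalyticOnNhd.eval_mvPolynomial P).contDiff.contDiffAt)).exists_lipschitzOnWith
  have h2 : (fun v => MvPolynomial.eval (φ (b + v) - φ b) P -
      MvPolynomial.eval (fun j => MvPolynomial.eval v (R j)) P) =o[𝓝 0] fun v => ‖v‖ ^ N := by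
    have hpi : (fun v => (φ (b + v) - φ b) - fun j => MvPolynomial.eval v (R j)) =o[𝓝 0]
        fun v => ‖v‖ ^ N := isLittleO_pi.2 hRv
    refine IsBigO.trans_isLittleO (IsBigO.of_bound K ?_) hpi
    filter_upwards [hw ht, hRtend ht] with v hv1 hv2
    exact hlip.norm_sub_le hv1 hv2
  change (fun v => g (φ (b + v)) - MvPolynomial.eval v (MvPolynomial.bind₁ R P)) =o[𝓝 0] _
  refine (h1.add h2).congr_left fun v => ?_
  have : MvPolynomial.eval v (MvPolynomial.bind₁ R P) =
      MvPolynomial.eval (fun j => MvPolynomial.eval v (R j)) P := by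
    induction P using MvPolynomial.induction_on with
    | C a => simp
    | add p q hp hq => simp [hp, hq]
    | mul_X p i hp => simp [hp]
  rw [this, sub_add_sub_cancel]

/-- All products of two increments vanish, squares included, so the Taylor formula of a polynomial
stops after the linear term. -/
lemma polyHom_add {s d : ι → Grassmann N} (hs : ∀ j, s j ∈ part N 0) (hd : ∀ j, d j ∈ part N 0)
    (hdd : ∀ i j, d i * d j = 0) (P : MvPolynomial ι ℝ) :
    polyHom (fun j => add_mem (hs j) (hd j)) P =
      polyHom hs P + ∑ j, d j * polyHom hs (MvPolynomial.pderiv j P) := by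
  induction P using MvPolynomial.induction_on with
  | C a => simp
  | add p q hp hq => simp only [map_add, hp, hq, mul_add, Finset.sum_add_distrib]; abel
  | mul_X p i hp =>
    have h1 : (∑ j, d j * polyHom hs (MvPolynomial.pderiv j p)) * d i = 0 := by
      rw [Finset.sum_mul]
      refine Finset.sum_eq_zero fun j _ => ?_
      rw [mul_assoc, ← even_commute (hd i), ← mul_assoc, hdd, zero_mul]
    have h2 : ∑ j, d j * polyHom hs (MvPolynomial.pderiv j (p * MvPolynomial.X i)) =
        polyHom hs p * d i + (∑ j, d j * polyHom hs (MvPolynomial.pderiv j p)) * s i := by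
      simp only [MvPolynomial.pderiv_mul, map_add, map_mul, polyHom_X, mul_add,
        Finset.sum_add_distrib, Finset.sum_mul, ← mul_assoc]
      rw [add_comm]
      congr 1
      rw [Finset.sum_eq_single i]
      · simp [even_commute (hd i)]
      · intro j _ hj
        simp [MvPolynomial.pderiv_X_of_ne hj.symm]
      · simp
    rw [map_mul, hp, polyHom_X, add_mul, mul_add, mul_add, h1, add_zero, h2, map_mul, polyHom_X]
    abel

/-- First order Taylor expansion in an even nilpotent direction. -/
lemma taylor_add_of_mul_eq_zero {x d : ι → Grassmann N} (hx : ∀ j, x j ∈ part N 0)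
    (hd : ∀ j, d j ∈ part N 0) (hb : ∀ j, body (d j) = 0) (hdd : ∀ i j, d i * d j = 0)
    {f : (ι → ℝ) → ℝ} (hf : ContDiffAt ℝ ∞ f fun j => body (x j)) :
    taylor f (fun j => x j + d j) = taylor f x + ∑ j, d j * taylor (coordDeriv j f) x := by
  have hbody : (fun j => body (x j + d j)) = fun j => body (x j) := by
    ext j; rw [map_add, hb, add_zero]
  -- One order more than needed: the partial derivatives of the Taylor polynomial of order N + 1 are
  -- the Taylor polynomials of order N of the partial derivatives.
  have hP := approximates_taylorPoly hf (N + 1)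
  have hsoul : (fun j => soul (x j + d j)) = fun j => soul (x j) + d j := by
    ext j; rw [soul_add, soul_of_body_eq_zero (hb j)]
  have h1 := taylor_eq_of_approximates (fun j => add_mem (hx j) (hd j)) (f := f)
    (by rwa [hbody]) (P := taylorPoly (N + 1) f fun j => body (x j)) (by
      rw [hbody]; exact hP.of_succ)
  have h2 := polyHom_add (fun j => soul_mem_part (hx j)) hd hdd
    (taylorPoly (N + 1) f fun j => body (x j))
  rw [h1, taylor_eq_of_approximates hx hf hP.of_succ]
  simp only [taylor_eq_polyHom hx, ← pderiv_taylorPoly hf, ← h2]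
  congr

end TaylorValue

/-! ### Evaluation of superfunctions -/

lemma one_add_one_eq_zero : (1 : ZMod 2) + 1 = 0 := rfl

section Evaluation

variable {ι : Type} [Fintype ι] [DecidableEq ι] {U : Opens (ι → ℝ)} {κ : Type} [Fintype κ]
  [LinearOrder κ] {N : ℕ}

lemma IsPoint.even {X : ι ⊕ κ → Grassmann N} (hX : IsPoint U X) (i : ι) :
    X (Sum.inl i) ∈ part N 0 := hX.1 (Sum.inl i)

lemma IsPoint.odd {X : ι ⊕ κ → Grassmann N} (hX : IsPoint U X) (k : κ) :
    X (Sum.inr k) ∈ part N 1 := hX.1 (Sum.inr k)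

lemma eval_eq_sum {X : ι ⊕ κ → Grassmann N} (hX : bodyPt X ∈ U) (f : SuperFun U κ) :
    eval X f = ∑ I : Finset κ, taylor (f.1 I) (fun i => X (Sum.inl i)) *
      oddMonomial (fun k => X (Sum.inr k)) I :=
  if_pos hX

lemma eval_mem_part {X : ι ⊕ κ → Grassmann N} (hX : IsPoint U X) {f : SuperFun U κ} {p : ZMod 2}
    (hf : HasParity p f) : eval X f ∈ part N p := by
  rw [eval_eq_sum hX.2]
  refine sum_mem fun I _ => ?_
  by_cases hI : (I.card : ZMod 2) = p
  · have := mul_mem_part (taylor_mem_part hX.even (f.1 I)) (oddMonomial_mem_part hX.odd I)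
    rwa [hI, zero_add] at this
  · have h0 : (0 : (ι → ℝ) → ℝ) = fun _ => 0 := rfl
    rw [hf I hI, h0, taylor_const _ _ hX.even, map_zero, zero_mul]
    exact zero_mem _

/-- A family of functions of Grassmann-valued points that is given by a superfunction. -/
def Representable (U : Opens (ι → ℝ)) (F : ∀ N : ℕ, (ι ⊕ κ → Grassmann N) → Grassmann N) : Prop :=
  ∃ f : SuperFun U κ, ∀ (N : ℕ) (X : ι ⊕ κ → Grassmann N), IsPoint U X → eval X f = F N X

namespace Representable

variable {F G : ∀ N : ℕ, (ι ⊕ κ → Grassmann N) → Grassmann N}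

lemma of_eval (f : SuperFun U κ) : Representable U fun _ X => eval X f := ⟨f, fun _ _ _ => rfl⟩

lemma congr (hF : Representable U F) (h : ∀ N X, IsPoint U X → F N X = G N X) :
    Representable U G := by
  obtain ⟨f, hf⟩ := hF
  exact ⟨f, fun N X hX => (hf N X hX).trans (h N X hX)⟩

lemma smul (r : ℝ) (hF : Representable U F) : Representable U fun N X => r • F N X := by
  obtain ⟨f, hf⟩ := hF
  exact ⟨r • f, fun N X hX => by rw [map_smul, hf N X hX]⟩

lemma zero : Representable U fun N (_ : ι ⊕ κ → Grassmann N) => 0 :=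
  ⟨0, fun _ _ _ => map_zero _⟩

lemma sum {α : Type} (s : Finset α)
    {F : α → ∀ N : ℕ, (ι ⊕ κ → Grassmann N) → Grassmann N} (hF : ∀ a, Representable U (F a)) :
    Representable U fun N X => ∑ a ∈ s, F a N X := by
  choose f hf using hF
  exact ⟨∑ a ∈ s, f a, fun N X hX => by
    rw [map_sum]; exact Finset.sum_congr rfl fun a _ => hf a N X hX⟩

open scoped Classical in
lemma term {g : (ι → ℝ) → ℝ} (hg : ContDiffOn ℝ ∞ g U) (I : Finset κ) :
    Representable U fun N (X : ι ⊕ κ → Grassmann N) =>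
      taylor g (fun i => X (Sum.inl i)) * oddMonomial (fun k => X (Sum.inr k)) I := by
  refine ⟨⟨fun J x => if J = I ∧ x ∈ U then g x else 0, fun J => ⟨?_, fun x hx => ?_⟩⟩,
    fun N X hX => ?_⟩
  · by_cases hJ : J = I
    · exact hg.congr fun x hx => if_pos ⟨hJ, hx⟩
    · simpa [hJ] using contDiffOn_const
  · exact if_neg fun h => hx h.2
  · rw [eval_eq_sum hX.2, Finset.sum_eq_single I]
    · congr 1
      refine taylor_congr ?_
      filter_upwards [U.2.mem_nhds hX.2] with x hx
      exact if_pos ⟨rfl, hx⟩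
    · intro J _ hJ
      simp only [hJ, false_and, if_false]
      rw [taylor_const _ _ hX.even, map_zero, zero_mul]
    · simp

lemma even {g : (ι → ℝ) → ℝ} (hg : ContDiffOn ℝ ∞ g U) :
    Representable U fun N (X : ι ⊕ κ → Grassmann N) => taylor g (fun i => X (Sum.inl i)) :=
  (term hg ∅).congr fun N X _ => by rw [oddMonomial_empty, mul_one]

lemma coord (c : ι ⊕ κ) : Representable U fun N (X : ι ⊕ κ → Grassmann N) => X c := by
  rcases c with i | k
  · exact (even (contDiff_apply ℝ ℝ i).contDiffOn).congr fun N X hX => taylor_coord i _ hX.even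
  · refine (term (g := fun _ => 1) contDiffOn_const {k}).congr fun N X hX => ?_
    rw [taylor_const _ _ hX.even, map_one, one_mul, oddMonomial]
    simp

lemma one : Representable U fun N (_ : ι ⊕ κ → Grassmann N) => 1 :=
  (even (g := fun _ => 1) contDiffOn_const).congr fun N X hX => by
    rw [taylor_const _ _ hX.even, map_one]

lemma mul (hF : Representable U F) (hG : Representable U G) :
    Representable U fun N X => F N X * G N X := by
  obtain ⟨f, hf⟩ := hF
  obtain ⟨g, hg⟩ := hG
  have hterm : ∀ I J : Finset κ, Representable U fun N (X : ι ⊕ κ → Grassmann N) =>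
      (taylor (f.1 I) (fun i => X (Sum.inl i)) * oddMonomial (fun k => X (Sum.inr k)) I) *
        (taylor (g.1 J) (fun i => X (Sum.inl i)) * oddMonomial (fun k => X (Sum.inr k)) J) := by
    intro I J
    -- The scalar e and the set K depend on I and J only, so the product of two terms is one fixed
    -- superfunction, for every N and every point.
    obtain ⟨e, K, hK⟩ := exists_list_prod_eq (I.sort (· ≤ ·) ++ J.sort (· ≤ ·))
    refine ((term ((f.2 I).1.mul (g.2 J).1) K).smul e).congr fun N X hX => ?_
    have h1 : oddMonomial (fun k => X (Sum.inr k)) I * oddMonomial (fun k => X (Sum.inr k)) J =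
        e • oddMonomial (fun k => X (Sum.inr k)) K := by
      rw [← hK N _ hX.odd, List.map_append, List.prod_append]
      rfl
    have h2 := taylor_mul hX.even (contDiffAt_coeff f I hX.2) (contDiffAt_coeff g J hX.2)
    rw [mul_assoc, ← mul_assoc (oddMonomial _ I),
      ← even_commute (taylor_mem_part hX.even (g.1 J)), mul_assoc, h1, ← mul_assoc, ← h2,
      mul_smul_comm]
  refine (sum Finset.univ fun I => sum Finset.univ fun J => hterm I J).congr fun N X hX => ?_
  rw [← hf N X hX, ← hg N X hX, eval_eq_sum hX.2, eval_eq_sum hX.2, Finset.sum_mul_sum]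

lemma list_prod {α : Type} (l : List α)
    {F : α → ∀ N : ℕ, (ι ⊕ κ → Grassmann N) → Grassmann N} (hF : ∀ a, Representable U (F a)) :
    Representable U fun N X => (l.map fun a => F a N X).prod := by
  induction l with
  | nil => simpa using one
  | cons a l ih => simpa using (hF a).mul ih

/-- Superfunctions are closed under substitution. -/
lemma comp {ι' κ' : Type} [Fintype ι'] [DecidableEq ι'] [Fintype κ'] [LinearOrder κ']
    {U' : Opens (ι' → ℝ)} (f : SuperFun U' κ') {φ : (ι → ℝ) → ι' → ℝ} (hφ : ContDiffOn ℝ ∞ φ U)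
    (hU : ∀ x ∈ U, φ x ∈ U') {Ξ : κ' → ∀ N : ℕ, (ι ⊕ κ → Grassmann N) → Grassmann N}
    (hΞ : ∀ k, Representable U (Ξ k)) :
    Representable U fun N X => eval (Sum.elim
      (fun j => taylor (fun v => φ v j) fun i => X (Sum.inl i)) fun k => Ξ k N X) f := by
  have hat : ∀ x ∈ U, ContDiffAt ℝ ∞ φ x := fun x hx => hφ.contDiffAt (U.2.mem_nhds hx)
  have hfφ : ∀ I, ContDiffOn ℝ ∞ (fun v => f.1 I (φ v)) U := fun I =>
    (f.2 I).1.comp hφ hU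
  refine (sum Finset.univ fun I : Finset κ' => (even (hfφ I)).mul
    (list_prod (I.sort (· ≤ ·)) hΞ)).congr fun N X hX => ?_
  have hbody : bodyPt (Sum.elim (fun j => taylor (fun v => φ v j) fun i => X (Sum.inl i))
      fun k => Ξ k N X) = φ (bodyPt X) := by
    ext j
    exact body_taylor hX.even (contDiffAt_pi.1 (hat _ hX.2) j)
  rw [eval_eq_sum (by rw [hbody]; exact hU _ hX.2)]
  refine Finset.sum_congr rfl fun I _ => ?_
  simp only [Sum.elim_inl, Sum.elim_inr]
  rw [taylor_comp hX.even (hat _ hX.2) (contDiffAt_coeff f I (hU _ hX.2))]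
  rfl

end Representable

/-! ### First order expansion of superfunctions -/

lemma card_filter_insert_min {a k : κ} {I : Finset κ} (ha : ∀ b ∈ I, a < b) (hk : k ∈ I) :
    ((insert a I).filter (· < k)).card = (I.filter (· < k)).card + 1 := by
  rw [Finset.filter_insert, if_pos (ha k hk), Finset.card_insert_of_notMem]
  intro h
  exact (ha a (Finset.mem_filter.1 h).1).false

/-- Since θ² = 0, at most one factor contributes its increment. The sign arises from carrying θ to
the left past the factors with smaller index. The induction adjoins a new least element because this
is the leftmost factor. -/
lemma oddMonomial_add {ξ η : κ → Grassmann N} (hξ : ∀ k, ξ k ∈ part N 1)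
    (hη : ∀ k, η k ∈ part N 0) {θ : Grassmann N} (hθ : θ ∈ part N 1) (I : Finset κ) :
    oddMonomial (fun k => ξ k + θ * η k) I = oddMonomial ξ I + θ * ∑ k ∈ I,
      ((-1 : ℝ) ^ (I.filter (· < k)).card) • (η k * oddMonomial ξ (I.erase k)) := by
  induction I using Finset.induction_on_min with
  | empty => simp [oddMonomial_empty]
  | insert a I ha ih =>
    have haI : a ∉ I := fun h => (ha a h).false
    have hsum : ∑ k ∈ I, ((-1 : ℝ) ^ ((insert a I).filter (· < k)).card) •
        (η k * oddMonomial ξ ((insert a I).erase k)) =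
        -(ξ a * ∑ k ∈ I, ((-1 : ℝ) ^ (I.filter (· < k)).card) •
          (η k * oddMonomial ξ (I.erase k))) := by
      rw [Finset.mul_sum, ← Finset.sum_neg_distrib]
      refine Finset.sum_congr rfl fun k hk => ?_
      have hak : a ≠ k := (ha k hk).ne
      rw [card_filter_insert_min ha hk, Finset.erase_insert_of_ne hak,
        oddMonomial_insert_min ξ a _ fun b hb => ha b (Finset.mem_of_mem_erase hb), pow_succ,
        mul_neg_one, neg_smul, mul_smul_comm, ← mul_assoc, ← mul_assoc, even_commute (hη k)]
    have hfilter : (insert a I).filter (· < a) = ∅ := by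
      refine Finset.filter_eq_empty_iff.2 fun b hb => ?_
      rcases Finset.mem_insert.1 hb with rfl | hb
      · exact lt_irrefl _
      · exact (ha b hb).not_gt
    rw [oddMonomial_insert_min _ a I ha, oddMonomial_insert_min _ a I ha, ih,
      Finset.sum_insert haI, hsum, hfilter, Finset.erase_insert haI]
    simp only [Finset.card_empty, pow_zero, one_smul]
    generalize ∑ k ∈ I, ((-1 : ℝ) ^ (I.filter (· < k)).card) •
      (η k * oddMonomial ξ (I.erase k)) = S
    have h1 : θ * η a * (θ * S) = 0 := by
      rw [mul_assoc, ← mul_assoc (η a), even_commute (hη a), mul_assoc, odd_mul_mul_self hθ]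
    have h2 : ξ a * (θ * S) = -(θ * (ξ a * S)) := by
      rw [← mul_assoc, odd_anticommute (hξ a) hθ, neg_mul, mul_assoc]
    rw [add_mul, mul_add, mul_add, h1, h2]
    noncomm_ring

lemma eval_pdEven {X : ι ⊕ κ → Grassmann N} (hX : IsPoint U X) (i : ι) (f : SuperFun U κ) :
    eval X (pdEven i f) = ∑ I : Finset κ,
      taylor (coordDeriv i (f.1 I)) (fun i => X (Sum.inl i)) *
        oddMonomial (fun k => X (Sum.inr k)) I := by
  rw [eval_eq_sum hX.2]
  refine Finset.sum_congr rfl fun I _ => ?_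
  congr 1
  refine taylor_congr ?_
  filter_upwards [U.2.mem_nhds hX.2] with x hx
  exact if_pos hx

lemma eval_pdOdd {X : ι ⊕ κ → Grassmann N} (hX : IsPoint U X) (k : κ) (f : SuperFun U κ) :
    eval X (pdOdd k f) = ∑ I : Finset κ with k ∈ I,
      ((-1 : ℝ) ^ (I.filter (· < k)).card) • (taylor (f.1 I) (fun i => X (Sum.inl i)) *
        oddMonomial (fun k => X (Sum.inr k)) (I.erase k)) := by
  rw [eval_eq_sum hX.2, ← Finset.sum_filter_add_sum_filter_not Finset.univ fun I => k ∈ I]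
  rw [Finset.sum_eq_zero, zero_add]
  · refine Finset.sum_nbij' (fun I => insert k I) (fun I => I.erase k) ?_ ?_ ?_ ?_ ?_
    · intro I _; simp
    · intro I _; simp
    · intro I hI; exact Finset.erase_insert (Finset.mem_filter.1 hI).2
    · intro I hI; exact Finset.insert_erase (Finset.mem_filter.1 hI).2
    · intro I hI
      have hk : k ∉ I := (Finset.mem_filter.1 hI).2
      have h1 : (pdOdd k f).1 I =
          (((-1 : ℝ) ^ (I.filter (· < k)).card) • f).1 (insert k I) := if_neg hk
      rw [h1, taylor_smul _ f _ _ hX.2, Finset.erase_insert hk, smul_mul_assoc,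
        Finset.filter_insert, if_neg (lt_irrefl k)]
  · intro I hI
    have h1 : (pdOdd k f).1 I = fun _ => 0 := if_pos (Finset.mem_filter.1 hI).2
    rw [h1, taylor_const _ _ hX.even, map_zero, zero_mul]

/-- First order Taylor expansion of a superfunction. -/
theorem eval_add_mul {X dX : ι ⊕ κ → Grassmann N} (hX : IsPoint U X) (hdX : IsDiff dX)
    {θ : Grassmann N} (hθ : θ ∈ part N 1) (f : SuperFun U κ) :
    eval (fun c => X c + θ * dX c) f = eval X f + θ * evalForm (fun c => pd c f) X dX := by
  have hde : ∀ i : ι, dX (Sum.inl i) ∈ part N 1 := fun i => by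
    simpa only [par, zero_add] using hdX (Sum.inl i)
  have hdo : ∀ k : κ, dX (Sum.inr k) ∈ part N 0 := fun k => by
    simpa only [par, one_add_one_eq_zero] using hdX (Sum.inr k)
  have hδ : ∀ i : ι, θ * dX (Sum.inl i) ∈ part N 0 := fun i => by
    simpa only [one_add_one_eq_zero] using mul_mem_part hθ (hde i)
  have hδb : ∀ i : ι, body (θ * dX (Sum.inl i)) = 0 := fun i => by
    rw [map_mul, body_odd hθ, zero_mul]
  -- Every product of two increments contains θ twice, so first order expansions are exact.
  have hδδ : ∀ i j : ι, θ * dX (Sum.inl i) * (θ * dX (Sum.inl j)) = 0 := fun i j => by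
    rw [mul_assoc, ← mul_assoc (dX _), odd_anticommute (hde i) hθ, neg_mul, mul_neg, mul_assoc,
      odd_mul_mul_self hθ, neg_zero]
  have hbody : bodyPt (fun c => X c + θ * dX c) = bodyPt X := by
    ext i
    simp only [bodyPt, map_add, hδb, add_zero]
  rw [eval_eq_sum (by rw [hbody]; exact hX.2), eval_eq_sum hX.2, evalForm, Fintype.sum_sum_type]
  have hterm : ∀ I : Finset κ,
      taylor (f.1 I) (fun i => X (Sum.inl i) + θ * dX (Sum.inl i)) *
        oddMonomial (fun k => X (Sum.inr k) + θ * dX (Sum.inr k)) I =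
      taylor (f.1 I) (fun i => X (Sum.inl i)) * oddMonomial (fun k => X (Sum.inr k)) I +
      (θ * ∑ i, dX (Sum.inl i) * (taylor (coordDeriv i (f.1 I)) (fun i => X (Sum.inl i)) *
          oddMonomial (fun k => X (Sum.inr k)) I) +
        θ * ∑ k ∈ I, dX (Sum.inr k) * (((-1 : ℝ) ^ (I.filter (· < k)).card) •
          (taylor (f.1 I) (fun i => X (Sum.inl i)) *
            oddMonomial (fun k => X (Sum.inr k)) (I.erase k)))) := by
    intro I
    rw [taylor_add_of_mul_eq_zero hX.even hδ hδb hδδ (contDiffAt_coeff f I hX.2),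
      oddMonomial_add hX.odd hdo hθ]
    have hT := taylor_mem_part hX.even (f.1 I)
    simp only [mul_assoc, ← Finset.mul_sum]
    set T := taylor (f.1 I) fun i => X (Sum.inl i)
    set A := ∑ i, dX (Sum.inl i) * taylor (coordDeriv i (f.1 I)) fun i => X (Sum.inl i) with hA
    set M := oddMonomial (fun k => X (Sum.inr k)) I
    set B := ∑ k ∈ I, ((-1 : ℝ) ^ (I.filter (· < k)).card) •
      (dX (Sum.inr k) * oddMonomial (fun k => X (Sum.inr k)) (I.erase k)) with hB
    have hAodd : A ∈ part N 1 := sum_mem fun i _ => by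
      simpa using mul_mem_part (hde i) (taylor_mem_part hX.even _)
    have h1 : ∑ i, dX (Sum.inl i) * (taylor (coordDeriv i (f.1 I)) (fun i => X (Sum.inl i)) *
        M) = A * M := by
      rw [hA, Finset.sum_mul]
      exact Finset.sum_congr rfl fun i _ => (mul_assoc _ _ _).symm
    have h2 : ∑ k ∈ I, dX (Sum.inr k) * (((-1 : ℝ) ^ (I.filter (· < k)).card) •
        (T * oddMonomial (fun k => X (Sum.inr k)) (I.erase k))) = T * B := by
      rw [hB, Finset.mul_sum]
      refine Finset.sum_congr rfl fun k _ => ?_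
      rw [mul_smul_comm, mul_smul_comm, ← mul_assoc, ← mul_assoc, even_commute hT]
    have h3 : θ * A * (θ * B) = 0 := by
      rw [mul_assoc, ← mul_assoc A, odd_anticommute hAodd hθ, neg_mul, mul_neg, mul_assoc,
        odd_mul_mul_self hθ, neg_zero]
    have h4 : T * (θ * B) = θ * (T * B) := by
      rw [← mul_assoc, even_commute hT, mul_assoc]
    rw [h1, h2, add_mul, mul_add, mul_add, h3, h4, add_zero, mul_assoc]
    abel
  simp only [hterm, Finset.sum_add_distrib, ← Finset.mul_sum, ← mul_add]
  congr 3
  · rw [Finset.sum_comm]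
    refine Finset.sum_congr rfl fun i _ => ?_
    rw [← Finset.mul_sum]
    exact congrArg _ (eval_pdEven hX i f).symm
  · have hcomm : ∀ g : Finset κ → κ → Grassmann N,
        ∑ I, ∑ k ∈ I, g I k = ∑ k, ∑ I : Finset κ with k ∈ I, g I k := fun g =>
      Finset.sum_comm' (by simp)
    rw [hcomm]
    refine Finset.sum_congr rfl fun k _ => ?_
    rw [← Finset.mul_sum]
    exact congrArg _ (eval_pdOdd hX k f).symm

end Evaluation

/-! ### Generic points -/

lemma parity_eq_add_one {p q : ZMod 2} (h : ¬ q = p) : q = p + 1 := by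
  revert p q; decide

lemma parity_add_cancel (p q : ZMod 2) : q + 1 + (p + q + 1) = p := by
  revert p q; decide

section Generic

variable {ι : Type} [Fintype ι] [DecidableEq ι] {U : Opens (ι → ℝ)} {κ : Type} [Fintype κ]
  [LinearOrder κ]

/-- The odd generators of a Grassmann algebra indexed by `κ` and three spare ones. -/
def labelledGen (s : κ ⊕ Fin 3) : Grassmann (Fintype.card (κ ⊕ Fin 3)) :=
  gen (Fintype.equivFin (κ ⊕ Fin 3) s)

lemma labelledGen_mem_part (s : κ ⊕ Fin 3) : labelledGen s ∈ part _ 1 := gen_mem_part _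

/-- The point over `b` whose odd coordinates are free generators. -/
def genericPoint (κ : Type) [Fintype κ] (b : ι → ℝ) :
    ι ⊕ κ → Grassmann (Fintype.card (κ ⊕ Fin 3)) :=
  Sum.elim (fun i => algebraMap ℝ _ (b i)) fun k => labelledGen (Sum.inl k)

lemma bodyPt_genericPoint (b : ι → ℝ) : bodyPt (genericPoint κ b) = b := by
  ext i
  exact body_algebraMap _

lemma isPoint_genericPoint {b : ι → ℝ} (hb : b ∈ U) : IsPoint U (genericPoint κ b) := by
  refine ⟨?_, by rwa [bodyPt_genericPoint]⟩
  rintro (i | k)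
  · exact algebraMap_mem_part _
  · exact labelledGen_mem_part _

lemma taylor_algebraMap {N : ℕ} {f : (ι → ℝ) → ℝ} {b : ι → ℝ} (hf : ContDiffAt ℝ ∞ f b) :
    taylor f (fun i => algebraMap ℝ (Grassmann N) (b i)) = algebraMap ℝ _ (f b) := by
  -- A real point is a constant map defined on a space with no coordinates, so the chain rule
  -- reduces the claim to constant functions.
  have h := taylor_comp (N := N) (ι := Empty) (x := Empty.elim) (fun j => j.elim) (g := f)
    (φ := fun _ => b) contDiffAt_const hf
  rw [taylor_const _ _ fun j => j.elim] at h
  rw [← h]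
  congr 1
  ext1 i
  rw [taylor_const _ _ fun j => j.elim]

lemma eval_genericPoint {b : ι → ℝ} (hb : b ∈ U) (f : SuperFun U κ) :
    eval (genericPoint κ b) f =
      ∑ I : Finset κ, f.1 I b • oddMonomial (fun k => labelledGen (Sum.inl k)) I := by
  rw [eval_eq_sum (by rwa [bodyPt_genericPoint])]
  refine Finset.sum_congr rfl fun I _ => ?_
  rw [Algebra.smul_def]
  congr 1
  exact taylor_algebraMap (contDiffAt_coeff f I hb)

/-- Products of distinct spare generators. -/
def spareProd (κ : Type) [Fintype κ] (l : List (Fin 3)) :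
    Grassmann (Fintype.card (κ ⊕ Fin 3)) :=
  (l.map fun i => labelledGen (Sum.inr i)).prod

lemma spareProd_cons (i : Fin 3) (l : List (Fin 3)) :
    spareProd κ (i :: l) = labelledGen (Sum.inr i) * spareProd κ l := by
  simp [spareProd]

/-- The spare generators do not occur in the monomials indexed by κ, so after multiplication by them
these monomials are still nonzero multiples of distinct basis elements. Three spares suffice: one
for an odd parameter θ and two for differentials. -/
lemma eq_zero_of_spareProd_mul_sum {l : List (Fin 3)} (hl : l.Nodup) {c : Finset κ → ℝ}
    (h : spareProd κ l * ∑ I, c I • oddMonomial (fun k => labelledGen (Sum.inl k)) I = 0)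
    (I : Finset κ) : c I = 0 := by
  set e := Fintype.equivFin (κ ⊕ Fin 3)
  set L : Finset κ → List (Fin (Fintype.card (κ ⊕ Fin 3))) := fun I =>
    (l.map fun i => e (Sum.inr i)) ++ (I.sort (· ≤ ·)).map fun k => e (Sum.inl k) with hL
  have hmem : ∀ I k, e (Sum.inl k) ∈ L I ↔ k ∈ I := by
    intro I k
    simp [hL]
  have hnodup : ∀ I, (L I).Nodup := by
    intro I
    refine List.nodup_append.2 ⟨hl.map ?_, (Finset.sort_nodup _ _).map ?_, ?_⟩
    · exact e.injective.comp Sum.inr_injective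
    · exact e.injective.comp Sum.inl_injective
    · intro a ha b hb hab
      obtain ⟨i, -, rfl⟩ := List.mem_map.1 ha
      obtain ⟨k, -, rfl⟩ := List.mem_map.1 hb
      exact Sum.inr_ne_inl (e.injective hab)
  choose s hs hprod using fun I => list_prod_of_nodup (hnodup I)
  have hinj : Function.Injective fun I => (L I).toFinset := by
    intro I J hIJ
    ext k
    rw [← hmem, ← hmem, ← List.mem_toFinset, ← List.mem_toFinset]
    exact (Finset.ext_iff.1 hIJ) _
  have hli := (linearIndependent_oddMonomial_gen (N := Fintype.card (κ ⊕ Fin 3))).comp _ hinj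
  have hsum : ∑ I, (c I * s I) • oddMonomial gen (L I).toFinset = 0 := by
    rw [← h, Finset.mul_sum]
    refine Finset.sum_congr rfl fun I _ => ?_
    rw [mul_smul, ← hprod I _ gen gen_mem_part, mul_smul_comm, hL, List.map_append,
      List.prod_append, List.map_map, List.map_map]
    rfl
  exact (mul_eq_zero.1 (Fintype.linearIndependent_iff.1 hli _ hsum I)).resolve_right (hs I)

lemma superFun_eq_zero {f : SuperFun U κ} (l : List (Fin 3)) (hl : l.Nodup)
    (h : ∀ b ∈ U, spareProd κ l * eval (genericPoint κ b) f = 0) : f = 0 := by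
  ext I b
  by_cases hb : b ∈ U
  · have := h b hb
    rw [eval_genericPoint hb] at this
    exact eq_zero_of_spareProd_mul_sum hl this I
  · exact (f.2 I).2 b hb

lemma coeff_eq_of_eval_eq {U' : Opens (ι → ℝ)} {f : SuperFun U κ} {g : SuperFun U' κ}
    {b : ι → ℝ} (hb : b ∈ U) (hb' : b ∈ U')
    (h : eval (genericPoint κ b) f = eval (genericPoint κ b) g) (I : Finset κ) :
    f.1 I b = g.1 I b := by
  rw [eval_genericPoint hb, eval_genericPoint hb', ← sub_eq_zero, ← Finset.sum_sub_distrib] at h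
  simp only [← sub_smul] at h
  refine sub_eq_zero.1 (eq_zero_of_spareProd_mul_sum (l := []) List.nodup_nil
    (c := fun I => f.1 I b - g.1 I b) ?_ I)
  rw [h, mul_zero]

/-- Superfunctions are determined by their values. -/
lemma superFun_ext {f g : SuperFun U κ}
    (h : ∀ (N : ℕ) (X : ι ⊕ κ → Grassmann N), IsPoint U X → eval X f = eval X g) : f = g := by
  rw [← sub_eq_zero]
  refine superFun_eq_zero [] List.nodup_nil fun b hb => ?_
  rw [map_sub, h _ _ (isPoint_genericPoint hb), sub_self, mul_zero]

lemma spareProd_mem_part (l : List (Fin 3)) : spareProd κ l ∈ part _ (l.length : ZMod 2) := by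
  have := list_prod_mem_part (l.map fun i => labelledGen (κ := κ) (Sum.inr i))
    (by simp [labelledGen_mem_part])
  simpa [spareProd] using this

/-- The terms of the wrong parity form a sum lying in both homogeneous parts. That sum is therefore
zero, and its coefficients vanish by independence. -/
lemma hasParity_of_eval {p : ZMod 2} {f : SuperFun U κ} (l : List (Fin 3)) (hl : l.Nodup)
    (h : ∀ b ∈ U, spareProd κ l * eval (genericPoint κ b) f ∈ part _ (l.length + p)) :
    HasParity p f := by
  intro I hI
  ext b
  by_cases hb : b ∈ U
  swap
  · exact (f.2 I).2 b hb
  have h1 := h b hb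
  rw [eval_genericPoint hb, ← Finset.sum_filter_add_sum_filter_not Finset.univ
    fun I : Finset κ => (I.card : ZMod 2) = p, mul_add] at h1
  have hξ : ∀ k : κ, labelledGen (Sum.inl k : κ ⊕ Fin 3) ∈ part _ 1 := fun k =>
    labelledGen_mem_part _
  have h2 : spareProd κ l * ∑ I : Finset κ with (I.card : ZMod 2) = p,
      f.1 I b • oddMonomial (fun k => labelledGen (Sum.inl k)) I ∈ part _ (l.length + p) := by
    refine mul_mem_part (spareProd_mem_part l) (sum_mem fun J hJ => Submodule.smul_mem _ _ ?_)
    have := oddMonomial_mem_part hξ J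
    rwa [(Finset.mem_filter.1 hJ).2] at this
  have h3 : spareProd κ l * ∑ I : Finset κ with ¬ (I.card : ZMod 2) = p,
      f.1 I b • oddMonomial (fun k => labelledGen (Sum.inl k)) I ∈ part _ (l.length + p + 1) := by
    rw [add_assoc]
    refine mul_mem_part (spareProd_mem_part l) (sum_mem fun J hJ => Submodule.smul_mem _ _ ?_)
    have := oddMonomial_mem_part hξ J
    have hJp := (Finset.mem_filter.1 hJ).2
    rwa [show (J.card : ZMod 2) = p + 1 by
      exact parity_eq_add_one hJp] at this
  have h4 := eq_zero_of_mem_parts ((Submodule.add_mem_iff_right _ h2).1 h1) h3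
  rw [Finset.sum_filter] at h4
  have h5 := eq_zero_of_spareProd_mul_sum hl
    (c := fun I => if ¬ (I.card : ZMod 2) = p then f.1 I b else 0) (by
      rw [← h4]
      congr 1
      refine Finset.sum_congr rfl fun I _ => ?_
      split_ifs <;> simp) I
  simpa [hI] using h5

/-- A product of spare generators of parity `p`. -/
def probe (i : Fin 3) (p : ZMod 2) : List (Fin 3) := if p = 0 then [] else [i]

lemma length_probe (i : Fin 3) (p : ZMod 2) : ((probe i p).length : ZMod 2) = p := by
  rcases parity_cases p with rfl | rfl <;> simp [probe]

lemma probe_mem_part (i : Fin 3) (p : ZMod 2) : spareProd κ (probe i p) ∈ part _ p := by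
  have := spareProd_mem_part (κ := κ) (probe i p)
  rcases parity_cases p with rfl | rfl <;> simpa [probe] using this

lemma isDiff_single {N : ℕ} {a : Grassmann N} (c : ι ⊕ κ) (ha : a ∈ part N (par c + 1)) :
    IsDiff (Pi.single c a) := by
  intro c'
  rcases eq_or_ne c' c with rfl | h
  · simpa using ha
  · simp [h]

lemma evalForm_single {N : ℕ} (τ : ι ⊕ κ → SuperFun U κ) (X : ι ⊕ κ → Grassmann N) (c : ι ⊕ κ)
    (a : Grassmann N) : evalForm τ X (Pi.single c a) = a * eval X (τ c) := by
  rw [evalForm, Finset.sum_eq_single c]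
  · simp
  · intro c' _ h
    simp [h]
  · simp

/-- A 1-form is determined by its values. -/
lemma form_eq_zero {τ : ι ⊕ κ → SuperFun U κ}
    (h : ∀ (N : ℕ) (X dX : ι ⊕ κ → Grassmann N) (θ : Grassmann N), IsPoint U X → IsDiff dX →
      θ ∈ part N 1 → θ * evalForm τ X dX = 0) : τ = 0 := by
  ext1 c
  -- The test differential is concentrated at c. Its value must have parity `par c + 1`: it is 1 in
  -- the even case and a spare generator in the odd case. The spare generator 0 plays the role of θ.
  refine superFun_eq_zero (0 :: probe 1 (par c + 1)) ?_ fun b hb => ?_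
  · unfold probe; split_ifs <;> simp
  · have := h _ (genericPoint κ b) (Pi.single c (spareProd κ (probe 1 (par c + 1))))
      (labelledGen (Sum.inr 0)) (isPoint_genericPoint hb) (isDiff_single c (probe_mem_part _ _))
      (labelledGen_mem_part _)
    rwa [evalForm_single, ← mul_assoc, ← spareProd_cons] at this

lemma form_ext {τ η : ι ⊕ κ → SuperFun U κ}
    (h : ∀ (N : ℕ) (X dX : ι ⊕ κ → Grassmann N), IsPoint U X → IsDiff dX →
      evalForm τ X dX = evalForm η X dX) : τ = η := by
  rw [← sub_eq_zero]
  refine form_eq_zero fun N X dX θ hX hdX _ => ?_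
  have : evalForm (τ - η) X dX = evalForm τ X dX - evalForm η X dX := by
    simp only [evalForm, Pi.sub_apply, map_sub, mul_sub, Finset.sum_sub_distrib]
  rw [this, h N X dX hX hdX, sub_self, mul_zero]

lemma evalForm_mem_part {N : ℕ} {τ : ι ⊕ κ → SuperFun U κ} {p : ZMod 2}
    (hτ : FormHasParity p τ) {X dX : ι ⊕ κ → Grassmann N} (hX : IsPoint U X) (hdX : IsDiff dX) :
    evalForm τ X dX ∈ part N p := by
  refine sum_mem fun c _ => ?_
  have := mul_mem_part (hdX c) (eval_mem_part hX (hτ c))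
  rwa [parity_add_cancel] at this

lemma formHasParity_iff {τ : ι ⊕ κ → SuperFun U κ} {p : ZMod 2} :
    FormHasParity p τ ↔ ∀ (N : ℕ) (X dX : ι ⊕ κ → Grassmann N), IsPoint U X → IsDiff dX →
      evalForm τ X dX ∈ part N p := by
  refine ⟨fun h N X dX hX hdX => evalForm_mem_part h hX hdX, fun h c => ?_⟩
  refine hasParity_of_eval (probe 1 (par c + 1)) ?_ fun b hb => ?_
  · unfold probe; split_ifs <;> simp
  · have := h _ (genericPoint κ b) (Pi.single c (spareProd κ (probe 1 (par c + 1))))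
      (isPoint_genericPoint hb) (isDiff_single c (probe_mem_part _ _))
    rw [evalForm_single] at this
    rwa [length_probe, parity_add_cancel]

lemma hasParity_iff {f : SuperFun U κ} {p : ZMod 2} :
    HasParity p f ↔ ∀ (N : ℕ) (X : ι ⊕ κ → Grassmann N), IsPoint U X → eval X f ∈ part N p := by
  refine ⟨fun h N X hX => eval_mem_part hX h, fun h => ?_⟩
  refine hasParity_of_eval [] List.nodup_nil fun b hb => ?_
  simpa [spareProd] using h _ _ (isPoint_genericPoint hb)

/-! ### Closed forms -/

/-- The coefficients of `dτ`. -/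
def curl (τ : ι ⊕ κ → SuperFun U κ) (c c' : ι ⊕ κ) : SuperFun U κ :=
  sgn (par c + 1) • pd c' (τ c) +
    (sgn ((par c + 1) * (par c' + 1)) * sgn (par c' + 1)) • pd c (τ c')

/-- Exchanging the two summation indices and reordering the differentials shows that twice dτ is the
sum over all pairs of dx^c dx^c' times the curl. -/
lemma isClosedForm_of_curl {τ : ι ⊕ κ → SuperFun U κ} (h : ∀ c c', curl τ c c' = 0) :
    IsClosedForm τ := by
  intro N X dX hX hdX
  have h1 : evalD τ X dX + evalD τ X dX = ∑ c, ∑ c', dX c * dX c' * eval X (curl τ c c') := by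
    conv_lhs => enter [2]; rw [evalD, Finset.sum_comm]
    rw [evalD, ← Finset.sum_add_distrib]
    refine Finset.sum_congr rfl fun c _ => ?_
    rw [← Finset.sum_add_distrib]
    refine Finset.sum_congr rfl fun c' _ => ?_
    rw [curl, map_add, map_smul, map_smul, mul_add, mul_smul_comm, mul_smul_comm, mul_assoc,
      ← mul_assoc (dX c'), part_commute (hdX c') (hdX c), smul_mul_assoc, smul_smul, mul_assoc,
      mul_comm (sgn (par c' + 1)), mul_comm (par c' + 1)]
  simp only [h, map_zero, mul_zero, Finset.sum_const_zero] at h1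
  rw [← two_smul ℝ] at h1
  exact (smul_eq_zero.1 h1).resolve_left two_ne_zero

/-- The bilinear form underlying the quadratic form `evalD`. -/
def evalD₂ {N : ℕ} (τ : ι ⊕ κ → SuperFun U κ) (X dX dY : ι ⊕ κ → Grassmann N) : Grassmann N :=
  ∑ c, ∑ c', sgn (par c + 1) • (dX c * (dY c' * eval X (pd c' (τ c))))

lemma evalD₂_single {N : ℕ} (τ : ι ⊕ κ → SuperFun U κ) (X : ι ⊕ κ → Grassmann N)
    (c c' : ι ⊕ κ) (a a' : Grassmann N) :
    evalD₂ τ X (Pi.single c a) (Pi.single c' a') =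
      sgn (par c + 1) • (a * (a' * eval X (pd c' (τ c)))) := by
  rw [evalD₂, Finset.sum_eq_single c]
  · rw [Finset.sum_eq_single c']
    · simp
    · intro i _ h
      simp [h]
    · simp
  · intro i _ h
    simp [h]
  · simp

/-- Polarization of dτ as a quadratic function of the differentials: the cross term isolates one
coefficient. -/
lemma evalD_single_add_single {N : ℕ} (τ : ι ⊕ κ → SuperFun U κ) (X : ι ⊕ κ → Grassmann N)
    (c c' : ι ⊕ κ) {a a' : Grassmann N} (ha : a ∈ part N (par c + 1))
    (ha' : a' ∈ part N (par c' + 1)) :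
    evalD τ X (Pi.single c a + Pi.single c' a') =
      evalD τ X (Pi.single c a) + evalD τ X (Pi.single c' a') + a * a' * eval X (curl τ c c') := by
  have hadd : ∀ dX dY : ι ⊕ κ → Grassmann N, evalD τ X (dX + dY) =
      evalD τ X dX + evalD τ X dY + (evalD₂ τ X dX dY + evalD₂ τ X dY dX) := by
    intro dX dY
    simp only [evalD, evalD₂, Pi.add_apply, add_mul, mul_add, smul_add, Finset.sum_add_distrib]
    abel
  rw [hadd, evalD₂_single, evalD₂_single, curl, map_add, map_smul, map_smul, mul_add,
    mul_smul_comm, mul_smul_comm, ← mul_assoc a', part_commute ha' ha, mul_comm (par c' + 1),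
    smul_mul_assoc, smul_smul, mul_comm (sgn (par c' + 1)), ← mul_assoc a]

lemma spareProd_append (l l' : List (Fin 3)) :
    spareProd κ (l ++ l') = spareProd κ l * spareProd κ l' := by
  simp [spareProd]

/-- Polarization with independent spare generators as differentials. The hypothesis is only required
up to an odd factor θ, because comparing first order expansions yields θ dτ rather than dτ. -/
lemma curl_eq_zero {τ : ι ⊕ κ → SuperFun U κ}
    (h : ∀ (N : ℕ) (X dX : ι ⊕ κ → Grassmann N) (θ : Grassmann N), IsPoint U X → IsDiff dX →
      θ ∈ part N 1 → θ * evalD τ X dX = 0) (c c' : ι ⊕ κ) : curl τ c c' = 0 := by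
  refine superFun_eq_zero (0 :: (probe 1 (par c + 1) ++ probe 2 (par c' + 1))) ?_ fun b hb => ?_
  · unfold probe; split_ifs <;> simp
  · have hX := isPoint_genericPoint (κ := κ) hb
    have hθ := labelledGen_mem_part (Sum.inr 0 : κ ⊕ Fin 3)
    have ha := probe_mem_part (κ := κ) 1 (par c + 1)
    have ha' := probe_mem_part (κ := κ) 2 (par c' + 1)
    have hd := isDiff_single c ha
    have hd' := isDiff_single c' ha'
    have hdd : IsDiff (Pi.single c (spareProd κ (probe 1 (par c + 1))) +
        Pi.single c' (spareProd κ (probe 2 (par c' + 1)))) := fun i => add_mem (hd i) (hd' i)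
    have h1 := h _ _ _ _ hX hdd hθ
    rw [evalD_single_add_single τ _ c c' ha ha', mul_add, mul_add, h _ _ _ _ hX hd hθ,
      h _ _ _ _ hX hd' hθ, add_zero, zero_add] at h1
    rw [spareProd_cons, spareProd_append, mul_assoc]
    exact h1

lemma isClosedForm_iff {τ : ι ⊕ κ → SuperFun U κ} :
    IsClosedForm τ ↔ ∀ c c', curl τ c c' = 0 :=
  ⟨fun h => curl_eq_zero fun N X dX θ hX hdX _ => by rw [h N X dX hX hdX, mul_zero],
    isClosedForm_of_curl⟩

/-- The partial derivatives are determined by the first order expansion. -/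
lemma pd_eq_of_expansion {f : SuperFun U κ} {τ : ι ⊕ κ → SuperFun U κ}
    (h : ∀ (N : ℕ) (X dX : ι ⊕ κ → Grassmann N) (θ : Grassmann N), IsPoint U X → IsDiff dX →
      θ ∈ part N 1 → eval (fun c => X c + θ * dX c) f = eval X f + θ * evalForm τ X dX)
    (c : ι ⊕ κ) : pd c f = τ c := by
  have h0 : (fun c => pd c f) - τ = 0 := by
    refine form_eq_zero fun N X dX θ hX hdX hθ => ?_
    have h1 : evalForm ((fun c => pd c f) - τ) X dX =
        evalForm (fun c => pd c f) X dX - evalForm τ X dX := by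
      simp only [evalForm, Pi.sub_apply, map_sub, mul_sub, Finset.sum_sub_distrib]
    rw [h1, mul_sub, sub_eq_zero]
    exact add_left_cancel ((eval_add_mul hX hdX hθ f).symm.trans (h N X dX θ hX hdX hθ))
  exact sub_eq_zero.1 (congrFun h0 c)

/-- First order expansion of a 1-form along its own differentials. -/
lemma evalForm_add_mul {N : ℕ} {X dX : ι ⊕ κ → Grassmann N} (hX : IsPoint U X) (hdX : IsDiff dX)
    {θ : Grassmann N} (hθ : θ ∈ part N 1) (τ : ι ⊕ κ → SuperFun U κ) :
    evalForm τ (fun c => X c + θ * dX c) dX = evalForm τ X dX + θ * evalD τ X dX := by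
  simp only [evalForm, evalD, eval_add_mul hX hdX hθ, mul_add, Finset.sum_add_distrib,
    Finset.mul_sum]
  congr 1
  refine Finset.sum_congr rfl fun c _ => Finset.sum_congr rfl fun c' _ => ?_
  rw [← mul_assoc, part_commute (hdX c) hθ, mul_one, smul_mul_assoc, mul_assoc, mul_smul_comm]

end Generic

/-! ### Functions of an even and an odd vector -/

section PairFunctions

variable {n m N : ℕ}

lemma parity_add_two (p q : ZMod 2) : 1 + (p + (q + 1)) = p + q := by
  revert p q; decide

lemma par_swap {ι κ : Type} (c : ι ⊕ κ) : par c.swap = par c + 1 := by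
  rcases c with i | k <;> rfl

lemma argCoord_zero_inl (i : Fin n) :
    argCoord (m := m) 0 (Sum.inl i) = Sum.inl (Sum.inl i) := rfl

lemma argCoord_zero_inr (j : Fin m) :
    argCoord (n := n) 0 (Sum.inr j) = Sum.inr (toLex (Sum.inl j)) := rfl

lemma argCoord_one_inl (i : Fin n) :
    argCoord (m := m) 1 (Sum.inl i) = Sum.inr (toLex (Sum.inr i)) := rfl

lemma argCoord_one_inr (j : Fin m) :
    argCoord (n := n) 1 (Sum.inr j) = Sum.inl (Sum.inr j) := rfl

lemma pair_argCoord_zero (x y : Fin n ⊕ Fin m → Grassmann N) (A : Fin n ⊕ Fin m) :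
    pair x y (argCoord 0 A) = x A := by
  rcases A with i | j <;> rfl

lemma pair_argCoord_one (x y : Fin n ⊕ Fin m → Grassmann N) (A : Fin n ⊕ Fin m) :
    pair x y (argCoord 1 A) = y A := by
  rcases A with i | j <;> rfl

lemma par_argCoord (F : ZMod 2) (A : Fin n ⊕ Fin m) : par (argCoord F A) = par A + F := by
  rcases parity_cases F with rfl | rfl <;> rcases A with i | j <;> rfl

lemma argCoord_cases (c : (Fin n ⊕ Fin m) ⊕ OddPair n m) :
    ∃ (F : ZMod 2) (A : Fin n ⊕ Fin m), c = argCoord F A := by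
  rcases c with (i | j) | s
  · exact ⟨0, Sum.inl i, rfl⟩
  · exact ⟨1, Sum.inr j, rfl⟩
  · rcases h : ofLex s with j | i
    · exact ⟨0, Sum.inr j, congrArg Sum.inr (congrArg toLex h)⟩
    · exact ⟨1, Sum.inl i, congrArg Sum.inr (congrArg toLex h)⟩

/-- The even and the odd vector of a point of `V × ΠV`. -/
def argVec (F : ZMod 2) (X : (Fin n ⊕ Fin m) ⊕ OddPair n m → Grassmann N) :
    Fin n ⊕ Fin m → Grassmann N := fun A => X (argCoord F A)

lemma pair_argVec (X : (Fin n ⊕ Fin m) ⊕ OddPair n m → Grassmann N) :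
    pair (argVec 0 X) (argVec 1 X) = X := by
  ext c
  obtain ⟨F, A, rfl⟩ := argCoord_cases c
  rcases parity_cases F with rfl | rfl
  · exact pair_argCoord_zero _ _ A
  · exact pair_argCoord_one _ _ A

lemma argVec_one_pair (x y : Fin n ⊕ Fin m → Grassmann N) : argVec 1 (pair x y) = y :=
  funext fun A => pair_argCoord_one x y A

lemma pair_comp₂ (x y x' y' : Fin n ⊕ Fin m → Grassmann N)
    (g : Grassmann N → Grassmann N → Grassmann N) :
    (fun c => g (pair x y c) (pair x' y' c)) =
      pair (fun A => g (x A) (x' A)) fun A => g (y A) (y' A) := by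
  ext c
  obtain ⟨F, A, rfl⟩ := argCoord_cases c
  rcases parity_cases F with rfl | rfl
  · simp only [pair_argCoord_zero]
  · simp only [pair_argCoord_one]

lemma isPoint_pair {x y : Fin n ⊕ Fin m → Grassmann N} (hx : IsVector 0 x) (hy : IsVector 1 y)
    (h : oddBody y ≠ 0) : IsPoint (pairDomain n m) (pair x y) := by
  refine ⟨fun c => ?_, h⟩
  obtain ⟨F, A, rfl⟩ := argCoord_cases c
  rw [par_argCoord]
  rcases parity_cases F with rfl | rfl
  · rw [pair_argCoord_zero]; exact hx A
  · rw [pair_argCoord_one]; exact hy A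

lemma IsPoint.isVector {X : (Fin n ⊕ Fin m) ⊕ OddPair n m → Grassmann N}
    (hX : IsPoint (pairDomain n m) X) (F : ZMod 2) : IsVector F (argVec F X) := fun A => by
  have := hX.1 (argCoord F A)
  rwa [par_argCoord] at this

lemma IsPoint.oddBody_ne_zero {X : (Fin n ⊕ Fin m) ⊕ OddPair n m → Grassmann N}
    (hX : IsPoint (pairDomain n m) X) : oddBody (argVec 1 X) ≠ 0 := hX.2

lemma isDiff_pair {x y : Fin n ⊕ Fin m → Grassmann N} (hx : IsVector 1 x) (hy : IsVector 0 y) :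
    IsDiff (pair x y) := fun c => by
  obtain ⟨F, A, rfl⟩ := argCoord_cases c
  rw [par_argCoord]
  rcases parity_cases F with rfl | rfl
  · rw [pair_argCoord_zero, add_zero]; exact hx A
  · rw [pair_argCoord_one, add_assoc, one_add_one_eq_zero]; exact hy A

lemma IsDiff.isVector {X : (Fin n ⊕ Fin m) ⊕ OddPair n m → Grassmann N}
    (hX : IsDiff X) (F : ZMod 2) : IsVector (F + 1) (argVec F X) := fun A => by
  have := hX (argCoord F A)
  rwa [par_argCoord, add_assoc] at this

lemma isPoint_onPi {y : Fin n ⊕ Fin m → Grassmann N} (hy : IsVector 1 y) (h : oddBody y ≠ 0) :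
    IsPoint (puncture m) (onPi y) := by
  refine ⟨fun c => ?_, h⟩
  have := hy c.swap
  rwa [par_swap, add_assoc, one_add_one_eq_zero, add_zero] at this

lemma isDiff_onPi {y : Fin n ⊕ Fin m → Grassmann N} (hy : IsVector 0 y) : IsDiff (onPi y) :=
  fun c => by
    have := hy c.swap
    rwa [par_swap, add_zero] at this

lemma onPi_swap (X : Fin m ⊕ Fin n → Grassmann N) : onPi (fun A => X A.swap) = X := by
  ext c
  simp [onPi]

lemma isVector_one_swap {X : Fin m ⊕ Fin n → Grassmann N} (hX : IsPoint (puncture m) X) :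
    IsVector 1 fun A => X A.swap := fun A => by
  have := hX.1 A.swap
  rwa [par_swap] at this

lemma isVector_zero_swap {X : Fin m ⊕ Fin n → Grassmann N} (hX : IsDiff X) :
    IsVector 0 fun A => X A.swap := fun A => by
  have := hX A.swap
  rwa [par_swap, add_assoc, one_add_one_eq_zero] at this

lemma sum_swap {M : Type*} [AddCommMonoid M] (g : Fin m ⊕ Fin n → M) :
    ∑ A : Fin n ⊕ Fin m, g A.swap = ∑ c, g c :=
  (Equiv.sumComm (Fin n) (Fin m)).sum_comp g

lemma evalForm_onPi (τ : Fin m ⊕ Fin n → OddFun n m) (X : Fin m ⊕ Fin n → Grassmann N)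
    (dy : Fin n ⊕ Fin m → Grassmann N) :
    evalForm τ X (onPi dy) = ∑ A, dy A * eval X (τ A.swap) := by
  rw [evalForm, ← sum_swap]
  simp [onPi]

lemma sum_argCoord {M : Type*} [AddCommMonoid M] (g : (Fin n ⊕ Fin m) ⊕ OddPair n m → M) :
    ∑ c, g c = ∑ A, g (argCoord 0 A) + ∑ A, g (argCoord 1 A) := by
  have h : ∑ s : OddPair n m, g (Sum.inr s) =
      ∑ j : Fin m, g (Sum.inr (toLex (Sum.inl j))) + ∑ i : Fin n, g (Sum.inr (toLex (Sum.inr i))) := by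
    rw [← (toLex (α := Fin m ⊕ Fin n)).sum_comp, Fintype.sum_sum_type]
  rw [Fintype.sum_sum_type, Fintype.sum_sum_type, h, Fintype.sum_sum_type, Fintype.sum_sum_type]
  simp only [argCoord_zero_inl, argCoord_zero_inr, argCoord_one_inl, argCoord_one_inr]
  abel

lemma evalForm_pair (τ : (Fin n ⊕ Fin m) ⊕ OddPair n m → PairFun n m)
    (X : (Fin n ⊕ Fin m) ⊕ OddPair n m → Grassmann N) (dx dy : Fin n ⊕ Fin m → Grassmann N) :
    evalForm τ X (pair dx dy) = ∑ A, dx A * eval X (τ (argCoord 0 A)) +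
      ∑ A, dy A * eval X (τ (argCoord 1 A)) := by
  rw [evalForm, sum_argCoord]
  simp only [pair_argCoord_zero, pair_argCoord_one]

lemma pairFun_ext {f g : PairFun n m}
    (h : ∀ (N : ℕ) (x y : Fin n ⊕ Fin m → Grassmann N), IsVector 0 x → IsVector 1 y →
      oddBody y ≠ 0 → eval (pair x y) f = eval (pair x y) g) : f = g :=
  superFun_ext fun N X hX => by
    have := h N _ _ (hX.isVector 0) (hX.isVector 1) hX.oddBody_ne_zero
    rwa [pair_argVec] at this

lemma representable_eval_onPi (f : OddFun n m) : Representable (pairDomain n m)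
    fun _ (X : (Fin n ⊕ Fin m) ⊕ OddPair n m → _) => eval (onPi (argVec 1 X)) f := by
  refine (Representable.comp (U := pairDomain n m) (κ := OddPair n m) f
    (φ := fun v j => v (Sum.inr j)) (by fun_prop) (fun x hx => hx)
    (fun i => Representable.coord (argCoord 1 (Sum.inl i)))).congr fun N X hX => ?_
  refine congrArg (fun Y => eval Y f) (funext fun c => ?_)
  rcases c with j | i
  · exact taylor_coord _ _ hX.even
  · rfl

lemma exists_pullFun (f : OddFun n m) : ∃ g : PairFun n m,
    ∀ (N : ℕ) (x y : Fin n ⊕ Fin m → Grassmann N), IsVector 0 x → IsVector 1 y →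
      oddBody y ≠ 0 → eval (pair x y) g = eval (onPi y) f := by
  obtain ⟨g, hg⟩ := representable_eval_onPi f
  exact ⟨g, fun N x y hx hy h => (hg N _ (isPoint_pair hx hy h)).trans (by
    beta_reduce; rw [argVec_one_pair])⟩

/-- The pull-back to `V × ΠV` of a function on `ΠV`. -/
def pullFun (f : OddFun n m) : PairFun n m := (exists_pullFun f).choose

lemma eval_pullFun (f : OddFun n m) {x y : Fin n ⊕ Fin m → Grassmann N} (hx : IsVector 0 x)
    (hy : IsVector 1 y) (h : oddBody y ≠ 0) : eval (pair x y) (pullFun f) = eval (onPi y) f :=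
  (exists_pullFun f).choose_spec N x y hx hy h

lemma exists_omegaFun (f : Fin n ⊕ Fin m → OddFun n m) : ∃ g : PairFun n m,
    ∀ (N : ℕ) (x y : Fin n ⊕ Fin m → Grassmann N), IsVector 0 x → IsVector 1 y →
      oddBody y ≠ 0 → eval (pair x y) g = ∑ A, x A * eval (onPi y) (f A) := by
  obtain ⟨g, hg⟩ := Representable.sum Finset.univ fun A =>
    (Representable.coord (U := pairDomain n m) (argCoord 0 A)).mul (representable_eval_onPi (f A))
  refine ⟨g, fun N x y hx hy h => (hg N _ (isPoint_pair hx hy h)).trans ?_⟩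
  refine Finset.sum_congr rfl fun A _ => ?_
  rw [pair_argCoord_zero, argVec_one_pair]

/-- The function `∑ x_1^A f_A(x_{1̂})`. -/
def omegaFun (f : Fin n ⊕ Fin m → OddFun n m) : PairFun n m := (exists_omegaFun f).choose

lemma eval_omegaFun (f : Fin n ⊕ Fin m → OddFun n m) {x y : Fin n ⊕ Fin m → Grassmann N}
    (hx : IsVector 0 x) (hy : IsVector 1 y) (h : oddBody y ≠ 0) :
    eval (pair x y) (omegaFun f) = ∑ A, x A * eval (onPi y) (f A) :=
  (exists_omegaFun f).choose_spec N x y hx hy h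

lemma isVector_zero : IsVector 0 (0 : Fin n ⊕ Fin m → Grassmann N) := fun _ => zero_mem _

lemma pullFun_eq_zero_iff {f : OddFun n m} : pullFun f = 0 ↔ f = 0 := by
  constructor
  · intro h
    refine superFun_ext fun N X hX => ?_
    have h1 := eval_pullFun f isVector_zero (isVector_one_swap hX) hX.2
    rw [onPi_swap, h, map_zero] at h1
    rw [← h1, map_zero]
  · rintro rfl
    refine pairFun_ext fun N x y hx hy h => ?_
    rw [eval_pullFun _ hx hy h, map_zero, map_zero]

lemma pullFun_smul_add (r s : ℝ) (f g : OddFun n m) :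
    pullFun (r • f + s • g) = r • pullFun f + s • pullFun g := by
  refine pairFun_ext fun N x y hx hy h => ?_
  simp only [map_add, map_smul, eval_pullFun _ hx hy h]

lemma IsVector.add_mul {F : ZMod 2} {x d : Fin n ⊕ Fin m → Grassmann N} (hx : IsVector F x)
    (hd : IsVector (F + 1) d) {θ : Grassmann N} (hθ : θ ∈ part N 1) :
    IsVector F fun A => x A + θ * d A := fun A => by
  refine add_mem (hx A) ?_
  have := mul_mem_part hθ (hd A)
  rwa [parity_add_two] at this

lemma oddBody_add_mul (y d : Fin n ⊕ Fin m → Grassmann N) {θ : Grassmann N}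
    (hθ : θ ∈ part N 1) : oddBody (fun A => y A + θ * d A) = oddBody y := by
  ext j
  simp [oddBody, body_odd hθ]

/-- The partial derivatives of a function of two vectors are determined by its expansion. -/
lemma pd_pair_eq {f : PairFun n m} {g : ZMod 2 → Fin n ⊕ Fin m → PairFun n m}
    (h : ∀ (N : ℕ) (x y dx dy : Fin n ⊕ Fin m → Grassmann N) (θ : Grassmann N),
      IsVector 0 x → IsVector 1 y → oddBody y ≠ 0 → IsVector 1 dx → IsVector 0 dy →
      θ ∈ part N 1 → eval (pair (fun A => x A + θ * dx A) fun A => y A + θ * dy A) f =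
        eval (pair x y) f + θ * (∑ A, dx A * eval (pair x y) (g 0 A) +
          ∑ A, dy A * eval (pair x y) (g 1 A))) (F : ZMod 2) (A : Fin n ⊕ Fin m) :
    pd (argCoord F A) f = g F A := by
  set τ : (Fin n ⊕ Fin m) ⊕ OddPair n m → PairFun n m :=
    Sum.elim (Sum.elim (fun i => g 0 (Sum.inl i)) fun j => g 1 (Sum.inr j)) fun s =>
      Sum.elim (fun j => g 0 (Sum.inr j)) (fun i => g 1 (Sum.inl i)) (ofLex s)
  have hτ : ∀ F A, τ (argCoord F A) = g F A := by
    intro F A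
    rcases parity_cases F with rfl | rfl <;> rcases A with i | j <;> rfl
  rw [← hτ]
  refine pd_eq_of_expansion (fun N X dX θ hX hdX hθ => ?_) _
  have h1 := h N _ _ _ _ θ (hX.isVector 0) (hX.isVector 1) hX.oddBody_ne_zero
    (by simpa using hdX.isVector 0) (by simpa [one_add_one_eq_zero] using hdX.isVector 1) hθ
  rw [← pair_comp₂ _ _ _ _ fun a b => a + θ * b, pair_argVec, pair_argVec] at h1
  rw [h1]
  conv_rhs => rw [← pair_argVec dX, evalForm_pair]
  simp only [hτ]

lemma evalForm_pd_onPi (f : OddFun n m) {y dy : Fin n ⊕ Fin m → Grassmann N} (hy : IsVector 1 y)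
    (h : oddBody y ≠ 0) (hdy : IsVector 0 dy) {θ : Grassmann N} (hθ : θ ∈ part N 1) :
    eval (onPi fun A => y A + θ * dy A) f =
      eval (onPi y) f + θ * ∑ B, dy B * eval (onPi y) (pd B.swap f) := by
  rw [← evalForm_onPi (fun c => pd c f)]
  exact eval_add_mul (isPoint_onPi hy h) (isDiff_onPi hdy) hθ f

lemma isVector_add_mul_zero {x d : Fin n ⊕ Fin m → Grassmann N} (hx : IsVector 0 x)
    (hd : IsVector 1 d) {θ : Grassmann N} (hθ : θ ∈ part N 1) :
    IsVector 0 fun A => x A + θ * d A := hx.add_mul (by simpa using hd) hθ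

lemma isVector_add_mul_one {x d : Fin n ⊕ Fin m → Grassmann N} (hx : IsVector 1 x)
    (hd : IsVector 0 d) {θ : Grassmann N} (hθ : θ ∈ part N 1) :
    IsVector 1 fun A => x A + θ * d A := hx.add_mul (by simpa [one_add_one_eq_zero] using hd) hθ

lemma pd_pullFun (f : OddFun n m) (F : ZMod 2) (A : Fin n ⊕ Fin m) :
    pd (argCoord F A) (pullFun f) = if F = 0 then 0 else pullFun (pd A.swap f) := by
  refine pd_pair_eq (g := fun F A => if F = 0 then 0 else pullFun (pd A.swap f))
    (fun N x y dx dy θ hx hy h hdx hdy hθ => ?_) F A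
  rw [eval_pullFun f (isVector_add_mul_zero hx hdx hθ) (isVector_add_mul_one hy hdy hθ)
    (by rwa [oddBody_add_mul y dy hθ]), evalForm_pd_onPi f hy h hdy hθ, eval_pullFun f hx hy h]
  simp [eval_pullFun _ hx hy h]

/-- The sign comes from carrying x_1^A past θ and past the increment of x_1̂^B, so that θ and the
increment stand on the left as in the expansion defining a left derivative. -/
lemma pd_omegaFun (f : Fin n ⊕ Fin m → OddFun n m) (F : ZMod 2) (B : Fin n ⊕ Fin m) :
    pd (argCoord F B) (omegaFun f) = if F = 0 then pullFun (f B) else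
      omegaFun fun A => sgn (par A * (par B + 1)) • pd B.swap (f A) := by
  refine pd_pair_eq (g := fun F B => if F = 0 then pullFun (f B) else
      omegaFun fun A => sgn (par A * (par B + 1)) • pd B.swap (f A))
    (fun N x y dx dy θ hx hy h hdx hdy hθ => ?_) F B
  rw [eval_omegaFun f (isVector_add_mul_zero hx hdx hθ) (isVector_add_mul_one hy hdy hθ)
    (by rwa [oddBody_add_mul y dy hθ]), eval_omegaFun f hx hy h]
  simp only [if_true, one_ne_zero, if_false, eval_pullFun _ hx hy h, eval_omegaFun _ hx hy h,
    evalForm_pd_onPi _ hy h hdy hθ, map_smul]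
  have hA : ∀ A, (x A + θ * dx A) * (eval (onPi y) (f A) +
      θ * ∑ B, dy B * eval (onPi y) (pd B.swap (f A))) =
      x A * eval (onPi y) (f A) + (θ * (dx A * eval (onPi y) (f A)) +
        θ * ∑ B, dy B * (x A * sgn (par A * (par B + 1)) • eval (onPi y) (pd B.swap (f A)))) := by
    intro A
    have h1 : θ * dx A * (θ * ∑ B, dy B * eval (onPi y) (pd B.swap (f A))) = 0 := by
      rw [mul_assoc, ← mul_assoc (dx A), part_commute (hdx A) hθ, smul_mul_assoc, mul_smul_comm,
        mul_assoc, odd_mul_mul_self hθ, smul_zero]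
    have h2 : x A * (θ * ∑ B, dy B * eval (onPi y) (pd B.swap (f A))) =
        θ * ∑ B, dy B * (x A * sgn (par A * (par B + 1)) • eval (onPi y) (pd B.swap (f A))) := by
      have hxA := hx A
      rw [← mul_assoc, part_commute hxA hθ, smul_mul_assoc, mul_assoc, ← mul_smul_comm,
        Finset.mul_sum, Finset.smul_sum]
      congr 1
      refine Finset.sum_congr rfl fun B _ => ?_
      rw [← mul_assoc, part_commute hxA (hdy B), smul_mul_assoc, smul_smul, ← sgn_add, mul_smul_comm,
        mul_smul_comm, mul_assoc]
      congr 2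
      ring
    rw [mul_add, add_mul, add_mul, h1, h2, add_zero, mul_assoc]
    abel
  rw [Finset.sum_congr rfl fun A _ => hA A, Finset.sum_add_distrib, Finset.sum_add_distrib,
    ← Finset.mul_sum, ← Finset.mul_sum, ← mul_add, Finset.sum_comm]
  simp only [Finset.mul_sum]

/-- Closedness of `∑ dx^A f_A` is equivalent to the differential equations for `∑ x_1^A f_A`. -/
theorem isClosedForm_iff_PDE (f : Fin n ⊕ Fin m → OddFun n m) :
    (IsClosedForm fun c : Fin m ⊕ Fin n => f c.swap) ↔ PDE (omegaFun f) := by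
  -- All the content of the system lies here: for functions linear in x_1, the equation with F = 1,
  -- G = 0 is a nonzero multiple of the pulled-back curl.
  have hmixed : ∀ A B : Fin n ⊕ Fin m,
      curl (fun c : Fin m ⊕ Fin n => f c.swap) A.swap B.swap = 0 ↔
        pd (argCoord 1 A) (pd (argCoord 0 B) (omegaFun f)) +
          sgn (par B) • pd (argCoord 0 A) (pd (argCoord 1 B) (omegaFun f)) = 0 := by
    intro A B
    simp only [pd_omegaFun, pd_pullFun, if_true, one_ne_zero, if_false]
    have h1 : pullFun (pd A.swap (f B)) +
        sgn (par B) • pullFun (sgn (par A * (par B + 1)) • pd B.swap (f A)) =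
        pullFun ((sgn (par A * par B) * sgn (par B)) •
          curl (fun c : Fin m ⊕ Fin n => f c.swap) A.swap B.swap) := by
      have h2 := pullFun_smul_add 1 (sgn (par B)) (pd A.swap (f B))
        (sgn (par A * (par B + 1)) • pd B.swap (f A))
      rw [one_smul, one_smul] at h2
      rw [← h2]
      congr 1
      simp only [curl, par_swap, Sum.swap_swap, add_assoc, one_add_one_eq_zero, add_zero, smul_add,
        smul_smul]
      rw [mul_mul_mul_comm, sgn_mul_self, sgn_mul_self, mul_one, one_smul, add_comm, mul_add,
        mul_one, sgn_add]
      congr 2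
      ring
    rw [h1, pullFun_eq_zero_iff, smul_eq_zero]
    simp [sgn_ne_zero]
  -- For F = G = 1 the sign in the system is -1 and both terms coincide, so the equation is empty.
  have hneg : ∀ t : PairFun n m, t + (-1 : ℝ) • t = 0 := fun t => by
    ext I x
    simp
  rw [isClosedForm_iff]
  constructor
  · intro h F G A B
    rcases parity_cases F with rfl | rfl <;> rcases parity_cases G with rfl | rfl
    · simp [pd_omegaFun, pd_pullFun]
    -- The equation for F = 0, G = 1 is the one for F = 1, G = 0, with the same A and B, multiplied
    -- by the sign of B.
    · have h1 := congrArg (fun t => sgn (par B) • t) ((hmixed A B).1 (h _ _))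
      simp only [smul_add, smul_smul, sgn_mul_self, one_smul, smul_zero] at h1
      rw [add_comm] at h1
      simpa using h1
    · have h1 := (hmixed A B).1 (h _ _)
      simpa using h1
    · rw [one_add_one_eq_zero, mul_zero, add_zero, mul_one, sgn_one]
      exact hneg _
  · intro h c c'
    have h1 := h 1 0 c.swap c'.swap
    rw [← Sum.swap_swap c, ← Sum.swap_swap c', hmixed]
    simpa using h1

end PairFunctions

/-! ### Forms on `V` are linear in the even vector -/

section Linearity

variable {n m : ℕ}

lemma PDE.pd_pd_even {L : PairFun n m} (hL : PDE L) (A B : Fin n ⊕ Fin m) :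
    pd (argCoord 0 A) (pd (argCoord 0 B) L) = 0 := by
  have h := hL 0 0 A B
  rw [add_zero, mul_zero, mul_zero, add_zero, sgn_zero, one_smul, ← two_smul ℝ] at h
  exact (smul_eq_zero.1 h).resolve_left two_ne_zero

/-- The coefficient is constant along the segment that scales the components x_1^i to 0. The segment
stays in the domain, which restricts only the components of the odd vector. -/
lemma coeff_eq_of_pd_even {M : PairFun n m}
    (h : ∀ i : Fin n, pd (argCoord 0 (Sum.inl i)) M = 0) (I : Finset (OddPair n m))
    {z : Fin n ⊕ Fin m → ℝ} (hz : z ∈ pairDomain n m) :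
    M.1 I z = M.1 I (Sum.elim (0 : Fin n → ℝ) fun j => z (Sum.inr j)) := by
  set ℓ : ℝ → Fin n ⊕ Fin m → ℝ := fun t =>
    Sum.elim (fun i => t * z (Sum.inl i)) fun j => z (Sum.inr j) with hℓ
  have hmem : ∀ t, ℓ t ∈ pairDomain n m := fun t => hz
  have hd : ∀ t, HasDerivAt ℓ (Sum.elim (fun i => z (Sum.inl i)) 0) t := by
    intro t
    refine hasDerivAt_pi.2 fun c => ?_
    rcases c with i | j
    · simpa [hℓ] using (hasDerivAt_id t).mul_const (z (Sum.inl i))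
    · simpa [hℓ] using hasDerivAt_const t (z (Sum.inr j))
  have hdir : (Sum.elim (fun i => z (Sum.inl i)) 0 : Fin n ⊕ Fin m → ℝ) =
      ∑ i : Fin n, z (Sum.inl i) • Pi.single (Sum.inl i) (1 : ℝ) := by
    ext c
    rcases c with i | j <;> simp [Finset.sum_apply, Pi.single_apply]
  have hder : ∀ t, HasDerivAt (fun t => M.1 I (ℓ t)) 0 t := by
    intro t
    have h1 := ((contDiffAt_coeff M I (hmem t)).differentiableAt (by simp)).hasFDerivAt
    have h2 := h1.comp_hasDerivAt t (hd t)
    have h3 : fderiv ℝ (M.1 I) (ℓ t) (Sum.elim (fun i => z (Sum.inl i)) 0) = 0 := by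
      rw [hdir, map_sum]
      refine Finset.sum_eq_zero fun i _ => ?_
      have h4 : (pd (argCoord 0 (Sum.inl i)) M).1 I (ℓ t) =
          fderiv ℝ (M.1 I) (ℓ t) (Pi.single (Sum.inl i) 1) := if_pos (hmem t)
      rw [map_smul, ← h4, h i]
      simp
    rwa [h3] at h2
  have hconst := is_const_of_deriv_eq_zero (fun t => (hder t).differentiableAt)
    (fun t => (hder t).deriv) 1 0
  have h1 : ℓ 1 = z := by
    ext c; rcases c with i | j <;> simp [hℓ]
  have h0 : ℓ 0 = Sum.elim (0 : Fin n → ℝ) fun j => z (Sum.inr j) := by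
    ext c; rcases c with i | j <;> simp [hℓ]
  rwa [h1, h0] at hconst

lemma coeff_eq_zero_of_pd_odd {M : PairFun n m} {k : OddPair n m}
    (h : pd (Sum.inr k) M = 0) {I : Finset (OddPair n m)} (hk : k ∈ I) : M.1 I = 0 := by
  have h1 : (pd (Sum.inr k) M).1 (I.erase k) =
      ((-1 : ℝ) ^ ((I.erase k).filter (· < k)).card) • M.1 (insert k (I.erase k)) :=
    if_neg (Finset.notMem_erase k I)
  rw [h, Finset.insert_erase hk] at h1
  exact (smul_eq_zero.1 h1.symm).resolve_left (pow_ne_zero _ (by norm_num))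

/-- A function that does not depend on the even vector is a pull-back. -/
lemma exists_eq_pullFun {M : PairFun n m} (h : ∀ B, pd (argCoord 0 B) M = 0) :
    ∃ f : OddFun n m, M = pullFun f := by
  -- The candidate for f is the restriction of M to x_1 = 0: zero is substituted for all components
  -- of the even vector, both the even and the odd ones.
  have hΞ : ∀ s : OddPair n m, Representable (puncture m) (κ := Fin n) fun N X =>
      Sum.elim (fun _ => 0) (fun i => X (Sum.inr i)) (ofLex s) := by
    intro s
    rcases h : ofLex s with j | i
    · exact Representable.zero
    · exact Representable.coord (Sum.inr i)
  obtain ⟨f, hf⟩ := Representable.comp (U := puncture m) (κ := Fin n) M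
    (φ := fun v => Sum.elim (0 : Fin n → ℝ) v)
    (contDiffOn_pi.2 fun c => by
      rcases c with i | j
      · exact contDiffOn_const
      · exact (contDiff_apply ℝ ℝ j).contDiffOn) (fun x hx => hx) hΞ
  refine ⟨f, ?_⟩
  ext I z
  by_cases hz : z ∈ pairDomain n m
  swap
  · rw [(M.2 I).2 z hz, ((pullFun f).2 I).2 z hz]
  refine coeff_eq_of_eval_eq hz hz ?_ I
  set X := genericPoint (OddPair n m) z with hX
  have hXp : IsPoint (pairDomain n m) X := isPoint_genericPoint hz
  conv_rhs => rw [← pair_argVec X, eval_pullFun f (hXp.isVector 0) (hXp.isVector 1)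
    hXp.oddBody_ne_zero, hf _ _ (isPoint_onPi (hXp.isVector 1) hXp.oddBody_ne_zero)]
  set z₀ : Fin n ⊕ Fin m → ℝ := Sum.elim (0 : Fin n → ℝ) fun j => z (Sum.inr j) with hz₀
  have hz₀m : z₀ ∈ pairDomain n m := hz
  set ξ : OddPair n m → Grassmann (Fintype.card (OddPair n m ⊕ Fin 3)) := fun s =>
    Sum.elim (fun _ => 0) (fun i => onPi (argVec 1 X) (Sum.inr i)) (ofLex s) with hξ
  have harg : (Sum.elim (fun j => taylor (fun v : Fin m → ℝ => (Sum.elim (0 : Fin n → ℝ) v) j)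
      fun i => onPi (argVec 1 X) (Sum.inl i)) ξ :
        (Fin n ⊕ Fin m) ⊕ OddPair n m → Grassmann (Fintype.card (OddPair n m ⊕ Fin 3))) =
      Sum.elim (fun c => algebraMap ℝ _ (z₀ c)) ξ := by
    have heven : ∀ j : Fin m, onPi (argVec 1 X) (Sum.inl j) ∈ part _ 0 :=
      (isPoint_onPi (hXp.isVector 1) hXp.oddBody_ne_zero).even
    ext1 c
    rcases c with (i | j) | s
    · exact taylor_const 0 _ heven
    · exact taylor_coord j _ heven
    · rfl
  change eval X M = eval (Sum.elim (fun j => taylor (fun v : Fin m → ℝ => (Sum.elim (0 : Fin n → ℝ) v) j)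
      fun i => onPi (argVec 1 X) (Sum.inl i)) ξ) M
  rw [harg, eval_genericPoint hz, eval_eq_sum]
  swap
  · have : bodyPt (Sum.elim (fun c => algebraMap ℝ _ (z₀ c)) ξ) = z₀ :=
      funext fun c => body_algebraMap _
    rwa [this]
  refine Finset.sum_congr rfl fun J _ => ?_
  have htaylor : taylor (M.1 J) (fun c => algebraMap ℝ
      (Grassmann (Fintype.card (OddPair n m ⊕ Fin 3))) (z₀ c)) = algebraMap ℝ _ (M.1 J z) := by
    rw [taylor_algebraMap (contDiffAt_coeff M J hz₀m),
      coeff_eq_of_pd_even (fun i => h (Sum.inl i)) J hz]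
  simp only [Sum.elim_inl, Sum.elim_inr]
  rw [htaylor, ← Algebra.smul_def]
  -- A monomial containing an odd component of x_1 has coefficient zero by the vanishing of the odd
  -- derivatives. The remaining monomials are not affected by the substitution x_1 = 0.
  by_cases hJ : ∃ j : Fin m, toLex (Sum.inl j) ∈ J
  · obtain ⟨j, hj⟩ := hJ
    rw [coeff_eq_zero_of_pd_odd (h (Sum.inr j)) hj]
    simp
  · congr 1
    unfold oddMonomial
    congr 1
    refine List.map_congr_left fun s hs => ?_
    rw [Finset.mem_sort] at hs
    rcases hsum : ofLex s with j | i
    · exact absurd (hsum ▸ hs : toLex (Sum.inl j) ∈ J) fun h' => hJ ⟨j, h'⟩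
    · simp only [hξ, hsum, Sum.elim_inr]
      have : s = toLex (Sum.inr i) := congrArg toLex hsum
      rw [this]
      rfl

/-- Homogeneity of degree one in the even vector. -/
lemma BER.eval_mul {L : PairFun n m} (hL : BER L) {N : ℕ} {a : Grassmann N} (ha : a ∈ part N 0)
    (hu : IsUnit a) {x y : Fin n ⊕ Fin m → Grassmann N} (hx : IsVector 0 x) (hy : IsVector 1 y)
    (h : oddBody y ≠ 0) : eval (pair (fun A => a * x A) y) L = eval (pair x y) L * a := by
  have := hL N a 0 0 1 ha (zero_mem _) (zero_mem _) one_mem_part hu isUnit_one x y hx hy h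
  simpa using this

/-- Euler's identity. Scaling x_1 by 1 + θθ' is a displacement by θ times θ' x_1. Expanding to first
order and comparing with homogeneity gives L = x_1^A ∂L/∂x_1^A after multiplication by θθ', and
these derivatives are pull-backs from the odd vector. -/
theorem exists_eq_omegaFun {L : PairFun n m} (hB : BER L) (hP : PDE L) :
    ∃ f : Fin n ⊕ Fin m → OddFun n m, L = omegaFun f := by
  choose f hf using fun A => exists_eq_pullFun (M := pd (argCoord 0 A) L) fun B => hP.pd_pd_even B A
  refine ⟨f, sub_eq_zero.1 (superFun_eq_zero [0, 1] (by simp) fun z hz => ?_)⟩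
  set X := genericPoint (OddPair n m) z
  have hX : IsPoint (pairDomain n m) X := isPoint_genericPoint hz
  set θ := labelledGen (Sum.inr 0 : OddPair n m ⊕ Fin 3)
  set θ' := labelledGen (Sum.inr 1 : OddPair n m ⊕ Fin 3)
  have hθ : θ ∈ part _ 1 := labelledGen_mem_part _
  have hθ' : θ' ∈ part _ 1 := labelledGen_mem_part _
  have hspare : spareProd (OddPair n m) [0, 1] = θ * θ' := by simp [spareProd, θ, θ']
  have hθθ : θ * θ' ∈ part _ 0 := by
    simpa only [one_add_one_eq_zero] using mul_mem_part hθ hθ'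
  set x := argVec 0 X
  set y := argVec 1 X
  have hx : IsVector 0 x := hX.isVector 0
  have hy : IsVector 1 y := hX.isVector 1
  have h : oddBody y ≠ 0 := hX.oddBody_ne_zero
  have hxy : pair x y = X := pair_argVec X
  have hunit : IsUnit (1 + θ * θ') := by
    rw [isUnit_iff_body_ne_zero, map_add, map_mul, body_odd hθ, map_one, zero_mul, add_zero]
    exact one_ne_zero
  have h1 := hB.eval_mul (add_mem one_mem_part hθθ) hunit hx hy h
  have hdx : IsVector 1 fun A => θ' * x A := fun A => by
    have := mul_mem_part hθ' (hx A)
    rwa [add_zero, add_comm] at this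
  have h2 := eval_add_mul (isPoint_pair hx hy h) (isDiff_pair hdx isVector_zero) hθ L
  have h3 : (fun c => pair x y c + θ * pair (fun A => θ' * x A) 0 c) =
      pair (fun A => (1 + θ * θ') * x A) y := by
    rw [pair_comp₂ x y _ 0 fun a b => a + θ * b]
    congr 1
    · funext A
      rw [add_mul, one_mul, mul_assoc]
    · funext A
      simp
  rw [h3, h1, evalForm_pair, mul_add, mul_one] at h2
  have h4 := add_left_cancel h2
  have h5 : ∑ A, θ' * x A * eval (pair x y) (pd (argCoord 0 A) L) =
      θ' * eval (pair x y) (omegaFun f) := by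
    rw [eval_omegaFun f hx hy h, Finset.mul_sum]
    refine Finset.sum_congr rfl fun A _ => ?_
    rw [hf A, eval_pullFun _ hx hy h, mul_assoc]
  rw [h5] at h4
  rw [hspare, map_sub, mul_sub, even_commute hθθ, ← hxy, h4]
  simp [mul_assoc]

end Linearity

/-! ### Affine charts -/

section Charts

variable {n m N : ℕ} {α : Fin m}

lemma inverse_eq_of_mul_eq_one {a b : Grassmann N} (h : a * b = 1) (h' : b * a = 1) :
    Ring.inverse a = b :=
  Ring.inverse_unit ⟨a, b, h, h'⟩

lemma even_left_comm {a : Grassmann N} (ha : a ∈ part N 0) (b c : Grassmann N) :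
    b * (a * c) = a * (b * c) := by
  rw [← mul_assoc, ← even_commute ha, mul_assoc]

lemma par_homIndex (c : {j : Fin m // j ≠ α} ⊕ Fin n) : par (homIndex c) = par c + 1 := by
  rcases c with j | i <;> rfl

lemma homIndex_cases (α : Fin m) (A : Fin n ⊕ Fin m) :
    A = Sum.inr α ∨ ∃ c : {j : Fin m // j ≠ α} ⊕ Fin n, A = homIndex c := by
  rcases A with i | j
  · exact Or.inr ⟨Sum.inr i, rfl⟩
  · by_cases h : j = α
    · exact Or.inl (congrArg Sum.inr h)
    · exact Or.inr ⟨Sum.inl ⟨j, h⟩, rfl⟩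

lemma homogenize_homIndex (u : {j : Fin m // j ≠ α} ⊕ Fin n → Grassmann N) (v : Grassmann N)
    (c : {j : Fin m // j ≠ α} ⊕ Fin n) : homogenize α u v (homIndex c) = u c := by
  rcases c with j | i
  · exact dif_neg j.2
  · rfl

lemma homogenize_self (u : {j : Fin m // j ≠ α} ⊕ Fin n → Grassmann N) (v : Grassmann N) :
    homogenize α u v (Sum.inr α) = v :=
  dif_pos rfl

lemma sum_homIndex (α : Fin m) {M : Type*} [AddCommMonoid M] (g : Fin n ⊕ Fin m → M) :
    ∑ A, g A = g (Sum.inr α) + ∑ c : {j : Fin m // j ≠ α} ⊕ Fin n, g (homIndex c) := by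
  have h : ∑ j : Fin m, g (Sum.inr j) =
      g (Sum.inr α) + ∑ j : {j : Fin m // j ≠ α}, g (Sum.inr j.1) := by
    rw [← Finset.add_sum_erase _ _ (Finset.mem_univ α)]
    congr 1
    exact Finset.sum_subtype _ (by simp) fun j => g (Sum.inr j)
  rw [Fintype.sum_sum_type, Fintype.sum_sum_type, h]
  simp only [homIndex]
  abel

lemma isVector_homogenize_one {u : {j : Fin m // j ≠ α} ⊕ Fin n → Grassmann N}
    (hu : IsPoint ⊤ u) : IsVector 1 (homogenize α u 1) := fun A => by
  rcases homIndex_cases α A with rfl | ⟨c, rfl⟩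
  · rw [homogenize_self]
    exact one_mem_part
  · rw [homogenize_homIndex, par_homIndex, add_assoc, one_add_one_eq_zero, add_zero]
    exact hu.1 c

lemma isVector_homogenize_zero {u : {j : Fin m // j ≠ α} ⊕ Fin n → Grassmann N}
    (hu : IsDiff u) : IsVector 0 (homogenize α u 0) := fun A => by
  rcases homIndex_cases α A with rfl | ⟨c, rfl⟩
  · rw [homogenize_self]
    exact zero_mem _
  · rw [homogenize_homIndex, par_homIndex, add_zero]
    exact hu c

lemma IsVector.even_coord {y : Fin n ⊕ Fin m → Grassmann N} (hy : IsVector 1 y) (α : Fin m) :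
    y (Sum.inr α) ∈ part N 0 := by
  simpa only [par, one_add_one_eq_zero] using hy (Sum.inr α)

lemma IsVector.odd_coord {x : Fin n ⊕ Fin m → Grassmann N} (hx : IsVector 0 x) (α : Fin m) :
    x (Sum.inr α) ∈ part N 1 := by
  simpa only [par, add_zero] using hx (Sum.inr α)

lemma oddBody_ne_zero_of_coord {y : Fin n ⊕ Fin m → Grassmann N}
    (h : body (y (Sum.inr α)) ≠ 0) : oddBody y ≠ 0 := fun h' => h (congrFun h' α)

lemma isVector_even_mul {p : ZMod 2} {x : Fin n ⊕ Fin m → Grassmann N} (hx : IsVector p x)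
    {a : Grassmann N} (ha : a ∈ part N 0) : IsVector p fun A => a * x A := fun A => by
  have := mul_mem_part ha (hx A)
  rwa [zero_add] at this

lemma isVector_odd_mul_one {x : Fin n ⊕ Fin m → Grassmann N} (hx : IsVector 1 x)
    {a : Grassmann N} (ha : a ∈ part N 1) : IsVector 0 fun A => a * x A := fun A => by
  have := mul_mem_part ha (hx A)
  rwa [add_left_comm, one_add_one_eq_zero] at this

lemma IsVector.add {p : ZMod 2} {x y : Fin n ⊕ Fin m → Grassmann N} (hx : IsVector p x)
    (hy : IsVector p y) : IsVector p fun A => x A + y A := fun A => add_mem (hx A) (hy A)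

lemma isPoint_affine {y : Fin n ⊕ Fin m → Grassmann N} (hy : IsVector 1 y) :
    IsPoint ⊤ (affine α y) := by
  refine ⟨fun c => ?_, trivial⟩
  have := mul_mem_part (hy (homIndex c)) (inverse_mem_part (hy.even_coord α))
  rwa [par_homIndex, add_zero, add_assoc, one_add_one_eq_zero, add_zero] at this

lemma isDiff_dAffine {x y : Fin n ⊕ Fin m → Grassmann N} (hy : IsVector 1 y)
    (hx : IsVector 0 x) : IsDiff (dAffine α y x) := fun c => by
  have hi := inverse_mem_part (hy.even_coord α)
  refine sub_mem ?_ ?_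
  · have := mul_mem_part (hx (homIndex c)) hi
    rwa [par_homIndex, add_zero, add_zero] at this
  · rw [sq]
    have hii : Ring.inverse (y (Sum.inr α)) * Ring.inverse (y (Sum.inr α)) ∈ part N 0 := by
      simpa only [add_zero] using mul_mem_part hi hi
    have := mul_mem_part (mul_mem_part (hx.odd_coord α) (hy (homIndex c))) hii
    rwa [par_homIndex, add_zero, add_assoc, one_add_one_eq_zero, add_zero, add_comm] at this

lemma affine_mul (y : Fin n ⊕ Fin m → Grassmann N)
    {d : Grassmann N} (hd : d ∈ part N 0) (hu : IsUnit d) :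
    affine α (fun A => d * y A) = affine α y := by
  funext c
  rw [affine, affine, Ring.mul_inverse_rev' (even_commute hd _),
    ← even_commute (inverse_mem_part hd), ← mul_assoc, even_commute hd, mul_assoc (y _),
    Ring.mul_inverse_cancel d hu, mul_one]

/-- Rescaling the base point by d with the tangent vector kept fixed divides the differential of the
projection by d. With `affine_mul` this produces the factor d⁻¹ of the Berezinian. -/
lemma dAffine_mul (y : Fin n ⊕ Fin m → Grassmann N)
    {d : Grassmann N} (hd : d ∈ part N 0) (hu : IsUnit d) (x : Fin n ⊕ Fin m → Grassmann N) :
    dAffine α (fun A => d * y A) x = fun c => Ring.inverse d * dAffine α y x c := by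
  funext c
  have hd' := inverse_mem_part hd
  set i := Ring.inverse (y (Sum.inr α)) with hi
  set e := Ring.inverse d
  have hde : d * e = 1 := Ring.mul_inverse_cancel d hu
  have h1 : Ring.inverse (d * y (Sum.inr α)) = e * i := by
    rw [Ring.mul_inverse_rev' (even_commute hd _), even_commute hd']
  simp only [dAffine, h1, ← hi]
  have h2 : x (Sum.inr α) * (d * y (homIndex c)) * (e * i) ^ 2 =
      e * (x (Sum.inr α) * y (homIndex c) * i ^ 2) := by
    have h3 : (e * i) ^ 2 = e * (e * i ^ 2) := by
      rw [sq, mul_assoc, ← mul_assoc i, ← even_commute hd' i, sq]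
      simp only [mul_assoc]
    rw [h3, even_left_comm hd', even_left_comm hd (x _), mul_assoc d, even_left_comm hd' _ (i ^ 2),
      ← mul_assoc d e, hde, one_mul]
  rw [h2, mul_sub, ← mul_assoc, ← even_commute hd', mul_assoc]

lemma mul_inverse_coord {y : Fin n ⊕ Fin m → Grassmann N} (h : body (y (Sum.inr α)) ≠ 0) :
    y (Sum.inr α) * Ring.inverse (y (Sum.inr α)) = 1 :=
  Ring.mul_inverse_cancel _ (isUnit_iff_body_ne_zero.2 h)

/-- The fibre direction y is killed by the differential of the projection, which is otherwise left
linear in the tangent vector. -/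
lemma dAffine_add {y : Fin n ⊕ Fin m → Grassmann N} (hy : IsVector 1 y)
    (h : body (y (Sum.inr α)) ≠ 0) (a β : Grassmann N)
    (x : Fin n ⊕ Fin m → Grassmann N) :
    dAffine α y (fun A => a * x A + β * y A) = fun c => a * dAffine α y x c := by
  funext c
  have hv := mul_inverse_coord h
  simp only [dAffine]
  set i := Ring.inverse (y (Sum.inr α))
  have h1 : β * y (Sum.inr α) * y (homIndex c) * i ^ 2 = β * y (homIndex c) * i := by
    rw [mul_assoc β, even_commute (hy.even_coord α), ← mul_assoc, mul_assoc, sq, ← mul_assoc (y _) i,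
      hv, one_mul]
  rw [add_mul, add_mul, add_mul, h1, mul_sub]
  simp only [mul_assoc]
  abel

/-- The geometric series for the inverse stops after its linear term because t² = 0. -/
lemma inverse_add_mul {y : Fin n ⊕ Fin m → Grassmann N} (hy : IsVector 1 y)
    (h : body (y (Sum.inr α)) ≠ 0) {t : Grassmann N} (ht : t ∈ part N 0) (htt : t * t = 0) :
    Ring.inverse (y (Sum.inr α) + t) = Ring.inverse (y (Sum.inr α)) -
      t * Ring.inverse (y (Sum.inr α)) ^ 2 := by
  have hv := mul_inverse_coord h
  have hcomm : Commute (y (Sum.inr α)) t := even_commute (hy.even_coord α) t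
  set v := y (Sum.inr α)
  set i := Ring.inverse v
  have key : (v + t) * (i - t * i ^ 2) = 1 := by
    have h1 : v * (t * i ^ 2) = t * i := by
      rw [← mul_assoc, hcomm.eq, mul_assoc, sq, ← mul_assoc v, hv, one_mul]
    have h2 : t * (t * i ^ 2) = 0 := by rw [← mul_assoc, htt, zero_mul]
    rw [add_mul, mul_sub, mul_sub, h1, h2, hv]
    abel
  refine inverse_eq_of_mul_eq_one key ?_
  rw [← key]
  exact (even_commute (add_mem (hy.even_coord α) ht) _).symm

lemma coord_mul_self {x : Fin n ⊕ Fin m → Grassmann N} (hx : IsVector 0 x) {θ : Grassmann N}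
    (hθ : θ ∈ part N 1) :
    θ * x (Sum.inr α) ∈ part N 0 ∧ θ * x (Sum.inr α) * (θ * x (Sum.inr α)) = 0 := by
  have hθx : θ * x (Sum.inr α) ∈ part N 0 := by
    simpa only [one_add_one_eq_zero] using mul_mem_part hθ (hx.odd_coord α)
  refine ⟨hθx, ?_⟩
  rw [mul_assoc, ← even_commute hθx, mul_assoc θ, odd_mul_mul_self hθ]

lemma affine_add_mul {x y : Fin n ⊕ Fin m → Grassmann N} (hy : IsVector 1 y)
    (h : body (y (Sum.inr α)) ≠ 0) (hx : IsVector 0 x) {θ : Grassmann N} (hθ : θ ∈ part N 1) :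
    affine α (fun A => y A + θ * x A) = fun c => affine α y c + θ * dAffine α y x c := by
  funext c
  obtain ⟨ht, htt⟩ := coord_mul_self (α := α) hx hθ
  simp only [affine, dAffine]
  rw [inverse_add_mul hy h ht htt]
  set i := Ring.inverse (y (Sum.inr α))
  have h1 : θ * x (homIndex c) * (θ * x (Sum.inr α) * i ^ 2) = 0 := by
    rw [mul_assoc θ (x (homIndex c)), mul_assoc θ (x (Sum.inr α)), ← mul_assoc (x _),
      part_commute (hx (homIndex c)) hθ, smul_mul_assoc, mul_smul_comm, mul_assoc,
      odd_mul_mul_self hθ, smul_zero]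
  have h2 : y (homIndex c) * (θ * x (Sum.inr α) * i ^ 2) =
      θ * (x (Sum.inr α) * y (homIndex c) * i ^ 2) := by
    rw [even_left_comm ht]
    simp only [mul_assoc]
  rw [add_mul, mul_sub, mul_sub, h1, h2, mul_sub, mul_assoc θ]
  abel

/-- With x in the role of dy this is d(du) = 0: the first order change of du along its own
differential vanishes. -/
lemma dAffine_add_mul {x y : Fin n ⊕ Fin m → Grassmann N} (hy : IsVector 1 y)
    (h : body (y (Sum.inr α)) ≠ 0) (hx : IsVector 0 x) {θ : Grassmann N} (hθ : θ ∈ part N 1) :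
    dAffine α (fun A => y A + θ * x A) x = dAffine α y x := by
  funext c
  obtain ⟨ht, htt⟩ := coord_mul_self (α := α) hx hθ
  have hi := inverse_mem_part (hy.even_coord α)
  simp only [dAffine]
  rw [inverse_add_mul hy h ht htt]
  set i := Ring.inverse (y (Sum.inr α))
  have hxα := hx.odd_coord α
  set z := x (Sum.inr α)
  set t := θ * z
  have hzt : z * t = 0 := by
    rw [← even_commute ht, mul_assoc, odd_mul_self hxα, mul_zero]
  have hsq : (i - t * i ^ 2) ^ 2 = i ^ 2 + t * (-2 * i ^ 3) := by
    have h1 : i * (t * i ^ 2) = t * i ^ 3 := by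
      rw [even_left_comm ht]; noncomm_ring
    have h2 : t * i ^ 2 * i = t * i ^ 3 := by noncomm_ring
    have h3 : t * i ^ 2 * (t * i ^ 2) = 0 := by
      rw [mul_assoc, even_left_comm ht, ← mul_assoc, htt, zero_mul]
    rw [sq, sub_mul, mul_sub, mul_sub, h1, h2, h3]
    noncomm_ring
  have h4 : z * (y (homIndex c) + θ * x (homIndex c)) * (i ^ 2 + t * (-2 * i ^ 3)) =
      z * y (homIndex c) * i ^ 2 - x (homIndex c) * (t * i ^ 2) := by
    rw [mul_add, even_left_comm ht, ← mul_assoc t, ← mul_assoc t z, even_commute ht z, hzt]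
    rw [zero_mul, zero_mul, add_zero, mul_add, add_mul, ← mul_assoc z θ, odd_anticommute hxα hθ]
    rw [even_left_comm ht, ← mul_assoc t (x _), neg_mul, neg_mul, sub_eq_add_neg]
  rw [hsq, h4, mul_sub]
  abel

lemma homogenize_affine {y : Fin n ⊕ Fin m → Grassmann N} (hy : IsVector 1 y)
    (h : body (y (Sum.inr α)) ≠ 0) :
    homogenize α (affine α y) 1 = fun A => Ring.inverse (y (Sum.inr α)) * y A := by
  have hi := inverse_mem_part (hy.even_coord α)
  funext A
  rcases homIndex_cases α A with rfl | ⟨c, rfl⟩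
  · rw [homogenize_self, even_commute hi, mul_inverse_coord h]
  · rw [homogenize_homIndex, affine, even_commute hi]

/-- Together with `homogenize_affine` this exhibits passage to the chart as the action of the matrix
(i, -x^α̂ i²; 0, i), where i is the inverse of y^α̂. It is the reason why (BER) implies descent. -/
lemma homogenize_dAffine {x y : Fin n ⊕ Fin m → Grassmann N} (hy : IsVector 1 y)
    (h : body (y (Sum.inr α)) ≠ 0) :
    homogenize α (dAffine α y x) 0 = fun A => Ring.inverse (y (Sum.inr α)) * x A +
      -(x (Sum.inr α) * Ring.inverse (y (Sum.inr α)) ^ 2) * y A := by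
  have hi := inverse_mem_part (hy.even_coord α)
  have hv := mul_inverse_coord h
  funext A
  set i := Ring.inverse (y (Sum.inr α))
  have hii : i ^ 2 ∈ part N 0 := by
    simpa only [add_zero, ← sq] using mul_mem_part hi hi
  rcases homIndex_cases α A with rfl | ⟨c, rfl⟩
  · rw [homogenize_self, neg_mul, mul_assoc, sq, mul_assoc i i, even_commute hi (y _), hv, mul_one,
      even_commute hi, add_neg_cancel]
  · rw [homogenize_homIndex, dAffine, even_commute hi, neg_mul, mul_assoc, mul_assoc,
      even_commute hii, sub_eq_add_neg]

lemma affine_homogenize (u : {j : Fin m // j ≠ α} ⊕ Fin n → Grassmann N) :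
    affine α (homogenize α u 1) = u := by
  funext c
  rw [affine, homogenize_self, homogenize_homIndex, Ring.inverse_one, mul_one]

lemma dAffine_homogenize (u du : {j : Fin m // j ≠ α} ⊕ Fin n → Grassmann N) :
    dAffine α (homogenize α u 1) (homogenize α du 0) = du := by
  funext c
  rw [dAffine, homogenize_self, homogenize_self, homogenize_homIndex, Ring.inverse_one, mul_one,
    zero_mul, zero_mul, sub_zero]

end Charts

/-! ### Functions on `V × ΠV` and forms on the projective superspace -/

section Matching

variable {n m N : ℕ}

/-- The function `L` is, over each chart, the value of the pull-back of the 1-form `w` at the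
differentials `dx_{1̂} = x_1`. -/
def Matches (L : PairFun n m)
    (w : (α : Fin m) → {j : Fin m // j ≠ α} ⊕ Fin n → ChartFun n α) : Prop :=
  ∀ (α : Fin m) (N : ℕ) (x y : Fin n ⊕ Fin m → Grassmann N), IsVector 0 x → IsVector 1 y →
    body (y (Sum.inr α)) ≠ 0 →
      eval (pair x y) L = evalForm (w α) (affine α y) (dAffine α y x)

lemma exists_coord_ne_zero {y : Fin n ⊕ Fin m → Grassmann N} (h : oddBody y ≠ 0) :
    ∃ α, body (y (Sum.inr α)) ≠ 0 := by
  by_contra! h'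
  exact h (funext h')

lemma evalForm_mul_left {ι : Type} [Fintype ι] [DecidableEq ι] {U : Opens (ι → ℝ)} {κ : Type}
    [Fintype κ] [LinearOrder κ] (τ : ι ⊕ κ → SuperFun U κ) (X dX : ι ⊕ κ → Grassmann N)
    (a : Grassmann N) : evalForm τ X (fun c => a * dX c) = a * evalForm τ X dX := by
  simp only [evalForm, Finset.mul_sum, mul_assoc]

variable {L : PairFun n m} {w : (α : Fin m) → {j : Fin m // j ≠ α} ⊕ Fin n → ChartFun n α}

lemma body_homogenize_one_ne_zero {α : Fin m}
    (u : {j : Fin m // j ≠ α} ⊕ Fin n → Grassmann N) :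
    body (homogenize α u 1 (Sum.inr α)) ≠ 0 := by
  rw [homogenize_self, map_one]
  exact one_ne_zero

/-- The normalization y^α̂ = 1, dy^α̂ = 0 is a section over the chart, so w is recovered from L. -/
lemma Matches.evalForm_eq (hw : Matches L w) {α : Fin m}
    {u du : {j : Fin m // j ≠ α} ⊕ Fin n → Grassmann N} (hu : IsPoint ⊤ u) (hdu : IsDiff du) :
    evalForm (w α) u du = eval (pair (homogenize α du 0) (homogenize α u 1)) L := by
  rw [hw α N _ _ (isVector_homogenize_zero hdu) (isVector_homogenize_one hu)
    (body_homogenize_one_ne_zero u), affine_homogenize, dAffine_homogenize]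

lemma exists_chartFun (f : OddFun n m) (α : Fin m) : ∃ g : ChartFun n α,
    ∀ (N : ℕ) (u : {j : Fin m // j ≠ α} ⊕ Fin n → Grassmann N), IsPoint ⊤ u →
      eval u g = eval (onPi (homogenize α u 1)) f := by
  obtain ⟨g, hg⟩ := Representable.comp (U := (⊤ : Opens ({j : Fin m // j ≠ α} → ℝ)))
    (κ := Fin n) f (φ := fun v j => if h : j = α then 1 else v ⟨j, h⟩)
    (contDiffOn_pi.2 fun j => by
      by_cases h : j = α
      · simp only [h, dite_true]
        exact contDiffOn_const
      · simp only [h, dite_false]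
        exact (contDiff_apply ℝ ℝ _).contDiffOn)
    (fun v _ h => by simpa using congrFun h α) fun i => Representable.coord (Sum.inr i)
  refine ⟨g, fun N u hu => (hg N u hu).trans ?_⟩
  refine congrArg (fun Y => eval Y f) (funext fun c => ?_)
  rcases c with j | i
  · by_cases h : j = α
    · simp only [Sum.elim_inl, h, dite_true]
      exact (taylor_const 1 _ hu.even).trans ((map_one _).trans (homogenize_self u 1).symm)
    · simp only [Sum.elim_inl, h, dite_false]
      exact (taylor_coord _ _ hu.even).trans (homogenize_homIndex u 1 (Sum.inl ⟨j, h⟩)).symm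
  · rfl

/-- A function `∑ x_1^A f_A` with the homogeneity property (BER) comes from the projective
superspace. -/
theorem exists_matches {f : Fin n ⊕ Fin m → OddFun n m} (hB : BER (omegaFun f)) :
    ∃ w, Matches (omegaFun f) w := by
  choose g hg using fun (α : Fin m) (A : Fin n ⊕ Fin m) => exists_chartFun (f A) α
  refine ⟨fun α c => g α (homIndex c), fun α N x y hx hy h => ?_⟩
  have hu := isPoint_affine (α := α) hy
  have hdu := isDiff_dAffine (α := α) hy hx
  have h1 : evalForm (fun c => g α (homIndex c)) (affine α y) (dAffine α y x) =
      eval (pair (homogenize α (dAffine α y x) 0) (homogenize α (affine α y) 1)) (omegaFun f) := by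
    rw [eval_omegaFun f (isVector_homogenize_zero hdu) (isVector_homogenize_one hu)
      (oddBody_ne_zero_of_coord (body_homogenize_one_ne_zero _)), sum_homIndex α,
      homogenize_self, zero_mul, zero_add, evalForm]
    refine Finset.sum_congr rfl fun c _ => ?_
    rw [homogenize_homIndex, hg α _ N _ hu]
  have hv := hy.even_coord α
  have hi := inverse_mem_part hv
  have hu' : IsUnit (y (Sum.inr α)) := isUnit_iff_body_ne_zero.2 h
  have hi' : IsUnit (Ring.inverse (y (Sum.inr α))) := hu'.ringInverse
  have hβ : -(x (Sum.inr α) * Ring.inverse (y (Sum.inr α)) ^ 2) ∈ part N 1 := by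
    have := mul_mem_part (hx.odd_coord α) (mul_mem_part hi hi)
    rw [add_zero, add_zero, ← sq] at this
    exact neg_mem this
  -- Here a = d = i is the inverse of y^α̂ and γ = 0, so the Berezinian is i i⁻¹ = 1.
  have h2 := hB N _ _ 0 _ hi hβ (zero_mem _) hi hi' hi' x y hx hy (oddBody_ne_zero_of_coord h)
  rw [h1, homogenize_affine hy h, homogenize_dAffine hy h]
  simp only [zero_mul, zero_add, mul_zero, sub_zero] at h2
  rw [h2, Ring.mul_inverse_cancel _ hi', mul_one]

/-- The shift y ↦ y + θx displaces the chart coordinates by θ du and leaves du unchanged, so the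
value of w changes by θ dw. -/
lemma Matches.eval_add_mul (hw : Matches L w) {α : Fin m} {x y : Fin n ⊕ Fin m → Grassmann N}
    (hx : IsVector 0 x) (hy : IsVector 1 y) (h : body (y (Sum.inr α)) ≠ 0) {θ : Grassmann N}
    (hθ : θ ∈ part N 1) : eval (pair x fun A => y A + θ * x A) L =
      eval (pair x y) L + θ * evalD (w α) (affine α y) (dAffine α y x) := by
  rw [hw α N x _ hx (isVector_add_mul_one hy hx hθ)
    (by rwa [map_add, map_mul, body_odd hθ, zero_mul, add_zero]), hw α N x y hx hy h,
    affine_add_mul hy h hx hθ, dAffine_add_mul hy h hx hθ,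
    evalForm_add_mul (isPoint_affine hy) (isDiff_dAffine hy hx) hθ]

lemma omegaFun_eval_add_mul (f : Fin n ⊕ Fin m → OddFun n m) {x y : Fin n ⊕ Fin m → Grassmann N}
    (hx : IsVector 0 x) (hy : IsVector 1 y) (h : oddBody y ≠ 0) {θ : Grassmann N}
    (hθ : θ ∈ part N 1) : eval (pair x fun A => y A + θ * x A) (omegaFun f) =
      eval (pair x y) (omegaFun f) +
        θ * evalD (fun c : Fin m ⊕ Fin n => f c.swap) (onPi y) (onPi x) := by
  have h1 := evalForm_add_mul (isPoint_onPi hy h) (isDiff_onPi hx) hθ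
    (fun c : Fin m ⊕ Fin n => f c.swap)
  rw [evalForm_onPi, evalForm_onPi] at h1
  simp only [Sum.swap_swap] at h1
  rw [eval_omegaFun f hx (isVector_add_mul_one hy hx hθ) (by rwa [oddBody_add_mul _ _ hθ]),
    eval_omegaFun f hx hy h]
  exact h1

/-- The form on `ΠV \ {0}` is closed if and only if the form on the projective superspace is. -/
theorem Matches.isClosedForm_iff {f : Fin n ⊕ Fin m → OddFun n m} (hw : Matches (omegaFun f) w) :
    (IsClosedForm fun c : Fin m ⊕ Fin n => f c.swap) ↔ ∀ α, IsClosedForm (w α) := by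
  -- Two first order expansions of the same value of L along y + θx: one on the punctured odd space,
  -- one in a chart.
  have key : ∀ (α : Fin m) (N : ℕ) (x y : Fin n ⊕ Fin m → Grassmann N) (θ : Grassmann N),
      IsVector 0 x → IsVector 1 y → body (y (Sum.inr α)) ≠ 0 → θ ∈ part N 1 →
      θ * evalD (fun c : Fin m ⊕ Fin n => f c.swap) (onPi y) (onPi x) =
        θ * evalD (w α) (affine α y) (dAffine α y x) := by
    intro α N x y θ hx hy h hθ
    have h1 := hw.eval_add_mul hx hy h hθ
    rw [omegaFun_eval_add_mul f hx hy (oddBody_ne_zero_of_coord h) hθ] at h1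
    exact add_left_cancel h1
  constructor
  · intro hf α
    refine isClosedForm_of_curl (curl_eq_zero fun N u du θ hu hdu hθ => ?_)
    have hy := isVector_homogenize_one hu
    have hx := isVector_homogenize_zero hdu
    have h := body_homogenize_one_ne_zero u
    have h1 := key α N _ _ θ hx hy h hθ
    rwa [affine_homogenize, dAffine_homogenize, hf N _ _
      (isPoint_onPi hy (oddBody_ne_zero_of_coord h)) (isDiff_onPi hx), mul_zero, eq_comm] at h1
  · intro hc
    refine isClosedForm_of_curl (curl_eq_zero fun N X dX θ hX hdX hθ => ?_)
    have hy := isVector_one_swap hX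
    have hx := isVector_zero_swap hdX
    obtain ⟨α, h⟩ := exists_coord_ne_zero (y := fun A => X A.swap) hX.2
    have h1 := key α N _ _ θ hx hy h hθ
    rwa [hc α N _ _ (isPoint_affine hy) (isDiff_dAffine hy hx), onPi_swap, onPi_swap,
      mul_zero] at h1

/-- Functions coming from closed forms on the projective superspace satisfy (BER). -/
theorem Matches.ber (hw : Matches L w) (hc : ∀ α, IsClosedForm (w α)) : BER L := by
  intro N a β γ d ha hβ hγ hd hua hud x y hx hy h
  obtain ⟨α, hα⟩ := exists_coord_ne_zero h
  have he := inverse_mem_part hd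
  have hθ : Ring.inverse d * γ ∈ part N 1 := by
    simpa only [zero_add] using mul_mem_part he hγ
  set e := Ring.inverse d
  have hde : d * e = 1 := Ring.mul_inverse_cancel d hud
  -- The group element is factored: with y' = y + θx and θ = d⁻¹γ, the new odd vector is d y' and
  -- the new even one is (a - βθ)x + βy'. The factor acting through y' is upper triangular and is
  -- handled by the scaling rules. The shift to y' is handled by closedness.
  set θ := e * γ
  set y' : Fin n ⊕ Fin m → Grassmann N := fun A => y A + θ * x A with hy'
  have hyv : IsVector 1 y' := isVector_add_mul_one hy hx hθ
  have hβθ : a - β * θ ∈ part N 0 := by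
    refine sub_mem ha ?_
    simpa only [one_add_one_eq_zero] using mul_mem_part hβ hθ
  have h1 : (fun A => γ * x A + d * y A) = fun A => d * y' A := by
    funext A
    rw [hy', mul_add, ← mul_assoc d θ, ← mul_assoc d e, hde, one_mul, add_comm]
  have h2 : (fun A => a * x A + β * y A) = fun A => (a - β * θ) * x A + β * y' A := by
    funext A
    rw [hy', mul_add, sub_mul, mul_assoc β θ]
    abel
  have hα' : body (y' (Sum.inr α)) ≠ 0 := by
    rwa [hy', map_add, map_mul, body_odd hθ, zero_mul, add_zero]
  have hdα : body (d * y' (Sum.inr α)) ≠ 0 := by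
    rw [map_mul]
    exact mul_ne_zero (isUnit_iff_body_ne_zero.1 hud) hα'
  have hx' : IsVector 0 fun A => (a - β * θ) * x A + β * y' A :=
    (isVector_even_mul hx hβθ).add (isVector_odd_mul_one hyv hβ)
  -- The only use of dw = 0: the lower unipotent shift does not change L.
  have h3 := hw.eval_add_mul hx hy hα hθ
  rw [hc α N _ _ (isPoint_affine hy) (isDiff_dAffine hy hx), mul_zero, add_zero,
    hw α N x y' hx hyv hα'] at h3
  have hber : (a - β * θ) * e ∈ part N 0 := by
    simpa only [zero_add] using mul_mem_part hβθ he
  rw [h1, h2, hw α N _ _ hx' (isVector_even_mul hyv hd) hdα, affine_mul y' hd hud,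
    dAffine_mul y' hd hud, dAffine_add hyv hα', evalForm_mul_left, evalForm_mul_left, h3,
    mul_assoc β e γ]
  change e * ((a - β * θ) * _) = _ * ((a - β * θ) * e)
  rw [← even_commute hber, even_commute hβθ e, mul_assoc]

end Matching

/-! ### Gluing -/

section Glue

variable {ι : Type} [Fintype ι] [DecidableEq ι] {U : Opens (ι → ℝ)} {κ : Type} [Fintype κ]
  [LinearOrder κ]

open scoped Classical in
lemma exists_glue {J : Type} {V : J → Opens (ι → ℝ)} (hV : ∀ x, x ∈ U ↔ ∃ j, x ∈ V j)
    (h : ∀ j, SuperFun (V j) κ)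
    (hh : ∀ j k x, x ∈ V j → x ∈ V k → ∀ I, (h j).1 I x = (h k).1 I x) :
    ∃ f : SuperFun U κ, ∀ (j : J) (N : ℕ) (X : ι ⊕ κ → Grassmann N), IsPoint (V j) X →
      eval X f = eval X (h j) := by
  set F : Finset κ → (ι → ℝ) → ℝ := fun I x =>
    if hx : ∃ j, x ∈ V j then (h hx.choose).1 I x else 0 with hF
  have hFV : ∀ j x, x ∈ V j → ∀ I, F I x = (h j).1 I x := by
    intro j x hx I
    have hex : ∃ j, x ∈ V j := ⟨j, hx⟩
    simp only [hF, dif_pos hex]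
    exact hh _ _ _ hex.choose_spec hx I
  have hev : ∀ j x, x ∈ V j → ∀ I, F I =ᶠ[nhds x] (h j).1 I := fun j x hx I => by
    filter_upwards [(V j).2.mem_nhds hx] with z hz using hFV j z hz I
  refine ⟨⟨F, fun I => ⟨fun x hx => ?_, fun x hx => dif_neg fun hx' => hx ((hV x).2 hx')⟩⟩,
    fun j N X hX => ?_⟩
  · obtain ⟨j, hj⟩ := (hV x).1 hx
    exact ((contDiffAt_coeff (h j) I hj).congr_of_eventuallyEq (hev j x hj I)).contDiffWithinAt
  · rw [eval_eq_sum hX.2, eval_eq_sum ((hV _).2 ⟨j, hX.2⟩)]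
    refine Finset.sum_congr rfl fun I _ => ?_
    congr 1
    exact taylor_congr (hev j _ hX.2 I)

end Glue

/-! ### Pull-backs from the affine charts and their gluing on the punctured odd space -/

section GlueForms

variable {n m N : ℕ}

/-- The open set of odd vectors with non-zero coordinate `α`. -/
def coordOpen (α : Fin m) : Opens (Fin m → ℝ) :=
  ⟨{v | v α ≠ 0}, isOpen_ne_fun (continuous_apply α) continuous_const⟩

/-- Multiplicativity of evaluation applied to v · v⁻¹ = 1, which holds near the body of the point.
-/
lemma taylor_inv {α : Fin m} {x : Fin m → Grassmann N} (hx : ∀ j, x j ∈ part N 0)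
    (h : body (x α) ≠ 0) : taylor (fun v => (v α)⁻¹) x = Ring.inverse (x α) := by
  have hinv : ContDiffAt ℝ ∞ (fun v : Fin m → ℝ => (v α)⁻¹) fun j => body (x j) :=
    (contDiff_apply ℝ ℝ α).contDiffAt.inv h
  have h1 := taylor_mul hx (contDiff_apply ℝ ℝ α).contDiffAt hinv
  have h2 : (fun v : Fin m → ℝ => v α * (v α)⁻¹) =ᶠ[nhds fun j => body (x j)] fun _ => 1 := by
    filter_upwards [(coordOpen α).2.mem_nhds h] with v hv using mul_inv_cancel₀ hv
  rw [taylor_congr h2, taylor_const _ _ hx, taylor_coord _ _ hx, map_one] at h1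
  exact (inverse_eq_of_mul_eq_one h1.symm (by rw [← even_commute (hx α), ← h1])).symm

lemma contDiffOn_inv_coord (α : Fin m) :
    ContDiffOn ℝ ∞ (fun v : Fin m → ℝ => (v α)⁻¹) (coordOpen α) :=
  (contDiff_apply ℝ ℝ α).contDiffOn.inv fun _ hx => hx

lemma representable_inverse (α : Fin m) : Representable (κ := Fin n) (coordOpen α)
    fun _ Y => Ring.inverse (Y (Sum.inl α)) :=
  (Representable.even (contDiffOn_inv_coord α)).congr fun _ _ hY => taylor_inv hY.even hY.2

lemma representable_affine {α : Fin m} (g : ChartFun n α) : Representable (coordOpen α)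
    fun _ Y => eval (affine α fun A => Y A.swap) g := by
  refine (Representable.comp (U := coordOpen α) (κ := Fin n) g
    (φ := fun v j => v j * (v α)⁻¹) (contDiffOn_pi.2 fun j =>
      (contDiff_apply ℝ ℝ j.1).contDiffOn.mul (contDiffOn_inv_coord α)) (fun _ _ => trivial)
    (fun i => (Representable.coord (Sum.inr i)).mul (representable_inverse α))).congr
    fun N Y hY => ?_
  refine congrArg (fun Y => eval Y g) (funext fun c => ?_)
  rcases c with j | i
  · refine (taylor_mul hY.even (contDiff_apply ℝ ℝ j.1).contDiffAt
      ((contDiffOn_inv_coord α).contDiffAt ((coordOpen α).2.mem_nhds hY.2))).trans ?_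
    rw [taylor_inv hY.even hY.2, taylor_coord _ _ hY.even]
    rfl
  · rfl

variable {w : (α : Fin m) → {j : Fin m // j ≠ α} ⊕ Fin n → ChartFun n α}

/-- The pull-back of a 1-form from an affine chart. -/
lemma exists_pullback (α : Fin m) (τ : {j : Fin m // j ≠ α} ⊕ Fin n → ChartFun n α) :
    ∃ h : Fin n ⊕ Fin m → SuperFun (coordOpen α) (Fin n),
      ∀ (N : ℕ) (x y : Fin n ⊕ Fin m → Grassmann N), IsVector 1 y →
        body (y (Sum.inr α)) ≠ 0 →
        evalForm τ (affine α y) (dAffine α y x) = ∑ A, x A * eval (onPi y) (h A) := by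
  have hinv := representable_inverse (n := n) α
  choose g hg using fun c => hinv.mul (representable_affine (τ c))
  -- In du^c = dy^c i - dy^α̂ y^c i², the coefficient of dy^α̂ collects a contribution from every c.
  -- The pull-back thus has the coefficient -Σ y^c i g_c at α̂ and g_c elsewhere, where g_c is i
  -- times the pulled-back coefficient of du^c.
  obtain ⟨s, hs⟩ := Representable.sum Finset.univ fun c : {j : Fin m // j ≠ α} ⊕ Fin n =>
    ((Representable.coord (homIndex c).swap).mul hinv).mul (Representable.of_eval (g c))
  refine ⟨fun A => if hA : ∃ c, A = homIndex c then g hA.choose else (-1 : ℝ) • s,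
    fun N x y hy h => ?_⟩
  have hY : IsPoint (coordOpen α) (onPi y) :=
    ⟨(isPoint_onPi hy (oddBody_ne_zero_of_coord h)).1, h⟩
  have hinj : ∀ c c' : {j : Fin m // j ≠ α} ⊕ Fin n, homIndex c = homIndex c' → c = c' := by
    rintro (j | i) (j' | i') h'
    · exact congrArg Sum.inl (Subtype.ext (Sum.inr_injective h'))
    · cases h'
    · cases h'
    · exact congrArg Sum.inr (Sum.inl_injective h')
  have hα : ¬ ∃ c : {j : Fin m // j ≠ α} ⊕ Fin n, Sum.inr α = homIndex c := by
    rintro ⟨j | i, h'⟩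
    · exact j.2 (Sum.inr_injective h').symm
    · cases h'
  have hc : ∀ c : {j : Fin m // j ≠ α} ⊕ Fin n, ∃ c', (homIndex c : Fin n ⊕ Fin m) = homIndex c' :=
    fun c => ⟨c, rfl⟩
  have hchoose : ∀ c : {j : Fin m // j ≠ α} ⊕ Fin n, (hc c).choose = c :=
    fun c => (hinj _ _ (hc c).choose_spec).symm
  have hswap : (fun A : Fin n ⊕ Fin m => onPi y A.swap) = y := by
    funext A
    simp [onPi]
  have hg' : ∀ c, eval (onPi y) (g c) =
      Ring.inverse (y (Sum.inr α)) * eval (affine α y) (τ c) := fun c => by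
    rw [hg c N _ hY]
    beta_reduce
    rw [hswap]
    rfl
  rw [sum_homIndex α]
  beta_reduce
  rw [dif_neg hα, map_smul, hs N _ hY, neg_one_smul, mul_neg, Finset.mul_sum,
    ← Finset.sum_neg_distrib, ← Finset.sum_add_distrib, evalForm]
  refine Finset.sum_congr rfl fun c _ => ?_
  rw [dif_pos (hc c), hchoose, hg']
  simp only [onPi, Sum.swap_swap, Sum.swap_inl, dAffine, sub_mul, sq, mul_assoc]
  abel

/-- The pull-backs from two charts agree as forms where both are defined. Testing at a generic point
with x concentrated at one index shows that their coefficients agree there, and these coefficients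
glue over the cover of the punctured space. -/
theorem exists_matches_of_compatible
    (hw : ∀ (α β : Fin m) (N : ℕ) (x y : Fin n ⊕ Fin m → Grassmann N), IsVector 0 x →
      IsVector 1 y → body (y (Sum.inr α)) ≠ 0 → body (y (Sum.inr β)) ≠ 0 →
      evalForm (w α) (affine α y) (dAffine α y x) = evalForm (w β) (affine β y) (dAffine β y x)) :
    ∃ f : Fin n ⊕ Fin m → OddFun n m, Matches (omegaFun f) w := by
  choose h hh using fun α => exists_pullback α (w α)
  have hglue : ∀ A, ∃ f : OddFun n m, ∀ (α : Fin m) (N : ℕ) (Y : Fin m ⊕ Fin n → Grassmann N),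
      IsPoint (coordOpen α) Y → eval Y f = eval Y (h α A) := by
    intro A
    refine exists_glue (fun v => ?_) (fun α => h α A) fun α β v hα hβ I => ?_
    · exact Function.ne_iff
    set Y := genericPoint (Fin n) v
    have hbody : ∀ j, body (Y (Sum.inl j)) = v j := fun j => body_algebraMap _
    have hY : IsPoint (puncture m) Y := isPoint_genericPoint (Function.ne_iff.2 ⟨α, hα⟩)
    set s := spareProd (Fin n) (probe 1 (par A))
    have hx : IsVector 0 (Pi.single A s : Fin n ⊕ Fin m → Grassmann _) := by
      intro B
      rcases eq_or_ne B A with rfl | hBA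
      · simpa using probe_mem_part 1 (par B)
      · simp [hBA]
    have hsum : ∀ γ, ∑ B, (Pi.single A s : Fin n ⊕ Fin m → Grassmann _) B * eval Y (h γ B) =
        s * eval Y (h γ A) := by
      intro γ
      rw [Finset.sum_eq_single A]
      · simp
      · intro B _ hBA
        simp [hBA]
      · simp
    have hα' : body (Y (Sum.inl α)) ≠ 0 := by rwa [hbody]
    have hβ' : body (Y (Sum.inl β)) ≠ 0 := by rwa [hbody]
    have h1 := hw α β _ _ _ hx (isVector_one_swap hY) hα' hβ'
    rw [hh α _ _ _ (isVector_one_swap hY) hα', hh β _ _ _ (isVector_one_swap hY) hβ', onPi_swap,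
      hsum, hsum, eval_genericPoint hα, eval_genericPoint hβ, ← sub_eq_zero, ← mul_sub,
      ← Finset.sum_sub_distrib] at h1
    simp only [← sub_smul] at h1
    refine sub_eq_zero.1 (eq_zero_of_spareProd_mul_sum
      (c := fun I => (h α A).1 I v - (h β A).1 I v) ?_ h1 I)
    unfold probe; split_ifs <;> simp
  choose f hf using hglue
  refine ⟨f, fun α N x y hx hy hα => ?_⟩
  have hY : IsPoint (coordOpen α) (onPi y) :=
    ⟨(isPoint_onPi hy (oddBody_ne_zero_of_coord hα)).1, hα⟩
  rw [eval_omegaFun f hx hy (oddBody_ne_zero_of_coord hα), hh α N x y hy hα]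
  simp only [hf _ α N _ hY]

end GlueForms

/-! ### Changes of frame -/

section Frames

variable {n m N : ℕ} {V₀ V₁ : Type*} [AddCommGroup V₀] [Module ℝ V₀] [AddCommGroup V₁]
  [Module ℝ V₁] (b b' : Frame n m V₀ V₁)

lemma changeFrame_self (x : Fin n ⊕ Fin m → Grassmann N) : changeFrame b b x = x := by
  funext A
  rcases A with i | j <;> simp [changeFrame, Finsupp.single_apply, ite_smul]

lemma changeFrame_mul (a : Grassmann N) (x : Fin n ⊕ Fin m → Grassmann N) :
    changeFrame b b' (fun A => a * x A) = fun A => a * changeFrame b b' x A := by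
  funext A
  rcases A with i | j <;> simp [changeFrame, Finset.mul_sum]

lemma changeFrame_add (x y : Fin n ⊕ Fin m → Grassmann N) :
    changeFrame b b' (fun A => x A + y A) =
      fun A => changeFrame b b' x A + changeFrame b b' y A := by
  funext A
  rcases A with i | j <;> simp [changeFrame, Finset.sum_add_distrib]

variable {x y : Fin n ⊕ Fin m → Grassmann N}

lemma IsVector.changeFrame {p : ZMod 2} (hx : IsVector p x) :
    IsVector p (changeFrame b b' x) := fun A => by
  rcases A with i | j
  · exact sum_mem fun k _ => Submodule.smul_mem _ _ (hx (Sum.inl k))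
  · exact sum_mem fun k _ => Submodule.smul_mem _ _ (hx (Sum.inr k))

lemma oddBody_changeFrame_ne_zero (h : oddBody y ≠ 0) : oddBody (changeFrame b b' y) ≠ 0 := by
  contrapose! h
  have h1 : b'.odd.repr (∑ k, oddBody y k • b.odd k) = 0 := by
    ext j
    have := congrFun h j
    simp only [oddBody, SuperGeom.changeFrame, map_sum, map_smul, Pi.zero_apply, smul_eq_mul] at this
    simp only [map_sum, map_smul, Finsupp.coe_finsetSum, Finset.sum_apply, Finsupp.coe_smul,
      Pi.smul_apply, smul_eq_mul, Finsupp.coe_zero, Pi.zero_apply]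
    rw [← this]
    exact Finset.sum_congr rfl fun k _ => mul_comm _ _
  have h2 := Fintype.linearIndependent_iff.1 b.odd.linearIndependent (oddBody y)
    ((map_eq_zero_iff _ b'.odd.repr.injective).1 h1)
  exact funext h2

end Frames

/-! ### Comparison of functions on `V × ΠV` with forms on `ΠV` and on `P(ΠV)` -/

section Comparison

variable {n m N : ℕ} {V₀ V₁ : Type*} [AddCommGroup V₀] [Module ℝ V₀] [AddCommGroup V₁]
  [Module ℝ V₁]

/-- The compatibility defining a form on P(ΠV) is stated for normalized coordinates. After
normalization by i, the inverse of y^α̂, the base point contributes i⁻¹, the tangent vector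
contributes i, and the multiple of y is killed. The law therefore holds for all homogeneous
coordinates. -/
lemma ProjForm.evalForm_eq (w : ProjForm n m V₀ V₁) (b b' : Frame n m V₀ V₁) {α β : Fin m}
    {x y : Fin n ⊕ Fin m → Grassmann N} (hx : IsVector 0 x) (hy : IsVector 1 y)
    (hα : body (y (Sum.inr α)) ≠ 0) (hβ : body (changeFrame b b' y (Sum.inr β)) ≠ 0) :
    evalForm (w.1 b' β) (affine β (changeFrame b b' y))
        (dAffine β (changeFrame b b' y) (changeFrame b b' x)) =
      evalForm (w.1 b α) (affine α y) (dAffine α y x) := by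
  have hi := inverse_mem_part (hy.even_coord α)
  have hu : IsUnit (Ring.inverse (y (Sum.inr α))) :=
    (isUnit_iff_body_ne_zero.2 hα).ringInverse
  have hy' := hy.changeFrame b b'
  have h1 := w.2 b b' α β N _ _ _ _ (isPoint_affine hy) (isDiff_dAffine (α := α) hy hx) rfl rfl
  rw [homogenize_affine hy hα, homogenize_dAffine hy hα, changeFrame_mul, changeFrame_add,
    changeFrame_mul, changeFrame_mul, affine_mul _ hi hu, dAffine_mul _ hi hu,
    dAffine_add hy' hβ, evalForm_mul_left, evalForm_mul_left, ← mul_assoc,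
    Ring.inverse_mul_cancel _ hu, one_mul] at h1
  refine h1 ?_
  rw [map_mul]
  exact mul_ne_zero (isUnit_iff_body_ne_zero.1 hu) hβ

/-- The function `L` corresponds to the 1-form `w` on `P(ΠV)`. -/
def Corresponds (L : VectorFun n m V₀ V₁) (w : ProjForm n m V₀ V₁) : Prop :=
  ∀ b, Matches (L.1 b) (w.1 b)

variable {L L' : VectorFun n m V₀ V₁} {η η' : PiForm n m V₀ V₁} {w w' : ProjForm n m V₀ V₁}

lemma Corresponds.add (h : Corresponds L w) (h' : Corresponds L' w') :
    Corresponds (L + L') (w + w') := by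
  intro b α N x y hx hy hα
  change eval _ (L.1 b + L'.1 b) = evalForm (w.1 b α + w'.1 b α) _ _
  rw [map_add, evalForm_add, h b α N x y hx hy hα, h' b α N x y hx hy hα]

lemma Corresponds.smul (h : Corresponds L w) (r : ℝ) : Corresponds (r • L) (r • w) := by
  intro b α N x y hx hy hα
  change eval _ (r • L.1 b) = evalForm (r • w.1 b α) _ _
  rw [map_smul, evalForm_smul, h b α N x y hx hy hα]

/-- Over each chart w is read off from L on the normalized section, and a form is determined by its
values. -/
lemma Corresponds.right_unique (h : Corresponds L w) (h' : Corresponds L w') : w = w' := by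
  refine Subtype.ext (funext fun b => funext fun α => form_ext fun N u du hu hdu => ?_)
  rw [(h b).evalForm_eq hu hdu, (h' b).evalForm_eq hu hdu]

/-- Every nonzero odd vector lies over some chart, so w determines all values of L. -/
lemma Corresponds.left_unique (h : Corresponds L w) (h' : Corresponds L' w) : L = L' := by
  refine Subtype.ext (funext fun b => pairFun_ext fun N x y hx hy hy0 => ?_)
  obtain ⟨α, hα⟩ := exists_coord_ne_zero hy0
  rw [h b α N x y hx hy hα, h' b α N x y hx hy hα]

lemma IsOmega.eq_omegaFun (h : IsOmega L η) (b : Frame n m V₀ V₁) :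
    L.1 b = omegaFun fun A => η.1 b A.swap :=
  pairFun_ext fun N x y hx hy hy0 => by rw [h b N x y hx hy hy0, eval_omegaFun _ hx hy hy0]

lemma IsOmega.evalForm_eq (h : IsOmega L η) (b : Frame n m V₀ V₁)
    {x y : Fin n ⊕ Fin m → Grassmann N} (hx : IsVector 0 x) (hy : IsVector 1 y)
    (hy0 : oddBody y ≠ 0) : evalForm (η.1 b) (onPi y) (onPi x) = eval (pair x y) (L.1 b) := by
  rw [evalForm_onPi, h b N x y hx hy hy0]

lemma IsOmega.unique (h : IsOmega L η) (h' : IsOmega L η') : η = η' := by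
  refine Subtype.ext (funext fun b => form_ext fun N X dX hX hdX => ?_)
  have h1 := h.evalForm_eq b (isVector_zero_swap hdX) (isVector_one_swap hX) hX.2
  have h2 := h'.evalForm_eq b (isVector_zero_swap hdX) (isVector_one_swap hX) hX.2
  rw [onPi_swap, onPi_swap] at h1 h2
  rw [h1, h2]

/-- Independence of the frame need not be checked on coefficients: the value of ω at (x_1̂, dx_1̂ =
x_1) is the value of L, which is invariant. -/
lemma exists_isOmega (h : ∀ b, ∃ f, L.1 b = omegaFun f) :
    ∃ η : PiForm n m V₀ V₁, IsOmega L η := by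
  choose f hf using h
  have key : ∀ (b : Frame n m V₀ V₁) (N : ℕ) (x y : Fin n ⊕ Fin m → Grassmann N), IsVector 0 x →
      IsVector 1 y → oddBody y ≠ 0 → eval (pair x y) (L.1 b) =
        ∑ A, x A * eval (onPi y) (f b A.swap.swap) := by
    intro b N x y hx hy hy0
    rw [hf b, eval_omegaFun _ hx hy hy0]
    simp only [Sum.swap_swap]
  refine ⟨⟨fun b c => f b c.swap, fun b b' N y x hy hx hy0 => ?_⟩, key⟩
  rw [evalForm_onPi, evalForm_onPi, ← key b N x y hx hy hy0, ← key b' N _ _ (hx.changeFrame b b')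
    (hy.changeFrame b b') (oddBody_changeFrame_ne_zero b b' hy0), L.2 b b' N x y hx hy hy0]

lemma IsOmega.isClosedForm_iff (h : IsOmega L η) (b : Frame n m V₀ V₁) :
    IsClosedForm (η.1 b) ↔ PDE (L.1 b) := by
  rw [h.eq_omegaFun b, ← isClosedForm_iff_PDE]
  simp only [Sum.swap_swap]

/-- The values of L are those of ω at dx_1̂ = x_1, so both sides compare the same two expressions.
-/
lemma IsOmega.corresponds_iff (h : IsOmega L η) : Corresponds L w ↔ DescendsTo η w := by
  constructor
  · intro hw b α N y x hy hx hα
    rw [h.evalForm_eq b hx hy (oddBody_ne_zero_of_coord hα), hw b α N x y hx hy hα]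
  · intro hw b α N x y hx hy hα
    rw [← h.evalForm_eq b hx hy (oddBody_ne_zero_of_coord hα), hw b α N y x hy hx hα]

/-- The chart forms agree on overlaps, and under changes of frame, because all of them are read off
from the one invariant function L. -/
lemma IsOmega.exists_corresponds (h : IsOmega L η) (hL : ∀ b, BER (L.1 b)) :
    ∃ w : ProjForm n m V₀ V₁, Corresponds L w := by
  have h1 : ∀ b, ∃ w, Matches (L.1 b) w := fun b => by
    have hb := hL b
    rw [h.eq_omegaFun b] at hb ⊢
    exact exists_matches hb
  choose w hw using h1
  refine ⟨⟨w, ?_⟩, hw⟩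
  rintro b b' α β N u du _ _ hu hdu rfl rfl hβ
  have hy := isVector_homogenize_one hu
  have hx := isVector_homogenize_zero hdu
  rw [(hw b).evalForm_eq hu hdu, ← hw b' β N _ _ (hx.changeFrame b b') (hy.changeFrame b b') hβ]
  exact L.2 b b' N _ _ hx hy (oddBody_ne_zero_of_coord (body_homogenize_one_ne_zero u))

lemma IsOmega.mem_closedProjForm_iff (h : IsOmega L η) (hw : Corresponds L w) :
    w ∈ ClosedProjForm n m V₀ V₁ ↔ ∀ b, PDE (L.1 b) := by
  have key : ∀ b, (∀ α, IsClosedForm (w.1 b α)) ↔ PDE (L.1 b) := by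
    intro b
    have hb := hw b
    rw [h.eq_omegaFun b] at hb
    rw [← h.isClosedForm_iff b, ← hb.isClosedForm_iff]
    simp only [Sum.swap_swap]
  exact ⟨fun hc b => (key b).1 (hc b), fun hp b => (key b).2 (hp b)⟩

/-- Every 1-form on `P(ΠV)` comes from a function that is linear in the even vector. -/
lemma ProjForm.exists_corresponds (w : ProjForm n m V₀ V₁) :
    ∃ (L : VectorFun n m V₀ V₁) (η : PiForm n m V₀ V₁), IsOmega L η ∧ Corresponds L w := by
  have h1 : ∀ b, ∃ f, Matches (omegaFun f) (w.1 b) := fun b =>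
    exists_matches_of_compatible fun α β N x y hx hy hα hβ => by
      have := ProjForm.evalForm_eq w b b hx hy hα (β := β) (by rwa [changeFrame_self])
      rw [changeFrame_self, changeFrame_self] at this
      exact this.symm
  choose f hf using h1
  have hL : (fun b => omegaFun (f b)) ∈ VectorFun n m V₀ V₁ := by
    intro b b' N x y hx hy hy0
    obtain ⟨α, hα⟩ := exists_coord_ne_zero hy0
    obtain ⟨β, hβ⟩ := exists_coord_ne_zero (oddBody_changeFrame_ne_zero b b' hy0)
    rw [hf b α N x y hx hy hα,
      hf b' β N _ _ (hx.changeFrame b b') (hy.changeFrame b b') hβ,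
      ProjForm.evalForm_eq w b b' hx hy hα hβ]
  obtain ⟨η, hη⟩ := exists_isOmega (L := ⟨_, hL⟩) fun b => ⟨f b, rfl⟩
  exact ⟨⟨_, hL⟩, η, hη, hf⟩

lemma exists_isOmega_of_mem_VZForm (hL : L ∈ VZForm n m V₀ V₁) :
    ∃ η : PiForm n m V₀ V₁, IsOmega L η :=
  exists_isOmega fun b => exists_eq_omegaFun (hL b).1 (hL b).2

/-- Parity of a function or of a form is visible on its values, and the values of L and w coincide.
The shifts in `FormHasParity` are absorbed by the parity of the differentials. -/
lemma Corresponds.hasParity_iff (h : Corresponds L w) (p : ZMod 2) (b : Frame n m V₀ V₁) :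
    HasParity p (L.1 b) ↔ ∀ α, FormHasParity p (w.1 b α) := by
  constructor
  · intro hp α
    refine formHasParity_iff.2 fun N u du hu hdu => ?_
    rw [(h b).evalForm_eq hu hdu]
    exact eval_mem_part (isPoint_pair (isVector_homogenize_zero hdu) (isVector_homogenize_one hu)
      (oddBody_ne_zero_of_coord (body_homogenize_one_ne_zero u))) hp
  · intro hp
    refine SuperGeom.hasParity_iff.2 fun N X hX => ?_
    obtain ⟨α, hα⟩ := exists_coord_ne_zero hX.oddBody_ne_zero
    rw [← pair_argVec X, h b α N _ _ (hX.isVector 0) (hX.isVector 1) hα]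
    exact evalForm_mem_part (hp α) (isPoint_affine (hX.isVector 1))
      (isDiff_dAffine (hX.isVector 1) (hX.isVector 0))

/-- The `1|1`-forms on `V` are the closed 1-forms on `P(ΠV)`. -/
theorem exists_linearEquiv : ∃ Φ : VZForm n m V₀ V₁ ≃ₗ[ℝ] ClosedProjForm n m V₀ V₁,
    ∀ L, Corresponds L.1 (Φ L).1 := by
  have h1 : ∀ L : VZForm n m V₀ V₁, ∃ w : ClosedProjForm n m V₀ V₁, Corresponds L.1 w.1 := by
    intro L
    obtain ⟨η, hη⟩ := exists_isOmega_of_mem_VZForm L.2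
    obtain ⟨w, hw⟩ := hη.exists_corresponds fun b => (L.2 b).1
    exact ⟨⟨w, (hη.mem_closedProjForm_iff hw).2 fun b => (L.2 b).2⟩, hw⟩
  choose φ hφ using h1
  let Φ : VZForm n m V₀ V₁ →ₗ[ℝ] ClosedProjForm n m V₀ V₁ :=
    { toFun := φ
      map_add' := fun L L' => Subtype.ext ((hφ _).right_unique ((hφ L).add (hφ L')))
      map_smul' := fun r L => Subtype.ext ((hφ _).right_unique ((hφ L).smul r)) }
  refine ⟨LinearEquiv.ofBijective Φ ⟨fun L L' h => ?_, fun w => ?_⟩, hφ⟩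
  · have h' := hφ L'
    rw [← show φ L = φ L' from h] at h'
    exact Subtype.ext ((hφ L).left_unique h')
  -- Surjectivity. Every form on P(ΠV) comes from some L = x_1^a L_a; closedness is used twice, once
  -- for (BER) and once for (PDE).
  · obtain ⟨L, η, hη, hw⟩ := ProjForm.exists_corresponds w.1
    have hL : L ∈ VZForm n m V₀ V₁ := fun b =>
      ⟨(hw b).ber fun α => w.2 b α, (hη.mem_closedProjForm_iff hw).1 w.2 b⟩
    exact ⟨⟨L, hL⟩, Subtype.ext ((hφ ⟨L, hL⟩).right_unique hw)⟩

end Comparison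

end SuperGeom

end

/-! ### The correspondence between 1|1-forms on V and closed 1-forms on P(ΠV) -/

theorem mainTheorem1 (n m : ℕ) (V₀ V₁ : Type*) [AddCommGroup V₀] [Module ℝ V₀]
    [FiniteDimensional ℝ V₀] [AddCommGroup V₁] [Module ℝ V₁] [FiniteDimensional ℝ V₁]
    (hV₀ : Module.finrank ℝ V₀ = n) (hV₁ : Module.finrank ℝ V₁ = m) :
    -- every 1|1-form is `x_1^a L_a` for unique functions `L_a`, so that `ω_L` makes sense
    (∀ L ∈ SuperGeom.VZForm n m V₀ V₁, ∃! η : SuperGeom.PiForm n m V₀ V₁,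
      SuperGeom.IsOmega L η) ∧
    -- closedness of `ω_L` is equivalent to the system of differential equations for `L`
    (∀ (L : SuperGeom.VectorFun n m V₀ V₁) (η : SuperGeom.PiForm n m V₀ V₁),
      SuperGeom.IsOmega L η →
        ((∀ b, SuperGeom.IsClosedForm (η.1 b)) ↔ ∀ b, SuperGeom.PDE (L.1 b))) ∧
    -- `ω_L` descends to the projective superspace, and the same equivalence holds there
    (∀ (L : SuperGeom.VectorFun n m V₀ V₁) (η : SuperGeom.PiForm n m V₀ V₁),
      SuperGeom.IsOmega L η → (∀ b, SuperGeom.BER (L.1 b)) →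
        (∃! w : SuperGeom.ProjForm n m V₀ V₁, SuperGeom.DescendsTo η w) ∧
        ∀ w : SuperGeom.ProjForm n m V₀ V₁, SuperGeom.DescendsTo η w →
          (w ∈ SuperGeom.ClosedProjForm n m V₀ V₁ ↔ ∀ b, SuperGeom.PDE (L.1 b))) ∧
    -- the resulting map from 1|1-forms to closed 1-forms is an (even) linear isomorphism
    (∃ Φ : SuperGeom.VZForm n m V₀ V₁ ≃ₗ[ℝ] SuperGeom.ClosedProjForm n m V₀ V₁,
      (∀ (L : SuperGeom.VZForm n m V₀ V₁) (η : SuperGeom.PiForm n m V₀ V₁),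
        SuperGeom.IsOmega L.1 η → SuperGeom.DescendsTo η (Φ L).1) ∧
      ∀ (L : SuperGeom.VZForm n m V₀ V₁) (p : ZMod 2),
        (∀ b, SuperGeom.HasParity p (L.1.1 b)) ↔
          ∀ b α, SuperGeom.FormHasParity p ((Φ L).1.1 b α)) := by
  refine ⟨fun L hL => ?_, fun L η h => ?_, fun L η h hB => ⟨?_, fun w hw => ?_⟩, ?_⟩
  · obtain ⟨η, hη⟩ := SuperGeom.exists_isOmega_of_mem_VZForm hL
    exact ⟨η, hη, fun η' h' => SuperGeom.IsOmega.unique h' hη⟩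
  · exact forall_congr' fun b => h.isClosedForm_iff b
  · obtain ⟨w, hw⟩ := h.exists_corresponds hB
    exact ⟨w, h.corresponds_iff.1 hw, fun w' hw' =>
      (h.corresponds_iff.2 hw').right_unique hw⟩
  · exact h.mem_closedProjForm_iff (h.corresponds_iff.2 hw)
  · obtain ⟨Φ, hΦ⟩ := SuperGeom.exists_linearEquiv (n := n) (m := m) (V₀ := V₀) (V₁ := V₁)
    exact ⟨Φ, fun L η h => h.corresponds_iff.1 (hΦ L),
      fun L p => forall_congr' fun b => (hΦ L).hasParity_iff p b⟩
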